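/- Let $M$ be a smooth manifold of dimension $n\ge 1$ and let $F$ be a Finsler structure on $M$: a positive smooth function on $TM_0=TM\setminus 0$, positively homogeneous of degree one on the fibres, such that $g_{ij}=\tfrac12[F^2]_{y^iy^j}$ is positive definite. Put $G^i=\tfrac14 g^{ij}([F^2]_{y^jx^k}y^k-[F^2]_{x^j})$, $\delta y^i=\tfrac1F\bigl(dy^i+\tfrac{\partial G^i}{\partial y^j}dx^j\bigr)$ and $A_{ijk}=\tfrac14F[F^2]_{y^iy^jy^k}$. Let $\pi:SM=TM_0/\mathbb R^+\to M$ be the projective sphere bundle, $g=g_{ij}dx^i\otimes dx^j$ the metric on $\pi^*TM$ defined by $F$, and $l=y/F$ the distinguished section of $\pi^*TM$. Let $g^{T(SM)}=g_{ij}dx^i\otimes dx^j+(g_{ij}-F_{y^i}F_{y^j})\delta y^i\otimes\delta y^j$ be the Sasaki-type Riemannian metric on $SM$; it has a Levi-Civita connection $\nabla^{T(SM)}$. Let $\mathcal F=V(SM)=\ker d\pi$ be the tangent bundle of the foliation of $SM$ by the vertical spheres, $\mathcal F^\perp=H(SM)$ its orthogonal complement, identified with $\pi^*TM$ by $d\pi$,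 and let $p,p^\perp$ be the orthogonal projections onto $\mathcal F,\mathcal F^\perp$. The Bott connection $\tilde\nabla$ on $H(SM)$ is given by $\tilde\nabla_XU=p^\perp[X,U]$ for $X$ vertical and $\tilde\nabla_XU=p^\perp\nabla^{T(SM)}_XU$ for $X$ horizontal. Its dual connection $\tilde\nabla^*$ is determined by $d\langle V,U\rangle=\langle\tilde\nabla V,U\rangle+\langle V,\tilde\nabla^*U\rangle$, the Cartan endomorphism is $H=\tfrac12(\tilde\nabla^*-\tilde\nabla)$, and the symmetrization of $\tilde\nabla$ is $\hat\nabla=\tilde\nabla+H$. (1) Let $\mathbf e_1,\dots,\mathbf e_n$ be a smooth orthonormal frame of $H(SM)$ over an open subset of $SM$, with $\mathbf e_n$ corresponding to $l$; let $\vartheta=(\omega^1,\dots,\omega^n)$ be the dual one-forms, vanishing on $V(SM)$, and let $H_{ij}=\langle H\mathbf e_i,\mathbf e_j\rangle$. Then the matrix of one-forms $\omega=(\omega^i_j)$ of the Bott connection, $\tilde\nabla\mathbf e_i=\omega_i^j\mathbf e_j$, is the unique solution of $$d\vartheta=\vartheta\wedge\omega,\qquad \omega+\omega^t=-2H .$$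 (2) The Chern connection on $\pi^*TM$, that is, the connection which is torsion-free, $\nabla_X(d\pi Y)-\nabla_Y(d\pi X)=d\pi[X,Y]$ for all vector fields $X,Y$ on $SM$, and almost compatible with the metric, $X\,g(s,t)-g(\nabla_Xs,t)-g(s,\nabla_Xt)=2A_{ijk}s^it^j\delta y^k(X)$ for all sections $s,t$ of $\pi^*TM$, exists, and under the identification $H(SM)\cong\pi^*TM$ it equals the Bott connection $\tilde\nabla$. (3) The Cartan connection on $\pi^*TM$, whose connection forms in natural coordinates are $\omega_i^j+A^j{}_{ik}\delta y^k$ with $\omega_i^j$ those of the Chern connection, exists, and under the same identification it equals the symmetrization $\hat\nabla=\tilde\nabla+H$. -/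

import Mathlib

open scoped Manifold ContDiff Topology Bundle
open Bundle

set_option linter.unusedSectionVars false

noncomputable section
namespace Finsler

/-- The model space of an `n`-dimensional manifold, `n = m + 1`. -/
abbrev Base (m : ℕ) : Type := EuclideanSpace ℝ (Fin (m + 1))
/-- The model space of the `(n - 1)`-sphere, `n = m + 1`. -/
abbrev Fib (m : ℕ) : Type := EuclideanSpace ℝ (Fin m)
/-- The Euclidean unit sphere of the model space. -/
abbrev USphere (m : ℕ) : Type := Metric.sphere (0 : Base m) 1

/-! ### The projective sphere bundle `SM = (TM minus the zero section) / ℝ⁺` as a manifold -/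

section SphereBundle

variable (m : ℕ) (M : Type*) [TopologicalSpace M] [ChartedSpace (Base m) M]
  [IsManifold (𝓡 (m + 1)) ∞ M]

/-- The tangent bundle of `M`. -/
abbrev TM : Type _ := TangentBundle (𝓡 (m + 1)) M

/-- The slit tangent bundle `TM₀`: nonzero tangent vectors. -/
abbrev SlitTM : Type _ := {v : TM m M // v.2 ≠ 0}

/-- Two nonzero tangent vectors are equivalent if one is a positive multiple of the other. -/
instance raySetoid : Setoid (SlitTM m M) where
  r v w := ∃ c : ℝ, 0 < c ∧ w.1 = ⟨v.1.proj, c • v.1.2⟩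
  iseqv :=
    { refl := fun v => ⟨1, one_pos, by rw [one_smul]⟩
      symm := by
        rintro ⟨⟨x, a⟩, ha⟩ ⟨w, hw⟩ ⟨c, hc, h⟩
        obtain rfl : w = ⟨x, c • a⟩ := h
        refine ⟨c⁻¹, inv_pos.2 hc, ?_⟩
        change (⟨x, a⟩ : TM m M) = ⟨x, c⁻¹ • c • a⟩
        rw [inv_smul_smul₀ hc.ne']
      trans := by
        rintro ⟨⟨x, a⟩, ha⟩ ⟨v, hv⟩ ⟨w, hw⟩ ⟨c, hc, h⟩ ⟨d, hd, h'⟩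
        obtain rfl : v = ⟨x, c • a⟩ := h
        obtain rfl : w = ⟨x, d • c • a⟩ := h'
        exact ⟨d * c, mul_pos hd hc, by rw [mul_smul]⟩ }

/-- The projective sphere bundle `SM = TM₀ / ℝ⁺`, with the quotient topology. -/
def SphereBundle : Type _ := Quotient (raySetoid m M)

instance sphereBundleTopology : TopologicalSpace (SphereBundle m M) :=
  inferInstanceAs (TopologicalSpace (Quotient (raySetoid m M)))

variable {m M}

/-- The class `[v]` of a nonzero tangent vector. -/
def ray (v : SlitTM m M) : SphereBundle m M := Quotient.mk _ v

theorem isQuotientMap_ray : Topology.IsQuotientMap (ray (m := m) (M := M)) :=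
  isQuotientMap_quot_mk

theorem continuous_ray : Continuous (ray (m := m) (M := M)) := continuous_quot_mk

variable (m M) in
/-- The projection `π : SM → M`. -/
def proj : C(SphereBundle m M, M) where
  toFun := Quotient.lift (fun v : SlitTM m M => v.1.proj) (by
    rintro v w ⟨c, hc, h⟩
    rw [h])
  continuous_toFun := by
    refine Continuous.quotient_lift ?_ _
    exact (FiberBundle.continuous_proj (Base m) (TangentSpace (𝓡 (m + 1)))).comp
      continuous_subtype_val

theorem proj_ray (v : SlitTM m M) : proj m M (ray v) = v.1.proj := rfl

/-- The natural coordinates `v ↦ (x, y)` of `TM` induced by the chart of `M` at `p`. -/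
def tChart (p : M) : OpenPartialHomeomorph (TM m M) (Base m × Base m) :=
  chartAt (ModelProd (Base m) (Base m)) (⟨p, 0⟩ : TM m M)

theorem mem_tChart_source {p : M} {v : TM m M} :
    v ∈ (tChart p).source ↔ v.proj ∈ (chartAt (Base m) p).source := by
  simp [tChart]

theorem mem_tChart_target {p : M} {q : Base m × Base m} :
    q ∈ (tChart (m := m) p).target ↔ q.1 ∈ (chartAt (Base m) p).target := by
  exact TangentBundle.mem_chart_target_iff (I := 𝓡 (m + 1)) (H := Base m) (M := M) q ⟨p, 0⟩

theorem tChart_fst (p : M) (v : TM m M) : (tChart p v).1 = chartAt (Base m) p v.proj := rfl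

theorem tChart_symm_proj (p : M) (q : Base m × Base m) :
    ((tChart (m := m) p).symm q).proj = (chartAt (Base m) p).symm q.1 := rfl

theorem tChart_snd (p : M) (v : TM m M) (hv : v.proj ∈ (chartAt (Base m) p).source) :
    (tChart p v).2 =
      (trivializationAt (Base m) (TangentSpace (𝓡 (m + 1))) p).continuousLinearEquivAt ℝ v.proj
        (by simpa using hv) v.2 := by
  rfl

theorem tChart_snd_ne_zero {p : M} {v : TM m M} (hv : v ∈ (tChart p).source) :
    (tChart p v).2 ≠ 0 ↔ v.2 ≠ 0 := by
  rw [tChart_snd p v (mem_tChart_source.1 hv)]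
  simp only [ne_eq, EmbeddingLike.map_eq_zero_iff]


/-- The components `a ↦ (aⁱ)` of a tangent vector at `x` in the chart of `M` at `p`. -/
def fiberCoord (p x : M) : TangentSpace (𝓡 (m + 1)) x →L[ℝ] Base m :=
  (trivializationAt (Base m) (TangentSpace (𝓡 (m + 1))) p).continuousLinearMapAt ℝ x

theorem tChart_apply {p : M} {v : TM m M} (hv : v ∈ (tChart p).source) :
    tChart p v = (chartAt (Base m) p v.proj, fiberCoord p v.proj v.2) := by
  refine Prod.ext (tChart_fst p v) ?_
  rw [tChart_snd p v (mem_tChart_source.1 hv)]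
  rw [fiberCoord, Bundle.Trivialization.continuousLinearMapAt_apply_of_mem]
  · rfl
  · simpa using mem_tChart_source.1 hv

/-- The Euclidean unit vector `w / ‖w‖` (an arbitrary unit vector if `w = 0`). -/
def unitDir (w : Base m) : USphere m :=
  if h : w = 0 then ⟨EuclideanSpace.single 0 1, by simp⟩
  else ⟨‖w‖⁻¹ • w, by simp [norm_smul, h]⟩

theorem coe_unitDir {w : Base m} (h : w ≠ 0) : (unitDir w : Base m) = ‖w‖⁻¹ • w := by
  simp [unitDir, h]

theorem unitDir_smul {c : ℝ} (hc : 0 < c) (w : Base m) : unitDir (c • w) = unitDir w := by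
  by_cases h : w = 0
  · simp [h]
  · apply Subtype.ext
    rw [coe_unitDir h, coe_unitDir (smul_ne_zero hc.ne' h), norm_smul, Real.norm_of_nonneg hc.le,
      smul_smul, mul_inv, mul_assoc, mul_comm ‖w‖⁻¹, ← mul_assoc, inv_mul_cancel₀ hc.ne', one_mul]

theorem unitDir_coe (u : USphere m) : unitDir (u : Base m) = u := by
  have h : (u : Base m) ≠ 0 := ne_zero_of_mem_unit_sphere u
  apply Subtype.ext
  rw [coe_unitDir h]
  simp

theorem continuousOn_unitDir : ContinuousOn (unitDir (m := m)) {0}ᶜ := by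
  rw [Topology.IsInducing.subtypeVal.continuousOn_iff]
  have : ContinuousOn (fun w : Base m => ‖w‖⁻¹ • w) {0}ᶜ :=
    (continuousOn_id.norm.inv₀ fun w hw => by simpa using hw).smul continuousOn_id
  exact this.congr fun w hw => coe_unitDir hw

open Classical in
/-- The class of a tangent vector if it is nonzero, with an arbitrary value over the same point
otherwise. -/
def toRay (v : TM m M) : SphereBundle m M :=
  if h : v.2 ≠ 0 then ray ⟨v, h⟩
  else ray ⟨⟨v.proj, (EuclideanSpace.single 0 1 : Base m)⟩, by
    intro h0
    exact one_ne_zero ((PiLp.single_eq_zero_iff 2 _).1 h0)⟩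

theorem toRay_of_ne {v : TM m M} (h : v.2 ≠ 0) : toRay v = ray ⟨v, h⟩ := by
  simp [toRay, h]

/-- `[v] ↦ (x, y / ‖y‖)` where `(x, y)` are the natural coordinates of `v` over the chart at `p`. -/
def localCoord (p : M) : SphereBundle m M → Base m × USphere m :=
  Quotient.lift
    (fun v : SlitTM m M => (chartAt (Base m) p v.1.proj, unitDir (fiberCoord p v.1.proj v.1.2))) (by
      rintro ⟨⟨x, a⟩, ha⟩ ⟨w, hw⟩ ⟨c, hc, h⟩
      obtain rfl : w = ⟨x, c • a⟩ := h
      simp only [map_smul, unitDir_smul hc])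

theorem localCoord_ray (p : M) (v : SlitTM m M) : localCoord p (ray v) =
    (chartAt (Base m) p v.1.proj, unitDir (fiberCoord p v.1.proj v.1.2)) := rfl

theorem ray_surj (z : SphereBundle m M) : ∃ v, ray v = z := Quotient.exists_rep z

/-- The local trivialization `π⁻¹(U) ≃ x(U) × Sⁿ⁻¹` of `SM` over the chart domain `U` at `p`. -/
def trivChart (p : M) : OpenPartialHomeomorph (SphereBundle m M) (Base m × USphere m) where
  toFun := localCoord p
  invFun q := toRay ((tChart p).symm (q.1, (q.2 : Base m)))
  source := proj m M ⁻¹' (chartAt (Base m) p).source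
  target := (chartAt (Base m) p).target ×ˢ Set.univ
  map_source' := by
    intro z hz
    obtain ⟨v, rfl⟩ := ray_surj z
    exact ⟨(chartAt (Base m) p).map_source hz, trivial⟩
  map_target' := by
    rintro ⟨x, u⟩ ⟨hx, -⟩
    have hq : ((x, (u : Base m)) : Base m × Base m) ∈ (tChart (m := m) p).target :=
      mem_tChart_target.2 hx
    have h0 : ((tChart p).symm (x, (u : Base m))).2 ≠ 0 := by
      rw [← tChart_snd_ne_zero ((tChart p).map_target hq), (tChart p).right_inv hq]
      exact ne_zero_of_mem_unit_sphere u
    simp only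
    rw [toRay_of_ne h0]
    exact (chartAt (Base m) p).map_target hx
  left_inv' := by
    intro z hz
    obtain ⟨⟨⟨x, a⟩, ha⟩, rfl⟩ := ray_surj z
    have hx : x ∈ (chartAt (Base m) p).source := hz
    have hv : (⟨x, a⟩ : TM m M) ∈ (tChart p).source := mem_tChart_source.2 hx
    have hne : fiberCoord p x a ≠ 0 := by
      have := (tChart_snd_ne_zero hv).2 ha
      rwa [tChart_apply hv] at this
    have key : (tChart p).symm (chartAt (Base m) p x, (unitDir (fiberCoord p x a) : Base m)) =
        ⟨x, ‖fiberCoord p x a‖⁻¹ • a⟩ := by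
      have hv' : (⟨x, ‖fiberCoord p x a‖⁻¹ • a⟩ : TM m M) ∈ (tChart p).source :=
        mem_tChart_source.2 hx
      rw [← (tChart p).left_inv hv', tChart_apply hv', coe_unitDir hne]
      simp only [map_smul]
    rw [localCoord_ray]
    simp only
    have hs : ‖fiberCoord p x a‖⁻¹ • a ≠ 0 := smul_ne_zero (inv_ne_zero (norm_ne_zero_iff.2 hne)) ha
    rw [key, toRay_of_ne hs]
    symm
    exact Quotient.sound ⟨‖fiberCoord p x a‖⁻¹, inv_pos.2 (norm_pos_iff.2 hne), rfl⟩
  right_inv' := by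
    rintro ⟨x, u⟩ ⟨hx, -⟩
    have hq : ((x, (u : Base m)) : Base m × Base m) ∈ (tChart (m := m) p).target :=
      mem_tChart_target.2 hx
    have hs := (tChart p).map_target hq
    have h0 : ((tChart p).symm (x, (u : Base m))).2 ≠ 0 := by
      rw [← tChart_snd_ne_zero hs, (tChart p).right_inv hq]
      exact ne_zero_of_mem_unit_sphere u
    simp only
    rw [toRay_of_ne h0, localCoord_ray]
    have := tChart_apply hs
    rw [(tChart p).right_inv hq, Prod.ext_iff] at this
    refine Prod.ext this.1.symm ?_
    have h2 := this.2
    simp only at h2 ⊢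
    rw [← h2, unitDir_coe]
  open_source := (chartAt (Base m) p).open_source.preimage (proj m M).continuous
  open_target := (chartAt (Base m) p).open_target.prod isOpen_univ
  continuousOn_toFun := by
    rw [isQuotientMap_ray.continuousOn_isOpen_iff
      ((chartAt (Base m) p).open_source.preimage (proj m M).continuous)]
    have h1 : ContinuousOn (fun v : SlitTM m M => tChart p v.1)
        (ray ⁻¹' (proj m M ⁻¹' (chartAt (Base m) p).source)) :=
      (tChart p).continuousOn.comp continuous_subtype_val.continuousOn
        fun v hv => mem_tChart_source.2 hv
    have h2 : ContinuousOn
        (fun v : SlitTM m M => ((tChart p v.1).1, unitDir (tChart p v.1).2))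
        (ray ⁻¹' (proj m M ⁻¹' (chartAt (Base m) p).source)) :=
      (continuous_fst.comp_continuousOn h1).prodMk
        (continuousOn_unitDir.comp (continuous_snd.comp_continuousOn h1) fun v hv =>
          (tChart_snd_ne_zero (mem_tChart_source.2 hv)).2 v.2)
    refine h2.congr fun v hv => ?_
    simp only [Function.comp_apply]
    rw [localCoord_ray, tChart_apply (mem_tChart_source.2 hv)]
  continuousOn_invFun := by
    rw [continuousOn_iff_continuous_domRestrict]
    have hmem : ∀ q : ((chartAt (Base m) p).target ×ˢ (Set.univ : Set (USphere m)) : Set _),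
        ((q.1.1, (q.1.2 : Base m)) : Base m × Base m) ∈ (tChart (m := m) p).target :=
      fun q => mem_tChart_target.2 q.2.1
    have h0 : ∀ q : ((chartAt (Base m) p).target ×ˢ (Set.univ : Set (USphere m)) : Set _),
        ((tChart p).symm (q.1.1, (q.1.2 : Base m))).2 ≠ 0 := fun q => by
      rw [← tChart_snd_ne_zero ((tChart p).map_target (hmem q)), (tChart p).right_inv (hmem q)]
      exact ne_zero_of_mem_unit_sphere q.1.2
    have hc : Continuous fun q : ((chartAt (Base m) p).target ×ˢ
        (Set.univ : Set (USphere m)) : Set _) =>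
        (⟨(tChart p).symm (q.1.1, (q.1.2 : Base m)), h0 q⟩ : SlitTM m M) := by
      refine Continuous.subtype_mk ?_ _
      refine (tChart p).continuousOn_symm.comp_continuous ?_ hmem
      fun_prop
    refine (continuous_ray.comp hc).congr fun q => ?_
    exact (toRay_of_ne (h0 q)).symm

/-- The charts of `SM`: a local trivialization followed by a stereographic projection of the
sphere. -/
def sphereChart (p : M) (u : USphere m) :
    OpenPartialHomeomorph (SphereBundle m M) (Base m × Fib m) :=
  haveI : Fact (Module.finrank ℝ (Base m) = m + 1) := ⟨finrank_euclideanSpace_fin⟩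
  (trivChart p).trans ((OpenPartialHomeomorph.refl (Base m)).prod (stereographic' m u))

instance sphereBundleChartedSpace : ChartedSpace (Base m × Fib m) (SphereBundle m M) where
  atlas := {e | ∃ (p : M) (u : USphere m), e = sphereChart p u}
  chartAt z := sphereChart (proj m M z) (-(localCoord (proj m M z) z).2)
  mem_chart_source z := by
    simp only [sphereChart, OpenPartialHomeomorph.trans_source,
      OpenPartialHomeomorph.prod_source, OpenPartialHomeomorph.refl_source, Set.mem_inter_iff,
      Set.mem_preimage, Set.mem_prod, Set.mem_univ, true_and, stereographic'_source]
    refine ⟨mem_chart_source _ _, ?_⟩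
    exact (ne_neg_of_mem_unit_sphere ℝ (localCoord (proj m M z) z).2)
  chart_mem_atlas z := ⟨_, _, rfl⟩


theorem contDiffOn_tChart (p p' : M) :
    ContDiffOn ℝ ∞ (fun q => tChart (m := m) p' ((tChart p).symm q))
      ((tChart (m := m) p).symm.trans (tChart p')).source := by
  have h := HasGroupoid.compatible (G := contDiffGroupoid ∞ ((𝓡 (m + 1)).prod 𝓘(ℝ, Base m)))
    (chart_mem_atlas (ModelProd (Base m) (Base m)) (⟨p, 0⟩ : TM m M))
    (chart_mem_atlas (ModelProd (Base m) (Base m)) (⟨p', 0⟩ : TM m M))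
  rw [contDiffGroupoid, mem_groupoid_of_pregroupoid] at h
  have h1 := h.1
  simp only [contDiffPregroupoid, mfld_simps] at h1
  refine ContDiffOn.mono h1 ?_
  intro q hq
  exact ⟨hq, ⟨q, rfl⟩⟩

theorem tChart_symm_ne_zero {p : M} {x : Base m} (hx : x ∈ (chartAt (Base m) p).target)
    (u : USphere m) : ((tChart p).symm (x, (u : Base m))).2 ≠ 0 := by
  have hq : ((x, (u : Base m)) : Base m × Base m) ∈ (tChart (m := m) p).target :=
    mem_tChart_target.2 hx
  rw [← tChart_snd_ne_zero ((tChart p).map_target hq), (tChart p).right_inv hq]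
  exact ne_zero_of_mem_unit_sphere u

theorem trivChart_symm_apply {p : M} {x : Base m} (hx : x ∈ (chartAt (Base m) p).target)
    (u : USphere m) : (trivChart p).symm (x, u) =
      ray ⟨(tChart p).symm (x, (u : Base m)), tChart_symm_ne_zero hx u⟩ :=
  toRay_of_ne _

instance sphereBundleIsManifold : IsManifold 𝓘(ℝ, Base m × Fib m) ∞ (SphereBundle m M) :=
  isManifold_of_contDiffOn _ _ _ (by
    rintro _ _ ⟨p, u, rfl⟩ ⟨p', u', rfl⟩
    have : Fact (Module.finrank ℝ (Base m) = m + 1) := ⟨finrank_euclideanSpace_fin⟩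
    let U := (OrthonormalBasis.fromOrthogonalSpanSingleton (𝕜 := ℝ)
      m (ne_zero_of_mem_unit_sphere u)).repr
    let U' := (OrthonormalBasis.fromOrthogonalSpanSingleton (𝕜 := ℝ)
      m (ne_zero_of_mem_unit_sphere u')).repr
    set S := (sphereChart p u).symm.trans (sphereChart (m := m) (M := M) p' u') with hS
    have hst : ContDiff ℝ ∞ fun w : Fib m => ((stereographic' m u).symm w : Base m) :=
      ((contDiff_stereoInvFunAux (m := ∞) (v := u.val)).comp
        (ℝ ∙ (u : Base m))ᗮ.subtypeL.contDiff).comp U.symm.contDiff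
    let A : Base m × Fib m → Base m × Base m := fun q => (q.1, ((stereographic' m u).symm q.2 : Base m))
    have hA : ContDiff ℝ ∞ A := contDiff_fst.prodMk (hst.comp contDiff_snd)
    let B : Base m × Fib m → Base m × Base m := fun q => tChart (m := m) p' ((tChart p).symm (A q))
    have hsrc : ∀ q ∈ S.source, q.1 ∈ (chartAt (Base m) p).target ∧
        (chartAt (Base m) p).symm q.1 ∈ (chartAt (Base m) p').source ∧
        (localCoord p' ((trivChart p).symm (q.1, (stereographic' m u).symm q.2))).2 ≠ u' := by
      intro q hq
      have h1 : q.1 ∈ (chartAt (Base m) p).target := hq.1.2.1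
      refine ⟨h1, ?_, ?_⟩
      · have h2 : proj m M ((trivChart p).symm (q.1, (stereographic' m u).symm q.2)) ∈
          (chartAt (Base m) p').source := hq.2.1
        rwa [trivChart_symm_apply h1] at h2
      · have h3 : (localCoord p' ((trivChart p).symm (q.1, (stereographic' m u).symm q.2))).2 ∈
          (stereographic' m u').source := hq.2.2.2
        rwa [stereographic'_source] at h3
    have hmem : ∀ q ∈ S.source, A q ∈ ((tChart (m := m) p).symm.trans (tChart p')).source :=
      fun q hq => ⟨mem_tChart_target.2 (hsrc q hq).1, mem_tChart_source.2 (hsrc q hq).2.1⟩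
    have hB : ∀ q ∈ S.source, (B q).2 ≠ 0 ∧
        localCoord p' ((trivChart p).symm (q.1, (stereographic' m u).symm q.2)) =
          ((B q).1, unitDir (B q).2) := by
      intro q hq
      refine ⟨(tChart_snd_ne_zero (hmem q hq).2).2 (tChart_symm_ne_zero (hsrc q hq).1 _), ?_⟩
      rw [trivChart_symm_apply (hsrc q hq).1, localCoord_ray]
      change _ = ((tChart p' ((tChart p).symm (A q))).1, unitDir (tChart p' ((tChart p).symm (A q))).2)
      have hh : tChart p' ((tChart p).symm (A q)) = _ := tChart_apply (hmem q hq).2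
      rw [hh]
    have hBs : ContDiffOn ℝ ∞ B S.source := (contDiffOn_tChart p p').comp hA.contDiffOn hmem
    have hu : ContDiffOn ℝ ∞ (fun q => ‖(B q).2‖⁻¹ • (B q).2) S.source := by
      have h2 : ContDiffOn ℝ ∞ (fun q => (B q).2) S.source := contDiff_snd.comp_contDiffOn hBs
      exact ((h2.norm ℝ fun q hq => (hB q hq).1).inv fun q hq => norm_ne_zero_iff.2 (hB q hq).1).smul h2
    have hfin : ContDiffOn ℝ ∞ (fun q => ((B q).1, U' (stereoToFun (u' : Base m) (‖(B q).2‖⁻¹ • (B q).2))))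
        S.source := by
      refine (contDiff_fst.comp_contDiffOn hBs).prodMk (U'.contDiff.comp_contDiffOn
        ((contDiffOn_stereoToFun (n := ∞)).comp hu ?_))
      intro q hq
      have h4 := (hsrc q hq).2.2
      rw [(hB q hq).2, ne_comm, Ne, sphere_ext_iff] at h4
      simp only at h4
      rw [coe_unitDir (hB q hq).1] at h4
      exact h4
    simp only [modelWithCornersSelf_coe, modelWithCornersSelf_coe_symm, Set.range_id, Set.inter_univ,
      Set.preimage_id, Function.comp_id, Function.id_comp]
    refine hfin.congr fun q hq => ?_
    change (((localCoord p' ((trivChart p).symm (q.1, (stereographic' m u).symm q.2))).1,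
      stereographic' m u' (localCoord p' ((trivChart p).symm (q.1, (stereographic' m u).symm q.2))).2) :
        Base m × Fib m) = _
    rw [(hB q hq).2]
    refine Prod.ext rfl ?_
    change U' (stereoToFun (u' : Base m) (unitDir (B q).2 : Base m)) = _
    rw [coe_unitDir (hB q hq).1])

end SphereBundle
/-! ### Finsler structures -/

section Local
variable {m : ℕ}

/-- `∂f/∂xⁱ` for a function of `(x, y)`. -/
def pdx (i : Fin (m + 1)) (f : Base m × Base m → ℝ) (q : Base m × Base m) : ℝ :=
  fderiv ℝ f q (EuclideanSpace.single i 1, 0)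

/-- `∂f/∂yⁱ` for a function of `(x, y)`. -/
def pdy (i : Fin (m + 1)) (f : Base m × Base m → ℝ) (q : Base m × Base m) : ℝ :=
  fderiv ℝ f q (0, EuclideanSpace.single i 1)

/-- `g_ij = ½ [F²]_{yⁱ yʲ}`. -/
def gMat (f : Base m × Base m → ℝ) (q : Base m × Base m) :
    Matrix (Fin (m + 1)) (Fin (m + 1)) ℝ :=
  Matrix.of fun i j => 1 / 2 * pdy j (pdy i fun r => f r ^ 2) q

/-- `Gⁱ = ¼ gⁱʲ ([F²]_{yʲ xᵏ} yᵏ - [F²]_{xʲ})`. -/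
def spray (f : Base m × Base m → ℝ) (i : Fin (m + 1)) (q : Base m × Base m) : ℝ :=
  1 / 4 * ∑ j, (gMat f q)⁻¹ i j *
    (∑ k, pdx k (pdy j fun r => f r ^ 2) q * q.2 k - pdx j (fun r => f r ^ 2) q)

/-- `A_ijk = ¼ F [F²]_{yⁱ yʲ yᵏ}`. -/
def cartanCoeff (f : Base m × Base m → ℝ) (i j k : Fin (m + 1)) (q : Base m × Base m) : ℝ :=
  1 / 4 * f q * pdy k (pdy j (pdy i fun r => f r ^ 2)) q

end Local

variable (m : ℕ) (M : Type*) [TopologicalSpace M] [ChartedSpace (Base m) M]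
  [IsManifold (𝓡 (m + 1)) ∞ M]

/-- A Finsler structure on `M`: a positive function `F` on the slit tangent bundle (its values on the
zero section are irrelevant), smooth, positively homogeneous of degree one on the fibres, and such
that the matrix `(g_ij)` is positive definite at every nonzero `v`, in natural coordinates. -/
structure FinslerStructure where
  toFun : TM m M → ℝ
  smooth : ContMDiffOn (𝓡 (m + 1)).tangent 𝓘(ℝ, ℝ) ∞ toFun {v | v.2 ≠ 0}
  pos : ∀ v : TM m M, v.2 ≠ 0 → 0 < toFun v
  homog : ∀ v : TM m M, v.2 ≠ 0 → ∀ c : ℝ, 0 < c → toFun ⟨v.proj, c • v.2⟩ = c * toFun v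
  posDef : ∀ (p : M) (v : TM m M), v.proj ∈ (chartAt (Base m) p).source → v.2 ≠ 0 →
    (gMat (fun q => toFun ((tChart p).symm q)) (tChart p v)).PosDef


namespace FinslerStructure

variable {m M}

/-! ### The Finsler structure in natural coordinates -/

/-- The function `F(x, y)` in the natural coordinates `(x, y)` of `TM` over the chart at `p`. -/
def loc (F : FinslerStructure m M) (p : M) (q : Base m × Base m) : ℝ :=
  F.toFun ((tChart p).symm q)

/-- `Nⁱ_j = ∂Gⁱ/∂yʲ`. -/
def nonlin (F : FinslerStructure m M) (p : M) (i j : Fin (m + 1)) (q : Base m × Base m) : ℝ :=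
  pdy j (spray (F.loc p) i) q

/-- The distinguished section `l = y / F` of `π^*TM`, as a map `SM → TM` over `M`. -/
def distinguished (F : FinslerStructure m M) : SphereBundle m M → TM m M :=
  Quotient.lift
    (fun v : SlitTM m M => (⟨v.1.proj, (F.toFun v.1)⁻¹ • v.1.2⟩ : TM m M)) (by
      rintro ⟨⟨x, a⟩, ha⟩ ⟨w, hw⟩ ⟨c, hc, h⟩
      obtain rfl : w = ⟨x, c • a⟩ := h
      change (⟨x, (F.toFun ⟨x, a⟩)⁻¹ • a⟩ : TM m M) = ⟨x, (F.toFun ⟨x, c • a⟩)⁻¹ • c • a⟩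
      have h1 : F.toFun ⟨x, c • a⟩ = c * F.toFun ⟨x, a⟩ := F.homog ⟨x, a⟩ ha c hc
      rw [h1, smul_smul, mul_inv, mul_comm c⁻¹, mul_assoc, inv_mul_cancel₀ hc.ne', mul_one])

end FinslerStructure

/-! ### Tangent geometry of the projective sphere bundle -/

section Geometry

variable {m M}

/-- The model space of `SM`, of dimension `2n - 1`. -/
abbrev SMModel (m : ℕ) : Type := Base m × Fib m

/-- The tangent space `T_z(SM)`. -/
abbrev TSM (z : SphereBundle m M) : Type := TangentSpace 𝓘(ℝ, SMModel m) z

/-- The tangent bundle `T(SM)`. -/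
abbrev TSMBundle (m : ℕ) (M : Type*) [TopologicalSpace M] [ChartedSpace (Base m) M]
    [IsManifold (𝓡 (m + 1)) ∞ M] : Type _ :=
  TangentBundle 𝓘(ℝ, SMModel m) (SphereBundle m M)

/-- The fibre of `π^*TM` at `z`, that is `T_{π(z)}M`. -/
abbrev PullTM (z : SphereBundle m M) : Type := TangentSpace (𝓡 (m + 1)) (proj m M z)

/-- Vector fields on `SM`; those defined on a part of `SM` are extended arbitrarily. -/
abbrev VField (m : ℕ) (M : Type*) [TopologicalSpace M] [ChartedSpace (Base m) M]
    [IsManifold (𝓡 (m + 1)) ∞ M] : Type _ :=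
  (z : SphereBundle m M) → TSM z

/-- Sections of `π^*TM`. -/
abbrev PullSection (m : ℕ) (M : Type*) [TopologicalSpace M] [ChartedSpace (Base m) M]
    [IsManifold (𝓡 (m + 1)) ∞ M] : Type _ :=
  (z : SphereBundle m M) → PullTM z

/-- A vector field on `SM` is smooth at `z`. -/
def SmoothAt (X : VField m M) (z : SphereBundle m M) : Prop :=
  ContMDiffAt 𝓘(ℝ, SMModel m) 𝓘(ℝ, SMModel m).tangent ∞ (fun w => (⟨w, X w⟩ : TSMBundle m M)) z

/-- A vector field on `SM` is differentiable at `z`. -/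
def DiffAt (X : VField m M) (z : SphereBundle m M) : Prop :=
  MDifferentiableAt 𝓘(ℝ, SMModel m) 𝓘(ℝ, SMModel m).tangent (fun w => (⟨w, X w⟩ : TSMBundle m M)) z

/-- A section of `π^*TM` is smooth at `z`, as a map `SM → TM` over `M`. -/
def PullSmoothAt (s : PullSection m M) (z : SphereBundle m M) : Prop :=
  ContMDiffAt 𝓘(ℝ, SMModel m) (𝓡 (m + 1)).tangent ∞ (fun w => (⟨proj m M w, s w⟩ : TM m M)) z

/-- A section of `π^*TM` is differentiable at `z`, as a map `SM → TM` over `M`. -/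
def PullDiffAt (s : PullSection m M) (z : SphereBundle m M) : Prop :=
  MDifferentiableAt 𝓘(ℝ, SMModel m) (𝓡 (m + 1)).tangent (fun w => (⟨proj m M w, s w⟩ : TM m M)) z

/-- The derivative of `f` at `z` in the direction `X`. -/
def dAlong (f : SphereBundle m M → ℝ) (z : SphereBundle m M) (X : TSM z) : ℝ :=
  mvfderiv 𝓘(ℝ, SMModel m) f z X

/-- The Lie bracket `[X, Y]`. -/
def lieBr (X Y : VField m M) : VField m M :=
  VectorField.mlieBracket 𝓘(ℝ, SMModel m) X Y

/-- The differential `dπ : T_z(SM) → T_{π(z)}M`. -/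
def dproj (z : SphereBundle m M) : TSM z →L[ℝ] PullTM z :=
  mfderiv 𝓘(ℝ, SMModel m) (𝓡 (m + 1)) (proj m M) z

/-- The vertical bundle `V(SM)`, tangent to the fibres of `π`. -/
def vert (z : SphereBundle m M) : Submodule ℝ (TSM z) := LinearMap.ker (dproj z).toLinearMap

/-- The natural coordinates `(x, y)`, over the chart at `p`, of the representative of `z` with
`‖y‖ = 1`. -/
def natCoord (p : M) (z : SphereBundle m M) : Base m × Base m :=
  ((localCoord p z).1, ((localCoord p z).2 : Base m))

/-- The form `dxⁱ` on `SM`. -/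
def dx (p : M) (z : SphereBundle m M) (i : Fin (m + 1)) : TSM z →ₗ[ℝ] ℝ :=
  ((EuclideanSpace.proj i).comp ((ContinuousLinearMap.fst ℝ (Base m) (Base m)).comp
    (mvfderiv 𝓘(ℝ, SMModel m) (natCoord p) z))).toLinearMap

/-- The form `dyⁱ` of `TM₀`, pulled back to `SM` by the section `z ↦ (x, y)`, `‖y‖ = 1`. -/
def dy (p : M) (z : SphereBundle m M) (i : Fin (m + 1)) : TSM z →ₗ[ℝ] ℝ :=
  ((EuclideanSpace.proj i).comp ((ContinuousLinearMap.snd ℝ (Base m) (Base m)).comp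
    (mvfderiv 𝓘(ℝ, SMModel m) (natCoord p) z))).toLinearMap

/-- Connections on the tangent bundle `T(SM)`; `nab Y z (X z)` is `(∇_X Y)(z)`. -/
abbrev SMConn (m : ℕ) (M : Type*) [TopologicalSpace M] [ChartedSpace (Base m) M]
    [IsManifold (𝓡 (m + 1)) ∞ M] : Type _ :=
  CovariantDerivative 𝓘(ℝ, SMModel m) (SMModel m)
    (TangentSpace 𝓘(ℝ, SMModel m) : SphereBundle m M → Type)

/-- Operators `(X, U) ↦ D_X U` on vector fields of `SM`, the type of the connections on the
subbundle `H(SM)`, which are applied to horizontal fields `U`. -/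
abbrev Op (m : ℕ) (M : Type*) [TopologicalSpace M] [ChartedSpace (Base m) M]
    [IsManifold (𝓡 (m + 1)) ∞ M] : Type _ :=
  VField m M → VField m M → VField m M

namespace FinslerStructure

variable (F : FinslerStructure m M)

/-- `δyⁱ = (dyⁱ + Nⁱ_j dxʲ) / F`, evaluated on tangent vectors of `SM` through the section
`z ↦ (x, y)`, `‖y‖ = 1`. Another section changes the vector `(δyⁱ)` by a multiple of `y`. -/
def deltaY (p : M) (z : SphereBundle m M) (i : Fin (m + 1)) : TSM z →ₗ[ℝ] ℝ :=
  (F.loc p (natCoord p z))⁻¹ •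
    (dy p z i + ∑ j, F.nonlin p i j (natCoord p z) • dx p z j)

open LinearMap.BilinForm in
/-- The Sasaki-type metric computed in the natural coordinates over the chart at `p`:
`g_ij dxⁱ ⊗ dxʲ + (g_ij - F_{yⁱ} F_{yʲ}) δyⁱ ⊗ δyʲ`. For an orthonormal coframe `om^i = vⁱ_j dxʲ` of
`π^*TM` with `om^n = F_{yʲ} dxʲ`, the second term is the sum of the squares of the forms
`om^{n+α} = -v^α_j δyʲ`, `α < n`. -/
def sasakiIn (p : M) (z : SphereBundle m M) : LinearMap.BilinForm ℝ (TSM z) :=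
  ∑ i, ∑ j, (gMat (F.loc p) (natCoord p z) i j • linMulLin (dx p z i) (dx p z j) +
    (gMat (F.loc p) (natCoord p z) i j
        - pdy i (F.loc p) (natCoord p z) * pdy j (F.loc p) (natCoord p z)) •
      linMulLin (F.deltaY p z i) (F.deltaY p z j))

/-- The Sasaki-type Riemannian metric on `SM`. -/
def sasaki (z : SphereBundle m M) : LinearMap.BilinForm ℝ (TSM z) :=
  F.sasakiIn (proj m M z) z

/-- The horizontal bundle `H(SM)`, the orthogonal complement of `V(SM)`. -/
def hor (z : SphereBundle m M) : Submodule ℝ (TSM z) := (F.sasaki z).orthogonal (vert z)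

open Classical in
/-- The orthogonal projection `p` onto `V(SM)`. -/
def vertProj (z : SphereBundle m M) : TSM z →ₗ[ℝ] TSM z :=
  if h : IsCompl (vert z) (F.hor z) then (vert z).projection (F.hor z) h else 0

open Classical in
/-- The orthogonal projection `p^⊥` onto `H(SM)`. -/
def horProj (z : SphereBundle m M) : TSM z →ₗ[ℝ] TSM z :=
  if h : IsCompl (F.hor z) (vert z) then (F.hor z).projection (vert z) h else 0

/-- The fundamental tensor `g = g_ij dxⁱ ⊗ dxʲ` as a metric on `π^*TM`. -/
def fund (z : SphereBundle m M) (a b : PullTM z) : ℝ :=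
  ∑ i, ∑ j, gMat (F.loc (proj m M z)) (natCoord (proj m M z) z) i j *
    fiberCoord (proj m M z) (proj m M z) a i * fiberCoord (proj m M z) (proj m M z) b j

/-- The value `A_ijk aⁱ bʲ δyᵏ(X)` of the Cartan tensor; it does not change if a multiple of `y`
is added to `(δyᵏ(X))`. -/
def cartanTensor (z : SphereBundle m M) (a b : PullTM z) (X : TSM z) : ℝ :=
  ∑ i, ∑ j, ∑ k, cartanCoeff (F.loc (proj m M z)) i j k (natCoord (proj m M z) z) *
    fiberCoord (proj m M z) (proj m M z) a i * fiberCoord (proj m M z) (proj m M z) b j *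
    F.deltaY (proj m M z) z k X

/-- The Levi-Civita connection of the Sasaki-type metric. -/
structure IsLeviCivita (nab : SMConn m M) : Prop where
  torsion_free : nab.torsion = 0
  metric : ∀ (z : SphereBundle m M) (X Y : VField m M), DiffAt X z → DiffAt Y z → ∀ W : TSM z,
    dAlong (fun w => F.sasaki w (X w) (Y w)) z W =
      F.sasaki z (nab X z W) (Y z) + F.sasaki z (X z) (nab Y z W)

/-- `∇^{F⊥} = p^⊥ ∇ p^⊥`, for a connection `∇` on `T(SM)`. -/
def normalConn (nab : SMConn m M) : Op m M := fun X U z =>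
  F.horProj z (nab (fun w => F.horProj w (U w)) z (X z))

/-- The Bott connection on `H(SM)`: `p^⊥ [X, U]` for vertical `X` and `∇^{F⊥}_X U` for horizontal `X`,
hence `p^⊥ [p X, U] + ∇^{F⊥}_{p^⊥ X} U` in general. Here `nab` is the Levi-Civita connection. -/
def bott (nab : SMConn m M) : Op m M := fun X U z =>
  F.horProj z (lieBr (fun w => F.vertProj w (X w)) U z) +
    F.normalConn nab (fun w => F.horProj w (X w)) U z

/-- The field `U` is a section of `H(SM)` near `z`. -/
def HorizontalNear (U : VField m M) (z : SphereBundle m M) : Prop := ∀ᶠ w in 𝓝 z, U w ∈ F.hor w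

/-- The horizontal vector `b` is the value at `z` of the dual connection:
`X⟨V, U⟩ = ⟨D_X V, U⟩ + ⟨V, b⟩` for all sections `V` of `H(SM)` near `z`. -/
def IsDualValue (D : Op m M) (X U : VField m M) (z : SphereBundle m M) (b : TSM z) : Prop :=
  b ∈ F.hor z ∧ ∀ V : VField m M, SmoothAt V z → F.HorizontalNear V z →
    dAlong (fun w => F.sasaki w (V w) (U w)) z (X z) =
      F.sasaki z (D X V z) (U z) + F.sasaki z (V z) b

open Classical in
/-- The dual connection `D^*`, determined by `d⟨V, U⟩ = ⟨D V, U⟩ + ⟨V, D^* U⟩`. -/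
def dualConn (D : Op m M) : Op m M := fun X U z =>
  if h : ∃ b, F.IsDualValue D X U z b then h.choose else 0

/-- The Cartan endomorphism `H = ½ (D^* - D)`, as the operator `(X, U) ↦ H(X) U`. -/
def cartanEndo (D : Op m M) : Op m M := fun X U z =>
  (1 / 2 : ℝ) • (F.dualConn D X U z - D X U z)

/-- The symmetrization `D + H` of a connection `D`. -/
def symmetrization (D : Op m M) : Op m M := fun X U z =>
  D X U z + F.cartanEndo D X U z

/-! ### Frames -/

/-- A smooth orthonormal frame `e_1, …, e_n` of `H(SM)` over `s` whose last member corresponds to the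
distinguished section `l` under the identification `dπ : H(SM) ≃ π^*TM`. -/
structure IsAdaptedFrame (s : Set (SphereBundle m M)) (e : Fin (m + 1) → VField m M) : Prop where
  smooth : ∀ i, ∀ z ∈ s, SmoothAt (e i) z
  horizontal : ∀ i, ∀ z ∈ s, e i z ∈ F.hor z
  orthonormal : ∀ i j, ∀ z ∈ s, F.sasaki z (e i z) (e j z) = if i = j then 1 else 0
  last : ∀ z ∈ s, (⟨proj m M z, dproj z (e (Fin.last m) z)⟩ : TM m M) = F.distinguished z

/-- The forms `om^i` dual to the frame: they vanish on `V(SM)`, and `om^i(e_j) = δ_ij`. -/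
def coframe (e : Fin (m + 1) → VField m M) (i : Fin (m + 1)) (z : SphereBundle m M) :
    TSM z →ₗ[ℝ] ℝ := F.sasaki z (e i z)

end FinslerStructure

/-- Matrices of one-forms; `om i j` is the form with lower index `i` and upper index `j`. -/
abbrev FormMatrix (m : ℕ) (M : Type*) [TopologicalSpace M] [ChartedSpace (Base m) M]
    [IsManifold (𝓡 (m + 1)) ∞ M] : Type _ :=
  Fin (m + 1) → Fin (m + 1) → (z : SphereBundle m M) → TSM z →ₗ[ℝ] ℝ

/-- The exterior derivative of a one-form, evaluated on vector fields. -/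
def extD (α : (z : SphereBundle m M) → TSM z →ₗ[ℝ] ℝ) (X Y : VField m M)
    (z : SphereBundle m M) : ℝ :=
  dAlong (fun w => α w (Y w)) z (X z) - dAlong (fun w => α w (X w)) z (Y z) - α z (lieBr X Y z)

/-- The entries are smooth one-forms on `s`. -/
def SmoothForms (s : Set (SphereBundle m M)) (om : FormMatrix m M) : Prop :=
  ∀ i j, ∀ z ∈ s, ∀ X : VField m M, SmoothAt X z →
    ContMDiffAt 𝓘(ℝ, SMModel m) 𝓘(ℝ, ℝ) ∞ (fun w => om i j w (X w)) z

/-- `om` is the connection matrix of `D` with respect to `e`: `D_X e_i = om_i^j(X) e_j`. -/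
def IsConnectionMatrix (D : Op m M) (s : Set (SphereBundle m M))
    (e : Fin (m + 1) → VField m M) (om : FormMatrix m M) : Prop :=
  ∀ z ∈ s, ∀ X : VField m M, SmoothAt X z → ∀ i, D X (e i) z = ∑ j, om i j z (X z) • e j z

/-- The structure equations `dϑ = ϑ ∧ om` and `om + omᵗ = -2 H` on `s`, with `ϑ = (om^1, …, om^n)`
and `H_ij(X) = ⟨H(X) e_i, e_j⟩`. -/
structure FinslerStructure.StructureEquations (F : FinslerStructure m M) (H : Op m M)
    (s : Set (SphereBundle m M)) (e : Fin (m + 1) → VField m M) (om : FormMatrix m M) : Prop where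
  first : ∀ z ∈ s, ∀ X Y : VField m M, SmoothAt X z → SmoothAt Y z → ∀ i,
    extD (F.coframe e i) X Y z =
      ∑ j, (F.coframe e j z (X z) * om j i z (Y z) - F.coframe e j z (Y z) * om j i z (X z))
  second : ∀ z ∈ s, ∀ X : VField m M, SmoothAt X z → ∀ i j,
    om i j z (X z) + om j i z (X z) = -2 * F.sasaki z (H X (e i) z) (e j z)

/-- Connections on `π^*TM`; `toFun s z (X z)` is `(∇_X s)(z)`. -/
structure PullConnection (m : ℕ) (M : Type*) [TopologicalSpace M] [ChartedSpace (Base m) M]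
    [IsManifold (𝓡 (m + 1)) ∞ M] where
  toFun : PullSection m M → (z : SphereBundle m M) → TSM z →L[ℝ] PullTM z
  add : ∀ (s t : PullSection m M) (z : SphereBundle m M), PullDiffAt s z → PullDiffAt t z →
    ∀ X : TSM z, toFun (fun w => s w + t w) z X = toFun s z X + toFun t z X
  leibniz : ∀ (f : SphereBundle m M → ℝ) (s : PullSection m M) (z : SphereBundle m M),
    MDifferentiableAt 𝓘(ℝ, SMModel m) 𝓘(ℝ, ℝ) f z → PullDiffAt s z →
    ∀ X : TSM z, toFun (fun w => f w • s w) z X = f z • toFun s z X + dAlong f z X • s z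

/-- The Chern connection on `π^*TM`: torsion-free and almost compatible with `g`, that is
`X g(s, t) - g(∇_X s, t) - g(s, ∇_X t) = 2 A(s, t, δy(X))`. In an orthonormal frame with coframe `ϑ`
these are the equations `dϑ = ϑ ∧ om` and `om_ij + om_ji = -2 A_ijk δyᵏ`. -/
structure FinslerStructure.IsChern (F : FinslerStructure m M) (C : PullConnection m M) : Prop where
  torsion_free : ∀ (z : SphereBundle m M) (X Y : VField m M), SmoothAt X z → SmoothAt Y z →
    C.toFun (fun w => dproj w (Y w)) z (X z) - C.toFun (fun w => dproj w (X w)) z (Y z) =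
      dproj z (lieBr X Y z)
  almost_metric : ∀ (z : SphereBundle m M) (s t : PullSection m M),
    PullSmoothAt s z → PullSmoothAt t z → ∀ X : TSM z,
    dAlong (fun w => F.fund w (s w) (t w)) z X - F.fund z (C.toFun s z X) (t z)
      - F.fund z (s z) (C.toFun t z X) = 2 * F.cartanTensor z (s z) (t z) X

/-- The Cartan connection on `π^*TM`: in natural coordinates its forms are `om_i^j + A^j_ik δyᵏ`, where
`om_i^j` are the forms of the Chern connection. -/
def FinslerStructure.IsCartan (F : FinslerStructure m M) (C : PullConnection m M) : Prop :=
  ∃ C₀ : PullConnection m M, F.IsChern C₀ ∧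
    ∀ (z : SphereBundle m M) (s : PullSection m M), PullSmoothAt s z → ∀ (X : TSM z) (b : PullTM z),
      F.fund z (C.toFun s z X) b = F.fund z (C₀.toFun s z X) b + F.cartanTensor z (s z) b X

/-- The connection `D` on `H(SM)` corresponds to the connection `C` on `π^*TM` under the
identification `dπ : H(SM) ≃ π^*TM`. -/
def FinslerStructure.Corresponds (F : FinslerStructure m M) (D : Op m M)
    (C : PullConnection m M) : Prop :=
  ∀ (z : SphereBundle m M) (X U : VField m M), SmoothAt X z → SmoothAt U z →
    F.HorizontalNear U z →
    D X U z ∈ F.hor z ∧ dproj z (D X U z) = C.toFun (fun w => dproj w (U w)) z (X z)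

end Geometry
end Finsler

/-!
The sphere bundle `SM` is studied through natural coordinates `(x, y)`, `‖y‖ = 1`, which embed its
tangent spaces by `dCoord`; conversely every pair `(dx, dy)` represents a tangent vector, up to
multiples of `y` in `dy` (`dCoord_ofCoord`). Every construction is first made in coordinates, and its
independence of the chart follows from the transformation laws of `g`, of the spray `G` and of the
nonlinear connection `N = ∂G/∂y` under a change of charts followed by a dilation of the fibres
(`gForm_fibreLift`, `sprayVec_fibreLift`, `nonlinMap_fibreLift`). The law for `G` comes from its
characterization by the Euler–Lagrange equation of `F²` (`spray_equation`, `spray_unique`), and the law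
for `N` by differentiation. As a result `δy` is a vector up to multiples of `y`, which lie in the kernel
of the angular form `g - F_y ⊗ F_y`. So the Sasaki-type metric is well defined, it is positive definite,
and its horizontal vectors are those with `δy` proportional to `y` (`mem_hor_iff`). On them the metric is
`g`, and the Cartan tensor vanishes because `g` is homogeneous of degree zero in `y`
(`cartanTensor_of_hor`).

The Levi-Civita connection is defined by the Koszul formula, whose right-hand side is tensorial in two
of its arguments. The Chern connection is given in coordinates by Christoffel symbols, in which the
partial derivatives of `g` are replaced by derivatives along the horizontal vectors `(a, -N a)`
(`exists_christoffel`).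

Let `C` be any Chern connection. For `X` vertical, torsion-freeness says `C_X (dπ U) = dπ [X, U]`, which
is the Bott connection. For horizontal fields, torsion-freeness and the vanishing of the Cartan tensor
give the Koszul formula for `C`, which is the Koszul formula of the Levi-Civita connection tested on
horizontal fields (`koszul_unique`). Hence `C` is the Bott connection (`corresponds_bott`). Almost
compatibility with `g` then says that the dual connection is `C + 2A`, so the Cartan endomorphism is
the Cartan tensor (`cartanEndo_spec`) and the symmetrization is the Cartan connection
(`corresponds_symmetrization`).

In an adapted frame, the structure equations express that the Bott connection is torsion-free and
almost metric. The difference of two solutions defines `d_kil` that is antisymmetric in `k, i` and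
symmetric in `k, l`, hence zero (`structureEquations_unique`).
-/

namespace Finsler

/-! ### Finsler functions in an open set of natural coordinates -/

section LocalAnalysis
variable {m : ℕ}

theorem two_le_infty : (2 : ℕ∞ω) ≤ ∞ := WithTop.coe_le_coe.2 (le_top : (2 : ℕ∞) ≤ ⊤)

/-- The pairs `(x, y)` with `x ∈ O` and `y ≠ 0`. -/
def slit (O : Set (Base m)) : Set (Base m × Base m) := {q | q.1 ∈ O ∧ q.2 ≠ 0}

/-- The square `L = F²` of a Finsler function. -/
abbrev energy (f : Base m × Base m → ℝ) : Base m × Base m → ℝ := fun r => f r ^ 2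

/-- `f` is a Finsler function in natural coordinates `(x, y)`, for `x` in the open set `O`. -/
structure IsLocalFinsler (f : Base m × Base m → ℝ) (O : Set (Base m)) : Prop where
  isOpen : IsOpen O
  smooth : ContDiffOn ℝ ∞ f (slit O)
  pos : ∀ q ∈ slit O, 0 < f q
  homog : ∀ q ∈ slit O, ∀ c : ℝ, 0 < c → f (q.1, c • q.2) = c * f q
  posDef : ∀ q ∈ slit O, (gMat f q).PosDef

/-- The bilinear form `g_ij aⁱ bʲ`. -/
def gForm (f : Base m × Base m → ℝ) (q : Base m × Base m) (a b : Base m) : ℝ :=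
  ∑ i, ∑ j, gMat f q i j * a i * b j

/-- The spray coefficients `(Gⁱ)` as a vector. -/
def sprayVec (f : Base m × Base m → ℝ) (q : Base m × Base m) : Base m :=
  WithLp.toLp 2 fun i => spray f i q

/-- The nonlinear connection `a ↦ (Nⁱ_j aʲ)`. -/
def nonlinMap (f : Base m × Base m → ℝ) (q : Base m × Base m) : Base m →L[ℝ] Base m :=
  (fderiv ℝ (sprayVec f) q).comp (ContinuousLinearMap.inr ℝ (Base m) (Base m))

/-- The angular form `(g_ij - F_{yⁱ} F_{yʲ}) aⁱ bʲ`. -/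
def hForm (f : Base m × Base m → ℝ) (q : Base m × Base m) (a b : Base m) : ℝ :=
  gForm f q a b - fderiv ℝ f q (0, a) * fderiv ℝ f q (0, b)

theorem sum_single (a : Base m) : ∑ i, a i • (EuclideanSpace.single i (1 : ℝ) : Base m) = a := by
  have := (EuclideanSpace.basisFun (Fin (m + 1)) ℝ).sum_repr a
  simpa using this

theorem clm_snd_eq_sum {E : Type*} [NormedAddCommGroup E] [NormedSpace ℝ E]
    (T : Base m × Base m →L[ℝ] E) (a : Base m) :
    T (0, a) = ∑ i, a i • T (0, EuclideanSpace.single i 1) := by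
  have h : T (0, a) = (T.comp (ContinuousLinearMap.inr ℝ (Base m) (Base m))) a := by simp
  rw [h]
  nth_rewrite 1 [← sum_single a]
  rw [map_sum]
  simp

theorem clm_fst_eq_sum {E : Type*} [NormedAddCommGroup E] [NormedSpace ℝ E]
    (T : Base m × Base m →L[ℝ] E) (a : Base m) :
    T (a, 0) = ∑ i, a i • T (EuclideanSpace.single i 1, 0) := by
  have h : T (a, 0) = (T.comp (ContinuousLinearMap.inl ℝ (Base m) (Base m))) a := by simp
  rw [h]
  nth_rewrite 1 [← sum_single a]
  rw [map_sum]
  simp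

theorem isOpen_slit {O : Set (Base m)} (h : IsOpen O) : IsOpen (slit O) := by
  have : slit O = O ×ˢ {(0 : Base m)}ᶜ := by ext q; simp [slit]
  rw [this]
  exact h.prod isOpen_compl_singleton

/-- Two differentiations along constant vectors, as a second derivative. -/
theorem fderiv_fderiv_apply {E : Type*} [NormedAddCommGroup E] [NormedSpace ℝ E] {k : E → ℝ}
    {q : E} (hk : ContDiffAt ℝ 2 k q) (u v : E) :
    fderiv ℝ (fun r => fderiv ℝ k r v) q u = fderiv ℝ (fderiv ℝ k) q u v := by
  have h : DifferentiableAt ℝ (fderiv ℝ k) q :=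
    (hk.fderiv_right (m := 1) le_rfl).differentiableAt one_ne_zero
  rw [fderiv_clm_apply h (differentiableAt_const v)]
  simp

theorem second_symm {E F : Type*} [NormedAddCommGroup E] [NormedSpace ℝ E] [NormedAddCommGroup F]
    [NormedSpace ℝ F] {k : E → F} {q : E} (hk : ContDiffAt ℝ 2 k q) (u v : E) :
    fderiv ℝ (fderiv ℝ k) q u v = fderiv ℝ (fderiv ℝ k) q v u :=
  (hk.isSymmSndFDerivAt (by simp)).eq u v

namespace IsLocalFinsler
variable {f : Base m × Base m → ℝ} {O : Set (Base m)} (hf : IsLocalFinsler f O)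
  {q : Base m × Base m}
include hf

theorem slit_mem_nhds (hq : q ∈ slit O) : slit O ∈ 𝓝 q := (isOpen_slit hf.isOpen).mem_nhds hq

theorem contDiffAt (hq : q ∈ slit O) : ContDiffAt ℝ ∞ f q :=
  hf.smooth.contDiffAt (hf.slit_mem_nhds hq)

theorem contDiffOn_energy : ContDiffOn ℝ ∞ (energy f) (slit O) := hf.smooth.pow 2

theorem contDiffAt_energy (hq : q ∈ slit O) : ContDiffAt ℝ ∞ (energy f) q := (hf.contDiffAt hq).pow 2

theorem contDiffOn_fderiv_energy : ContDiffOn ℝ ∞ (fderiv ℝ (energy f)) (slit O) :=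
  hf.contDiffOn_energy.fderiv_of_isOpen (isOpen_slit hf.isOpen) (by simp)

theorem contDiffOn_fderiv_fderiv_energy :
    ContDiffOn ℝ ∞ (fderiv ℝ (fderiv ℝ (energy f))) (slit O) :=
  hf.contDiffOn_fderiv_energy.fderiv_of_isOpen (isOpen_slit hf.isOpen) (by simp)

theorem gMat_eq (hq : q ∈ slit O) (i j : Fin (m + 1)) :
    gMat f q i j = 1 / 2 * fderiv ℝ (fderiv ℝ (energy f)) q (0, EuclideanSpace.single j 1)
      (0, EuclideanSpace.single i 1) := by
  have h2 : ContDiffAt ℝ 2 (energy f) q := (hf.contDiffAt_energy hq).of_le two_le_infty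
  simp only [gMat, Matrix.of_apply]
  rw [← fderiv_fderiv_apply h2]
  rfl

theorem gForm_eq (hq : q ∈ slit O) (a b : Base m) :
    gForm f q a b = 1 / 2 * fderiv ℝ (fderiv ℝ (energy f)) q (0, a) (0, b) := by
  have h2 : ContDiffAt ℝ 2 (energy f) q := (hf.contDiffAt_energy hq).of_le two_le_infty
  rw [second_symm h2, clm_snd_eq_sum (fderiv ℝ (fderiv ℝ (energy f)) q) b, gForm, Finset.sum_comm]
  simp only [_root_.sum_apply, _root_.smul_apply, Finset.mul_sum]
  refine Finset.sum_congr rfl fun j _ => ?_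
  rw [clm_snd_eq_sum _ a, smul_eq_mul, Finset.mul_sum, Finset.mul_sum]
  refine Finset.sum_congr rfl fun i _ => ?_
  rw [hf.gMat_eq hq, smul_eq_mul]
  ring

theorem gForm_symm (hq : q ∈ slit O) (a b : Base m) : gForm f q a b = gForm f q b a := by
  have h2 : ContDiffAt ℝ 2 (energy f) q := (hf.contDiffAt_energy hq).of_le two_le_infty
  rw [hf.gForm_eq hq, hf.gForm_eq hq, second_symm h2]

theorem gForm_pos (hq : q ∈ slit O) {a : Base m} (ha : a ≠ 0) : 0 < gForm f q a a := by
  have h := (hf.posDef q hq).dotProduct_mulVec_pos (x := a.ofLp)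
    (fun h => ha (by ext i; simpa using congrFun h i))
  simp only [star_trivial, dotProduct, Matrix.mulVec, Finset.mul_sum] at h
  refine h.trans_eq ?_
  exact Finset.sum_congr rfl fun i _ => Finset.sum_congr rfl fun j _ => by ring

theorem contDiffOn_gForm (a b : Base m) : ContDiffOn ℝ ∞ (fun q => gForm f q a b) (slit O) := by
  have := (contDiffOn_const (c := (1 / 2 : ℝ))).mul
    ((hf.contDiffOn_fderiv_fderiv_energy.clm_apply (contDiffOn_const (c := ((0, a) : Base m × Base m)))).clm_apply
    (contDiffOn_const (c := ((0, b) : Base m × Base m))))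
  exact this.congr fun q hq => hf.gForm_eq hq a b

end IsLocalFinsler

theorem gForm_add_left (f : Base m × Base m → ℝ) (q a a' b) :
    gForm f q (a + a') b = gForm f q a b + gForm f q a' b := by
  simp [gForm, mul_add, add_mul, Finset.sum_add_distrib]

theorem gForm_add_right (f : Base m × Base m → ℝ) (q a b b') :
    gForm f q a (b + b') = gForm f q a b + gForm f q a b' := by
  simp [gForm, mul_add, Finset.sum_add_distrib]

theorem gForm_smul_left (f : Base m × Base m → ℝ) (q) (c : ℝ) (a b) :
    gForm f q (c • a) b = c * gForm f q a b := by
  simp only [gForm, Finset.mul_sum, PiLp.smul_apply, smul_eq_mul]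
  refine Finset.sum_congr rfl fun i _ => Finset.sum_congr rfl fun j _ => by ring

theorem gForm_smul_right (f : Base m × Base m → ℝ) (q) (c : ℝ) (a b) :
    gForm f q a (c • b) = c * gForm f q a b := by
  simp only [gForm, Finset.mul_sum, PiLp.smul_apply, smul_eq_mul]
  refine Finset.sum_congr rfl fun i _ => Finset.sum_congr rfl fun j _ => by ring

theorem gForm_single (f : Base m × Base m → ℝ) (q) (i j : Fin (m + 1)) :
    gForm f q (EuclideanSpace.single i 1) (EuclideanSpace.single j 1) = gMat f q i j := by
  rw [gForm, Finset.sum_eq_single i, Finset.sum_eq_single j] <;> simp +contextual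

/-- `gForm` as a bilinear form. -/
def gBilin (f : Base m × Base m → ℝ) (q : Base m × Base m) : LinearMap.BilinForm ℝ (Base m) :=
  LinearMap.mk₂ ℝ (gForm f q) (gForm_add_left f q) (gForm_smul_left f q) (gForm_add_right f q)
    (gForm_smul_right f q)

namespace IsLocalFinsler
variable {f : Base m × Base m → ℝ} {O : Set (Base m)} (hf : IsLocalFinsler f O)
  {q : Base m × Base m}
include hf

theorem gForm_eq_zero (hq : q ∈ slit O) {a : Base m} (h : ∀ b, gForm f q a b = 0) : a = 0 := by
  by_contra ha
  exact (hf.gForm_pos hq ha).ne' (h a)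

theorem nondegenerate_gBilin (hq : q ∈ slit O) : (gBilin f q).Nondegenerate := by
  refine ⟨fun a h => hf.gForm_eq_zero hq h, fun a h => hf.gForm_eq_zero hq fun b => ?_⟩
  rw [hf.gForm_symm hq]
  exact h b

theorem contDiffOn_gMat (i j : Fin (m + 1)) : ContDiffOn ℝ ∞ (fun q => gMat f q i j) (slit O) := by
  refine (hf.contDiffOn_gForm (EuclideanSpace.single i 1) (EuclideanSpace.single j 1)).congr ?_
  intro q _
  rw [gForm_single]

end IsLocalFinsler

theorem contDiffOn_det {E : Type*} [NormedAddCommGroup E] [NormedSpace ℝ E] {ι : Type*} [Fintype ι]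
    [DecidableEq ι] {A : E → Matrix ι ι ℝ} {s : Set E}
    (h : ∀ i j, ContDiffOn ℝ ∞ (fun q => A q i j) s) : ContDiffOn ℝ ∞ (fun q => (A q).det) s := by
  simp only [Matrix.det_apply']
  exact ContDiffOn.sum fun σ _ => contDiffOn_const.mul (contDiffOn_prod fun i _ => h _ _)

theorem contDiffOn_matrix_inv {E : Type*} [NormedAddCommGroup E] [NormedSpace ℝ E] {ι : Type*}
    [Fintype ι] [DecidableEq ι] {A : E → Matrix ι ι ℝ} {s : Set E}
    (h : ∀ i j, ContDiffOn ℝ ∞ (fun q => A q i j) s) (hA : ∀ q ∈ s, (A q).det ≠ 0) (i j : ι) :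
    ContDiffOn ℝ ∞ (fun q => (A q)⁻¹ i j) s := by
  simp only [Matrix.inv_def, Matrix.smul_apply, Ring.inverse_eq_inv', smul_eq_mul,
    Matrix.adjugate_apply]
  refine ((contDiffOn_det h).inv hA).mul (contDiffOn_det fun k l => ?_)
  by_cases hk : k = j
  · subst hk
    simpa using contDiffOn_const
  · simpa [Matrix.updateRow_ne hk] using h k l

namespace IsLocalFinsler
variable {f : Base m × Base m → ℝ} {O : Set (Base m)} (hf : IsLocalFinsler f O)
  {q : Base m × Base m}
include hf

theorem contDiffOn_sprayVec : ContDiffOn ℝ ∞ (sprayVec f) (slit O) := by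
  rw [contDiffOn_euclidean]
  intro i
  have hy : ∀ j, ContDiffOn ℝ ∞ (pdy j (energy f)) (slit O) := fun j =>
    hf.contDiffOn_fderiv_energy.clm_apply contDiffOn_const
  have hx : ∀ j, ContDiffOn ℝ ∞ (pdx j (energy f)) (slit O) := fun j =>
    hf.contDiffOn_fderiv_energy.clm_apply contDiffOn_const
  have hxy : ∀ k j, ContDiffOn ℝ ∞ (pdx k (pdy j (energy f))) (slit O) := fun k j =>
    ((hy j).fderiv_of_isOpen (isOpen_slit hf.isOpen) (by simp)).clm_apply contDiffOn_const
  have hc : ∀ k : Fin (m + 1), ContDiffOn ℝ ∞ (fun q : Base m × Base m => q.2 k) (slit O) :=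
    fun k => (contDiffOn_euclidean.1 contDiffOn_snd k)
  exact contDiffOn_const.mul (ContDiffOn.sum fun j _ =>
    (contDiffOn_matrix_inv hf.contDiffOn_gMat (fun q hq => (hf.posDef q hq).det_pos.ne') i j).mul
      ((ContDiffOn.sum fun k _ => (hxy k j).mul (hc k)).sub (hx j)))

theorem contDiffOn_nonlinMap : ContDiffOn ℝ ∞ (nonlinMap f) (slit O) :=
  (hf.contDiffOn_sprayVec.fderiv_of_isOpen (isOpen_slit hf.isOpen) (by simp)).clm_comp
    contDiffOn_const

theorem nonlin_sum (hq : q ∈ slit O) (a : Base m) (i : Fin (m + 1)) :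
    nonlinMap f q a i = ∑ j, pdy j (spray f i) q * a j := by
  have hd : DifferentiableAt ℝ (sprayVec f) q :=
    (hf.contDiffOn_sprayVec.contDiffAt (hf.slit_mem_nhds hq)).differentiableAt (by simp)
  have h1 : ∀ v, fderiv ℝ (sprayVec f) q v i = fderiv ℝ (spray f i) q v := by
    intro v
    have := ((EuclideanSpace.proj i : Base m →L[ℝ] ℝ).hasFDerivAt.comp q hd.hasFDerivAt).fderiv
    have h2 : (⇑(EuclideanSpace.proj i : Base m →L[ℝ] ℝ) ∘ sprayVec f) = spray f i := by
      ext; simp [sprayVec]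
    rw [h2] at this
    rw [this]
    simp
  change fderiv ℝ (sprayVec f) q ((0 : Base m), a) i = _
  rw [h1, clm_snd_eq_sum]
  exact Finset.sum_congr rfl fun j _ => by rw [smul_eq_mul, mul_comm]; rfl

/-- The defining equation of the spray `S = (y, -2G)`: it is the Euler–Lagrange field of `L`. -/
theorem spray_equation (hq : q ∈ slit O) (w : Base m) :
    fderiv ℝ (fderiv ℝ (energy f)) q (q.2, (-2 : ℝ) • sprayVec f q) (0, w) =
      fderiv ℝ (energy f) q (w, 0) := by
  have h2 : ContDiffAt ℝ 2 (energy f) q := (hf.contDiffAt_energy hq).of_le two_le_infty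
  set D2 := fderiv ℝ (fderiv ℝ (energy f)) q with hD2
  have hdet : IsUnit (gMat f q).det := (hf.posDef q hq).det_pos.ne'.isUnit
  let ρ : Fin (m + 1) → ℝ := fun j =>
    ∑ k, pdx k (pdy j (energy f)) q * q.2 k - pdx j (energy f) q
  have hρ : ∀ j, ρ j = D2 (q.2, 0) (0, EuclideanSpace.single j 1) -
      fderiv ℝ (energy f) q (EuclideanSpace.single j 1, 0) := by
    intro j
    simp only [ρ]
    rw [clm_fst_eq_sum D2 q.2]
    simp only [_root_.sum_apply, _root_.smul_apply, smul_eq_mul]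
    refine congrArg₂ _ (Finset.sum_congr rfl fun k _ => ?_) rfl
    rw [mul_comm, hD2, ← fderiv_fderiv_apply h2]
    rfl
  have hG : ∀ i, sprayVec f q i = 1 / 4 * ((gMat f q)⁻¹.mulVec ρ) i := fun i => rfl
  have hgG : ∀ j, D2 (0, sprayVec f q) (0, EuclideanSpace.single j 1) = 1 / 2 * ρ j := by
    intro j
    have h3 := hf.gForm_eq hq (EuclideanSpace.single j 1) (sprayVec f q)
    rw [second_symm h2] at h3
    have h4 : gForm f q (EuclideanSpace.single j 1) (sprayVec f q) = 1 / 4 * ρ j := by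
      rw [gForm, Finset.sum_eq_single j]
      · have h5 : (gMat f q).mulVec ((gMat f q)⁻¹.mulVec ρ) j = ρ j := by
          rw [Matrix.mulVec_mulVec, Matrix.mul_nonsing_inv _ hdet, Matrix.one_mulVec]
        rw [← h5]
        simp only [hG, Matrix.mulVec, dotProduct, PiLp.single_apply, if_true, mul_one,
          Finset.mul_sum]
        exact Finset.sum_congr rfl fun k _ => Finset.sum_congr rfl fun l _ => by ring
      · intro b _ hb
        simp [hb]
      · simp
    linarith
  have key : ∀ j, D2 (q.2, (-2 : ℝ) • sprayVec f q) (0, EuclideanSpace.single j 1) =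
      fderiv ℝ (energy f) q (EuclideanSpace.single j 1, 0) := by
    intro j
    have h6 : ((q.2, (-2 : ℝ) • sprayVec f q) : Base m × Base m) =
        (q.2, 0) + (-2 : ℝ) • (0, sprayVec f q) := by simp
    rw [h6, map_add, map_smul, _root_.add_apply, _root_.smul_apply, hgG,
      smul_eq_mul]
    linarith [hρ j]
  rw [clm_snd_eq_sum, clm_fst_eq_sum]
  exact Finset.sum_congr rfl fun j _ => by rw [key]

/-- The spray equation determines `G`, because `g` is nondegenerate. -/
theorem spray_unique (hq : q ∈ slit O) {v : Base m}
    (hv : ∀ w, fderiv ℝ (fderiv ℝ (energy f)) q (q.2, (-2 : ℝ) • v) (0, w) =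
      fderiv ℝ (energy f) q (w, 0)) : sprayVec f q = v := by
  rw [← sub_eq_zero]
  refine hf.gForm_eq_zero hq fun w => ?_
  have h1 := hf.spray_equation hq w
  have h2 := hv w
  have h3 : ((q.2, (-2 : ℝ) • v) : Base m × Base m) =
      (q.2, (-2 : ℝ) • sprayVec f q) + (2 : ℝ) • (0, sprayVec f q - v) := by
    ext i
    · simp
    · simp; ring
  rw [h3, map_add, map_smul, _root_.add_apply, _root_.smul_apply, h1,
    smul_eq_mul, ← sub_eq_zero] at h2
  rw [hf.gForm_eq hq]
  linarith

end IsLocalFinsler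

end LocalAnalysis

/-! ### Change of coordinates and homogeneity -/

section CoordChange
variable {m : ℕ}

/-- `φ` is a change of coordinates from `O` to `O'` under which the Finsler functions `f` and `f'`
correspond. -/
structure IsCoordChange (f f' : Base m × Base m → ℝ) (O O' : Set (Base m)) (φ : Base m → Base m) :
    Prop where
  left : IsLocalFinsler f O
  right : IsLocalFinsler f' O'
  smooth : ContDiffOn ℝ ∞ φ O
  mapsTo : ∀ x ∈ O, φ x ∈ O'
  injective : ∀ x ∈ O, Function.Injective (fderiv ℝ φ x)
  compat : ∀ q ∈ slit O, f' (φ q.1, fderiv ℝ φ q.1 q.2) = f q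

/-- The map `(x, y) ↦ (φ x, c Dφ_x y)`: the change of natural coordinates followed by a dilation of
the fibres. -/
def fibreLift (φ : Base m → Base m) (c : ℝ) (q : Base m × Base m) : Base m × Base m :=
  (φ q.1, c • fderiv ℝ φ q.1 q.2)

/-- The derivative of `fibreLift φ c` at `q`. -/
def fibreLiftDeriv (φ : Base m → Base m) (c : ℝ) (q : Base m × Base m) :
    Base m × Base m →L[ℝ] Base m × Base m :=
  ((fderiv ℝ φ q.1).comp (ContinuousLinearMap.fst ℝ _ _)).prod
    (c • (((fderiv ℝ (fderiv ℝ φ) q.1).flip q.2).comp (ContinuousLinearMap.fst ℝ _ _) +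
      (fderiv ℝ φ q.1).comp (ContinuousLinearMap.snd ℝ _ _)))

theorem fibreLiftDeriv_apply (φ : Base m → Base m) (c : ℝ) (q ξ : Base m × Base m) :
    fibreLiftDeriv φ c q ξ = (fderiv ℝ φ q.1 ξ.1,
      c • (fderiv ℝ (fderiv ℝ φ) q.1 ξ.1 q.2 + fderiv ℝ φ q.1 ξ.2)) := by
  simp [fibreLiftDeriv]

namespace IsCoordChange
variable {f f' : Base m × Base m → ℝ} {O O' : Set (Base m)} {φ : Base m → Base m}
  (h : IsCoordChange f f' O O' φ) {q : Base m × Base m} {c : ℝ}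
include h

theorem contDiffAt {x : Base m} (hx : x ∈ O) : ContDiffAt ℝ ∞ φ x :=
  h.smooth.contDiffAt (h.left.isOpen.mem_nhds hx)

theorem hasFDerivAt_fderiv {x : Base m} (hx : x ∈ O) :
    HasFDerivAt (fderiv ℝ φ) (fderiv ℝ (fderiv ℝ φ) x) x :=
  (((h.contDiffAt hx).of_le two_le_infty).fderiv_right (m := 1) le_rfl).differentiableAt
    one_ne_zero |>.hasFDerivAt

theorem fibreLift_mem (hq : q ∈ slit O) (hc : 0 < c) : fibreLift φ c q ∈ slit O' :=
  ⟨h.mapsTo _ hq.1, smul_ne_zero hc.ne' fun h0 =>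
    hq.2 (h.injective _ hq.1 (h0.trans (map_zero _).symm))⟩

theorem bijective {x : Base m} (hx : x ∈ O) : Function.Bijective (fderiv ℝ φ x) :=
  ⟨h.injective x hx, LinearMap.surjective_of_injective (f := (fderiv ℝ φ x).toLinearMap)
    (h.injective x hx)⟩

theorem hasFDerivAt_fibreLift (hx : q.1 ∈ O) (c : ℝ) :
    HasFDerivAt (fibreLift φ c) (fibreLiftDeriv φ c q) q := by
  have h1 : HasFDerivAt (fun r : Base m × Base m => φ r.1)
      ((fderiv ℝ φ q.1).comp (ContinuousLinearMap.fst ℝ _ _)) q :=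
    ((h.contDiffAt hx).differentiableAt (by simp)).hasFDerivAt.comp q hasFDerivAt_fst
  have h2 := (((h.hasFDerivAt_fderiv hx).comp q hasFDerivAt_fst).clm_apply
    (hasFDerivAt_snd (p := q))).const_smul c
  refine (h1.prodMk h2).congr_fderiv ?_
  ext ξ <;> simp [fibreLiftDeriv]

theorem apply_fibreLift (hq : q ∈ slit O) (hc : 0 < c) : f' (fibreLift φ c q) = c * f q := by
  have h1 := h.right.homog (φ q.1, fderiv ℝ φ q.1 q.2)
    (by simpa [fibreLift] using h.fibreLift_mem hq one_pos) c hc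
  rw [h.compat q hq] at h1
  exact h1

theorem fderiv_fibreLift (hq : q ∈ slit O) (hc : 0 < c) (ξ : Base m × Base m) :
    fderiv ℝ f' (fibreLift φ c q) (fibreLiftDeriv φ c q ξ) = c * fderiv ℝ f q ξ := by
  have h1 := ((h.right.contDiffAt (h.fibreLift_mem hq hc)).differentiableAt (by simp)).hasFDerivAt.comp
    q (h.hasFDerivAt_fibreLift hq.1 c)
  have h2 := ((h.left.contDiffAt hq).differentiableAt (by simp)).hasFDerivAt.const_mul c
  have h3 : (f' ∘ fibreLift φ c) =ᶠ[𝓝 q] fun r => c * f r := by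
    filter_upwards [h.left.slit_mem_nhds hq] with r hr using h.apply_fibreLift hr hc
  exact congrArg (fun T => T ξ) (h1.unique (h2.congr_of_eventuallyEq h3))

theorem fderiv_energy_fibreLift (hq : q ∈ slit O) (hc : 0 < c) (ξ : Base m × Base m) :
    fderiv ℝ (energy f') (fibreLift φ c q) (fibreLiftDeriv φ c q ξ) =
      c ^ 2 * fderiv ℝ (energy f) q ξ := by
  have h1 := ((h.right.contDiffAt_energy (h.fibreLift_mem hq hc)).differentiableAt
    (by simp)).hasFDerivAt.comp q (h.hasFDerivAt_fibreLift hq.1 c)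
  have h2 := ((h.left.contDiffAt_energy hq).differentiableAt (by simp)).hasFDerivAt.const_mul (c ^ 2)
  have h3 : (energy f' ∘ fibreLift φ c) =ᶠ[𝓝 q] fun r => c ^ 2 * energy f r := by
    filter_upwards [h.left.slit_mem_nhds hq] with r hr
    simp only [Function.comp_apply, energy, h.apply_fibreLift hr hc]
    ring
  exact congrArg (fun T => T ξ) (h1.unique (h2.congr_of_eventuallyEq h3))

/-- The transformation of the second derivatives of `L` in one arbitrary and one vertical direction. The
second term on the left is due to the dependence of `Dφ` on `x`. -/
theorem fderiv_fderiv_energy_fibreLift (hq : q ∈ slit O) (hc : 0 < c) (ξ : Base m × Base m)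
    (w : Base m) :
    fderiv ℝ (fderiv ℝ (energy f')) (fibreLift φ c q) (fibreLiftDeriv φ c q ξ)
        (0, c • fderiv ℝ φ q.1 w) +
      fderiv ℝ (energy f') (fibreLift φ c q) (0, c • fderiv ℝ (fderiv ℝ φ) q.1 ξ.1 w) =
    c ^ 2 * fderiv ℝ (fderiv ℝ (energy f)) q ξ (0, w) := by
  have hd' : HasFDerivAt (fderiv ℝ (energy f')) _ (fibreLift φ c q) :=
    ((h.right.contDiffOn_fderiv_energy.contDiffAt (h.right.slit_mem_nhds
      (h.fibreLift_mem hq hc))).differentiableAt (by simp)).hasFDerivAt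
  have hd : HasFDerivAt (fderiv ℝ (energy f)) _ q :=
    ((h.left.contDiffOn_fderiv_energy.contDiffAt (h.left.slit_mem_nhds
      hq)).differentiableAt (by simp)).hasFDerivAt
  have h1 : HasFDerivAt (fun r : Base m × Base m => c • fderiv ℝ φ r.1 w)
      (c • ((fderiv ℝ (fderiv ℝ φ) q.1).flip w).comp (ContinuousLinearMap.fst ℝ _ _)) q := by
    have := (((h.hasFDerivAt_fderiv hq.1).comp q hasFDerivAt_fst).clm_apply
      (hasFDerivAt_const w q)).const_smul c
    refine this.congr_fderiv ?_
    ext ξ <;> simp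
  have h2 := (hd'.comp q (h.hasFDerivAt_fibreLift hq.1 c)).clm_apply
    ((hasFDerivAt_const (0 : Base m) q).prodMk h1)
  have h3 := (hd.clm_apply (hasFDerivAt_const ((0, w) : Base m × Base m) q)).const_mul (c ^ 2)
  have h4 : (fun r => (fderiv ℝ (energy f') ∘ fibreLift φ c) r (0, c • fderiv ℝ φ r.1 w)) =ᶠ[𝓝 q]
      fun r => c ^ 2 * fderiv ℝ (energy f) r (0, w) := by
    filter_upwards [h.left.slit_mem_nhds hq] with r hr
    rw [← h.fderiv_energy_fibreLift hr hc, fibreLiftDeriv_apply]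
    simp
  have h5 := congrArg (fun T => T ξ) (h2.unique (h3.congr_of_eventuallyEq h4))
  simp at h5
  rw [← h5, add_comm]

theorem gForm_fibreLift (hq : q ∈ slit O) (hc : 0 < c) (u w : Base m) :
    gForm f' (fibreLift φ c q) (fderiv ℝ φ q.1 u) (fderiv ℝ φ q.1 w) = gForm f q u w := by
  have h1 := h.fderiv_fderiv_energy_fibreLift hq hc (0, u) w
  rw [fibreLiftDeriv_apply] at h1
  have h2 := h.right.gForm_eq (h.fibreLift_mem hq hc) (c • fderiv ℝ φ q.1 u) (c • fderiv ℝ φ q.1 w)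
  simp only [map_zero, _root_.zero_apply, zero_add, smul_zero, Prod.mk_zero_zero, add_zero] at h1
  rw [h1, gForm_smul_left, gForm_smul_right] at h2
  rw [h.left.gForm_eq hq]
  have : c ^ 2 ≠ 0 := by positivity
  apply mul_left_cancel₀ this
  linear_combination h2

/-- The transformation law of the spray coefficients: the right-hand side satisfies the spray equation. -/
theorem sprayVec_fibreLift (hq : q ∈ slit O) (hc : 0 < c) :
    sprayVec f' (fibreLift φ c q) = c ^ 2 • (fderiv ℝ φ q.1 (sprayVec f q) -
      (1 / 2 : ℝ) • fderiv ℝ (fderiv ℝ φ) q.1 q.2 q.2) := by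
  refine h.right.spray_unique (h.fibreLift_mem hq hc) fun w' => ?_
  obtain ⟨w, rfl⟩ := (h.bijective hq.1).2 w'
  have hsym : fderiv ℝ (fderiv ℝ φ) q.1 q.2 w = fderiv ℝ (fderiv ℝ φ) q.1 w q.2 :=
    second_symm ((h.contDiffAt hq.1).of_le two_le_infty) _ _
  have h1 := h.fderiv_fderiv_energy_fibreLift hq hc (q.2, (-2 : ℝ) • sprayVec f q) w
  rw [h.left.spray_equation hq, ← h.fderiv_energy_fibreLift hq hc, fibreLiftDeriv_apply,
    fibreLiftDeriv_apply] at h1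
  simp only [map_zero, add_zero, hsym] at h1
  have h2 : ((fderiv ℝ φ q.1 w, c • fderiv ℝ (fderiv ℝ φ) q.1 w q.2) : Base m × Base m) =
      (fderiv ℝ φ q.1 w, 0) + (0, c • fderiv ℝ (fderiv ℝ φ) q.1 w q.2) := by simp
  rw [h2, map_add, add_left_inj] at h1
  rw [← h1]
  have h3 : ((0, c • fderiv ℝ φ q.1 w) : Base m × Base m) = c • (0, fderiv ℝ φ q.1 w) := by simp
  have h4 : (((fibreLift φ c q).2, (-2 : ℝ) • c ^ 2 • (fderiv ℝ φ q.1 (sprayVec f q) -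
      (1 / 2 : ℝ) • fderiv ℝ (fderiv ℝ φ) q.1 q.2 q.2)) : Base m × Base m) =
      c • (fderiv ℝ φ q.1 q.2, c • (fderiv ℝ (fderiv ℝ φ) q.1 q.2 q.2 +
        fderiv ℝ φ q.1 ((-2 : ℝ) • sprayVec f q))) := by
    refine Prod.ext rfl ?_
    simp only [map_smul, Prod.smul_mk]
    module
  rw [h4, map_smul, h3, _root_.smul_apply]
  exact (map_smul _ _ _).symm

/-- The transformation law of the nonlinear connection. Its inhomogeneous term `D²φ(w, y)` is the one of
`fibreLiftDeriv`, so that the two cancel in `δy`. -/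
theorem nonlinMap_fibreLift (hq : q ∈ slit O) (hc : 0 < c) (w : Base m) :
    nonlinMap f' (fibreLift φ c q) (fderiv ℝ φ q.1 w) =
      c • (fderiv ℝ φ q.1 (nonlinMap f q w) - fderiv ℝ (fderiv ℝ φ) q.1 w q.2) := by
  have hd' : HasFDerivAt (sprayVec f') _ (fibreLift φ c q) :=
    ((h.right.contDiffOn_sprayVec.contDiffAt (h.right.slit_mem_nhds
      (h.fibreLift_mem hq hc))).differentiableAt (by simp)).hasFDerivAt
  have hd : HasFDerivAt (sprayVec f) _ q :=
    ((h.left.contDiffOn_sprayVec.contDiffAt (h.left.slit_mem_nhds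
      hq)).differentiableAt (by simp)).hasFDerivAt
  have hsym : fderiv ℝ (fderiv ℝ φ) q.1 q.2 w = fderiv ℝ (fderiv ℝ φ) q.1 w q.2 :=
    second_symm ((h.contDiffAt hq.1).of_le two_le_infty) _ _
  -- The derivatives along `(0, w)` only involve `Dφ` and `D²φ` at the fixed point `q.1`.
  have e : HasDerivAt (fun t : ℝ => ((q.1, q.2 + t • w) : Base m × Base m)) (0, w) 0 := by
    have := ((hasDerivAt_id (0 : ℝ)).smul_const w).const_add q.2
    simp only [one_smul] at this
    exact (hasDerivAt_const (0 : ℝ) q.1).prodMk this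
  have e0 : ((q.1, q.2 + (0 : ℝ) • w) : Base m × Base m) = q := by simp
  have h1 := (hd'.comp q (h.hasFDerivAt_fibreLift hq.1 c))
  have h2 : HasDerivAt (fun t : ℝ => sprayVec f' (fibreLift φ c (q.1, q.2 + t • w)))
      (fderiv ℝ (sprayVec f') (fibreLift φ c q) (fibreLiftDeriv φ c q (0, w))) 0 :=
    HasFDerivAt.comp_hasDerivAt_of_eq (0 : ℝ) h1 e e0.symm
  have h3 : HasDerivAt (fun t : ℝ => sprayVec f (q.1, q.2 + t • w))
      (fderiv ℝ (sprayVec f) q (0, w)) 0 :=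
    HasFDerivAt.comp_hasDerivAt_of_eq (0 : ℝ) hd e e0.symm
  have e2 : HasDerivAt (fun t : ℝ => q.2 + t • w) w 0 := by
    have := ((hasDerivAt_id (0 : ℝ)).smul_const w).const_add q.2
    rw [one_smul] at this
    exact this
  have h4 : HasDerivAt (fun t : ℝ => fderiv ℝ (fderiv ℝ φ) q.1 (q.2 + t • w) (q.2 + t • w))
      (fderiv ℝ (fderiv ℝ φ) q.1 w q.2 + fderiv ℝ (fderiv ℝ φ) q.1 q.2 w) 0 := by
    have := (((fderiv ℝ (fderiv ℝ φ) q.1).hasFDerivAt.comp_hasDerivAt (0 : ℝ) e2)).clm_apply e2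
    simpa using this
  have h5 := (((fderiv ℝ φ q.1).hasFDerivAt.comp_hasDerivAt (0 : ℝ) h3).sub
    (h4.const_smul (1 / 2 : ℝ))).const_smul (c ^ 2)
  have hmem : ∀ᶠ t : ℝ in 𝓝 0, ((q.1, q.2 + t • w) : Base m × Base m) ∈ slit O := by
    have := e.continuousAt.preimage_mem_nhds (t := slit O) (by rw [e0]; exact h.left.slit_mem_nhds hq)
    exact this
  have h6 := h2.unique (h5.congr_of_eventuallyEq (hmem.mono fun t ht => h.sprayVec_fibreLift ht hc))
  rw [fibreLiftDeriv_apply] at h6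
  simp only [map_zero, _root_.zero_apply, zero_add, hsym] at h6
  have h7 : ((0, c • fderiv ℝ φ q.1 w) : Base m × Base m) = c • (0, fderiv ℝ φ q.1 w) := by simp
  rw [h7, map_smul] at h6
  have h8 : c • nonlinMap f' (fibreLift φ c q) (fderiv ℝ φ q.1 w) =
      c • c • (fderiv ℝ φ q.1 (nonlinMap f q w) - fderiv ℝ (fderiv ℝ φ) q.1 w q.2) := by
    change c • fderiv ℝ (sprayVec f') (fibreLift φ c q) (0, fderiv ℝ φ q.1 w) = _
    rw [h6]
    change _ = c • c • (fderiv ℝ φ q.1 (fderiv ℝ (sprayVec f) q (0, w)) - _)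
    module
  exact smul_right_injective _ hc.ne' h8

end IsCoordChange

/-- Euler's relation for a function that is homogeneous of degree `r` in `y`. -/
theorem euler_relation {k : Base m × Base m → ℝ} {q : Base m × Base m} (hk : DifferentiableAt ℝ k q)
    (r : ℕ) (h : ∀ c : ℝ, 0 < c → k (q.1, c • q.2) = c ^ r * k q) :
    fderiv ℝ k q (0, q.2) = r * k q := by
  have e : HasDerivAt (fun t : ℝ => ((q.1, t • q.2) : Base m × Base m)) (0, q.2) 1 := by
    have := (hasDerivAt_id (1 : ℝ)).smul_const q.2
    simp only [one_smul] at this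
    exact (hasDerivAt_const (1 : ℝ) q.1).prodMk this
  have h1 : HasDerivAt (fun t : ℝ => k (q.1, t • q.2)) (fderiv ℝ k q (0, q.2)) 1 :=
    HasFDerivAt.comp_hasDerivAt (1 : ℝ) (by simpa using hk.hasFDerivAt) e
  have h2 := (hasDerivAt_pow r (1 : ℝ)).mul_const (k q)
  have h3 : (fun t : ℝ => k (q.1, t • q.2)) =ᶠ[𝓝 1] fun t => t ^ r * k q := by
    filter_upwards [lt_mem_nhds (zero_lt_one (α := ℝ))] with t ht using h t ht
  simpa using h1.unique (h2.congr_of_eventuallyEq h3)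

namespace IsLocalFinsler
variable {f : Base m × Base m → ℝ} {O : Set (Base m)} (hf : IsLocalFinsler f O)
  {q : Base m × Base m} {c : ℝ}
include hf

theorem mono {O₁ : Set (Base m)} (h₁ : IsOpen O₁) (h : O₁ ⊆ O) : IsLocalFinsler f O₁ where
  isOpen := h₁
  smooth := hf.smooth.mono fun _ hq => ⟨h hq.1, hq.2⟩
  pos q hq := hf.pos q ⟨h hq.1, hq.2⟩
  homog q hq := hf.homog q ⟨h hq.1, hq.2⟩
  posDef q hq := hf.posDef q ⟨h hq.1, hq.2⟩

/-- The maps `fibreLift id c` are the dilations of the fibres, so for the identity the transformation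
laws become homogeneity in `y`. -/
theorem isCoordChange_id : IsCoordChange f f O O id where
  left := hf
  right := hf
  smooth := contDiffOn_id
  mapsTo _ h := h
  injective x _ := by simpa using Function.injective_id
  compat q _ := by simp

theorem gForm_smul_fibre (hq : q ∈ slit O) (hc : 0 < c) (a b : Base m) :
    gForm f (q.1, c • q.2) a b = gForm f q a b := by
  simpa [fibreLift] using hf.isCoordChange_id.gForm_fibreLift hq hc a b

theorem fderiv_self (hq : q ∈ slit O) : fderiv ℝ f q (0, q.2) = f q := by
  have := euler_relation ((hf.contDiffAt hq).differentiableAt (by simp)) 1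
    fun c hc => by rw [pow_one]; exact hf.homog q hq c hc
  simpa using this

theorem fderiv_energy (hq : q ∈ slit O) (ξ : Base m × Base m) :
    fderiv ℝ (energy f) q ξ = 2 * f q * fderiv ℝ f q ξ := by
  have := (((hf.contDiffAt hq).differentiableAt (by simp)).hasFDerivAt.pow 2).fderiv
  rw [this]
  simp

/-- `g(y, a) = F F_y(a)`, by Euler's relation for `[F²]_y`. -/
theorem gForm_self_left (hq : q ∈ slit O) (a : Base m) :
    gForm f q q.2 a = f q * fderiv ℝ f q (0, a) := by
  have h2 : ContDiffAt ℝ 2 (energy f) q := (hf.contDiffAt_energy hq).of_le two_le_infty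
  have hd : DifferentiableAt ℝ (fun r => fderiv ℝ (energy f) r (0, a)) q :=
    ((h2.fderiv_right (m := 1) le_rfl).differentiableAt one_ne_zero).clm_apply
      (differentiableAt_const _)
  have := euler_relation hd 1 fun c hc => by
    have h3 := hf.isCoordChange_id.fderiv_energy_fibreLift hq hc (0, a)
    have h4 : ((0, c • a) : Base m × Base m) = c • (0, a) := by simp
    simp only [fibreLift, id_eq, fderiv_id, ContinuousLinearMap.id_apply, fibreLiftDeriv_apply,
      map_zero, _root_.zero_apply, zero_add] at h3
    rw [h4, map_smul, smul_eq_mul] at h3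
    apply mul_left_cancel₀ hc.ne'
    rw [h3]
    ring
  rw [hf.gForm_eq hq, ← fderiv_fderiv_apply h2, this, hf.fderiv_energy hq]
  ring

/-- `g` is homogeneous of degree zero in `y`. -/
theorem fderiv_gForm_self (hq : q ∈ slit O) (a b : Base m) :
    fderiv ℝ (fun r => gForm f r a b) q (0, q.2) = 0 := by
  have := euler_relation (((hf.contDiffOn_gForm a b).contDiffAt
    (hf.slit_mem_nhds hq)).differentiableAt (by simp)) 0
    fun c hc => by rw [pow_zero, one_mul]; exact hf.gForm_smul_fibre hq hc a b
  simpa using this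

theorem fderiv_gForm_symm (hq : q ∈ slit O) (a b : Base m) (ξ : Base m × Base m) :
    fderiv ℝ (fun r => gForm f r a b) q ξ = fderiv ℝ (fun r => gForm f r b a) q ξ := by
  have : (fun r => gForm f r a b) =ᶠ[𝓝 q] fun r => gForm f r b a := by
    filter_upwards [hf.slit_mem_nhds hq] with r hr using hf.gForm_symm hr a b
  rw [this.fderiv_eq]

theorem hForm_symm (hq : q ∈ slit O) (a b : Base m) : hForm f q a b = hForm f q b a := by
  rw [hForm, hForm, hf.gForm_symm hq, mul_comm]

/-- The angular form is `g` evaluated on the components orthogonal to `y`. -/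
theorem hForm_eq (hq : q ∈ slit O) (a b : Base m) :
    hForm f q a b = gForm f q (a - (fderiv ℝ f q (0, a) / f q) • q.2)
      (b - (fderiv ℝ f q (0, b) / f q) • q.2) := by
  have h0 := (hf.pos q hq).ne'
  have h1 := hf.gForm_self_left hq a
  have h2 := hf.gForm_self_left hq b
  have h3 := hf.gForm_self_left hq q.2
  rw [hf.fderiv_self hq] at h3
  have h4 := hf.gForm_symm hq a q.2
  rw [sub_eq_add_neg, sub_eq_add_neg, ← neg_smul, ← neg_smul, gForm_add_left, gForm_add_right,
    gForm_add_right, gForm_smul_left, gForm_smul_left, gForm_smul_right, gForm_smul_right, h4, h1, h2,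
    h3, hForm]
  field_simp
  ring

theorem hForm_self_nonneg (hq : q ∈ slit O) (a : Base m) : 0 ≤ hForm f q a a := by
  rw [hf.hForm_eq hq]
  by_cases h : a - (fderiv ℝ f q (0, a) / f q) • q.2 = 0
  · rw [h]; simp [gForm]
  · exact (hf.gForm_pos hq h).le

/-- The kernel of the angular form is spanned by `y`. -/
theorem exists_smul_of_hForm_self_eq_zero (hq : q ∈ slit O) {a : Base m} (h : hForm f q a a = 0) :
    ∃ c : ℝ, a = c • q.2 := by
  rw [hf.hForm_eq hq] at h
  refine ⟨fderiv ℝ f q (0, a) / f q, sub_eq_zero.1 ?_⟩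
  by_contra h'
  exact (hf.gForm_pos hq h').ne' h

theorem hForm_self_left (hq : q ∈ slit O) (a : Base m) : hForm f q q.2 a = 0 := by
  rw [hForm, hf.gForm_self_left hq, hf.fderiv_self hq, sub_self]

end IsLocalFinsler

theorem hForm_add_left (f : Base m × Base m → ℝ) (q a a' b) :
    hForm f q (a + a') b = hForm f q a b + hForm f q a' b := by
  have : ((0, a + a') : Base m × Base m) = (0, a) + (0, a') := by simp
  rw [hForm, this, map_add, gForm_add_left, hForm, hForm]
  ring

theorem hForm_add_right (f : Base m × Base m → ℝ) (q a b b') :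
    hForm f q a (b + b') = hForm f q a b + hForm f q a b' := by
  have : ((0, b + b') : Base m × Base m) = (0, b) + (0, b') := by simp
  rw [hForm, this, map_add, gForm_add_right, hForm, hForm]
  ring

theorem hForm_smul_left (f : Base m × Base m → ℝ) (q) (c : ℝ) (a b) :
    hForm f q (c • a) b = c * hForm f q a b := by
  have : ((0, c • a) : Base m × Base m) = c • (0, a) := by simp
  rw [hForm, this, map_smul, gForm_smul_left, hForm, smul_eq_mul]
  ring

theorem hForm_smul_right (f : Base m × Base m → ℝ) (q) (c : ℝ) (a b) :
    hForm f q a (c • b) = c * hForm f q a b := by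
  have : ((0, c • b) : Base m × Base m) = c • (0, b) := by simp
  rw [hForm, this, map_smul, gForm_smul_right, hForm, smul_eq_mul]
  ring

theorem IsCoordChange.hForm_fibreLift {f f' : Base m × Base m → ℝ} {O O' : Set (Base m)}
    {φ : Base m → Base m} (h : IsCoordChange f f' O O' φ) {q : Base m × Base m} {c : ℝ}
    (hq : q ∈ slit O) (hc : 0 < c) (u w : Base m) :
    hForm f' (fibreLift φ c q) (fderiv ℝ φ q.1 u) (fderiv ℝ φ q.1 w) = hForm f q u w := by
  have key : ∀ u, fderiv ℝ f' (fibreLift φ c q) (0, fderiv ℝ φ q.1 u) = fderiv ℝ f q (0, u) := by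
    intro u
    have h1 := h.fderiv_fibreLift hq hc (0, u)
    rw [fibreLiftDeriv_apply] at h1
    simp only [map_zero, _root_.zero_apply, zero_add] at h1
    have h2 : ((0, c • fderiv ℝ φ q.1 u) : Base m × Base m) = c • (0, fderiv ℝ φ q.1 u) := by simp
    rw [h2, map_smul, smul_eq_mul] at h1
    exact mul_left_cancel₀ hc.ne' h1
  rw [hForm, hForm, key, key, h.gForm_fibreLift hq hc]

end CoordChange

/-! ### Natural coordinates on the projective sphere bundle -/

section Coordinates
variable {m : ℕ} {M : Type*} [TopologicalSpace M] [ChartedSpace (Base m) M]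
  [IsManifold (𝓡 (m + 1)) ∞ M]

/-- The part of `SM` over the chart domain of `M` at `p`. -/
def coordDomain (p : M) : Set (SphereBundle m M) := proj m M ⁻¹' (chartAt (Base m) p).source

/-- The slit natural coordinate domain `{(x, y) | y ≠ 0}` over the chart at `p`. -/
abbrev slitTarget (p : M) : Set (Base m × Base m) := slit (chartAt (Base m) p).target

theorem isOpen_coordDomain (p : M) : IsOpen (coordDomain (m := m) p) :=
  (chartAt (Base m) p).open_source.preimage (proj m M).continuous

theorem mem_coordDomain_self (z : SphereBundle m M) : z ∈ coordDomain (m := m) (proj m M z) :=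
  mem_chart_source _ _

theorem coordDomain_mem_nhds {p : M} {z : SphereBundle m M} (hz : z ∈ coordDomain p) :
    coordDomain p ∈ 𝓝 z := (isOpen_coordDomain p).mem_nhds hz

theorem isOpen_slitTarget (p : M) : IsOpen (slitTarget (m := m) p) :=
  isOpen_slit (chartAt (Base m) p).open_target

theorem natCoord_fst (p : M) (z : SphereBundle m M) :
    (natCoord p z).1 = chartAt (Base m) p (proj m M z) := by
  obtain ⟨v, rfl⟩ := ray_surj z
  rfl

theorem norm_natCoord_snd (p : M) (z : SphereBundle m M) : ‖(natCoord p z).2‖ = 1 := by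
  simp [natCoord]

theorem natCoord_mem {p : M} {z : SphereBundle m M} (hz : z ∈ coordDomain p) :
    natCoord p z ∈ slitTarget (m := m) p := by
  refine ⟨?_, fun h => ?_⟩
  · rw [natCoord_fst]
    exact (chartAt (Base m) p).map_source hz
  · have := norm_natCoord_snd p z
    rw [h, norm_zero] at this
    exact zero_ne_one this

/-- The class in `SM` of the tangent vector with natural coordinates `(x, y)`. -/
def rayOfCoord (p : M) (q : Base m × Base m) : SphereBundle m M := toRay ((tChart p).symm q)

theorem tChart_symm_snd_ne {p : M} {q : Base m × Base m} (hq : q ∈ slitTarget (m := m) p) :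
    ((tChart p).symm q).2 ≠ 0 := by
  have h : q ∈ (tChart (m := m) p).target := mem_tChart_target.2 hq.1
  rw [← tChart_snd_ne_zero ((tChart p).map_target h), (tChart p).right_inv h]
  exact hq.2

theorem rayOfCoord_eq {p : M} {q : Base m × Base m} (hq : q ∈ slitTarget (m := m) p) :
    rayOfCoord p q = ray ⟨(tChart p).symm q, tChart_symm_snd_ne hq⟩ := toRay_of_ne _

theorem localCoord_rayOfCoord {p : M} {q : Base m × Base m} (hq : q ∈ slitTarget (m := m) p) :
    localCoord p (rayOfCoord p q) = (q.1, unitDir q.2) := by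
  have h : q ∈ (tChart (m := m) p).target := mem_tChart_target.2 hq.1
  have h2 := tChart_apply ((tChart p).map_target h)
  rw [(tChart p).right_inv h] at h2
  rw [rayOfCoord_eq hq, localCoord_ray]
  exact Prod.ext (congrArg Prod.fst h2).symm (congrArg (fun r => unitDir r.2) h2).symm

theorem proj_rayOfCoord {p : M} {q : Base m × Base m} (hq : q ∈ slitTarget (m := m) p) :
    proj m M (rayOfCoord p q) = (chartAt (Base m) p).symm q.1 := by
  rw [rayOfCoord_eq hq, proj_ray]
  rfl

theorem rayOfCoord_mem {p : M} {q : Base m × Base m} (hq : q ∈ slitTarget (m := m) p) :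
    rayOfCoord p q ∈ coordDomain (m := m) p := by
  change proj m M _ ∈ (chartAt (Base m) p).source
  rw [proj_rayOfCoord hq]
  exact (chartAt (Base m) p).map_target hq.1

theorem natCoord_rayOfCoord {p : M} {q : Base m × Base m} (hq : q ∈ slitTarget (m := m) p) :
    natCoord p (rayOfCoord p q) = (q.1, ‖q.2‖⁻¹ • q.2) := by
  rw [natCoord, localCoord_rayOfCoord hq, coe_unitDir hq.2]

theorem rayOfCoord_natCoord {p : M} {z : SphereBundle m M} (hz : z ∈ coordDomain p) :
    rayOfCoord p (natCoord p z) = z := (trivChart p).left_inv hz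

theorem sphereChart_mem_maximalAtlas (p : M) (u : USphere m) :
    sphereChart p u ∈ IsManifold.maximalAtlas 𝓘(ℝ, SMModel m) ∞ (SphereBundle m M) :=
  IsManifold.subset_maximalAtlas ⟨p, u, rfl⟩

theorem mem_sphereChart_source {p : M} {u : USphere m} {z : SphereBundle m M} :
    z ∈ (sphereChart p u).source ↔ z ∈ coordDomain p ∧ (localCoord p z).2 ≠ u := by
  have : Fact (Module.finrank ℝ (Base m) = m + 1) := ⟨finrank_euclideanSpace_fin⟩
  simp only [sphereChart, OpenPartialHomeomorph.trans_source,
      OpenPartialHomeomorph.prod_source, OpenPartialHomeomorph.refl_source, Set.mem_inter_iff,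
      Set.mem_preimage, Set.mem_prod, Set.mem_univ, true_and, stereographic'_source]
  rfl

/-- In a stereographic chart of `SM` the natural coordinates are the inclusion of the sphere. -/
theorem contMDiffOn_natCoord (p : M) :
    ContMDiffOn 𝓘(ℝ, SMModel m) 𝓘(ℝ, Base m × Base m) ∞ (natCoord (m := m) p) (coordDomain p) := by
  have : Fact (Module.finrank ℝ (Base m) = m + 1) := ⟨finrank_euclideanSpace_fin⟩
  intro z hz
  apply ContMDiffAt.contMDiffWithinAt
  let u : USphere m := -(localCoord p z).2
  have hzs : z ∈ (sphereChart p u).source :=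
    mem_sphereChart_source.2 ⟨hz, ne_neg_of_mem_unit_sphere ℝ _⟩
  let U := (OrthonormalBasis.fromOrthogonalSpanSingleton (𝕜 := ℝ)
      m (ne_zero_of_mem_unit_sphere u)).repr
  have hst : ContDiff ℝ ∞ fun w : Fib m => ((stereographic' m u).symm w : Base m) :=
    ((contDiff_stereoInvFunAux (m := ∞) (v := u.val)).comp
      (ℝ ∙ (u : Base m))ᗮ.subtypeL.contDiff).comp U.symm.contDiff
  let A : Base m × Fib m → Base m × Base m := fun q => (q.1, ((stereographic' m u).symm q.2 : Base m))
  have hA : ContDiff ℝ ∞ A := contDiff_fst.prodMk (hst.comp contDiff_snd)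
  have h1 := (contMDiffOn_of_mem_maximalAtlas (sphereChart_mem_maximalAtlas (M := M) p u)).contMDiffAt
    ((sphereChart p u).open_source.mem_nhds hzs)
  have h2 := (hA.contMDiff (n := ∞)).contMDiffAt.comp z h1
  refine h2.congr_of_eventuallyEq ?_
  filter_upwards [(sphereChart p u).open_source.mem_nhds hzs] with w hw
  have hw' := (mem_sphereChart_source.1 hw).2
  have h3 : (localCoord p w).2 ∈ (stereographic' m u).source := by
    rw [stereographic'_source]
    exact hw'
  change _ = (((localCoord p w).1,
    ((stereographic' m u).symm (stereographic' m u (localCoord p w).2) : Base m)) : Base m × Base m)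
  rw [(stereographic' m u).left_inv h3]
  rfl

theorem contMDiffOn_rayOfCoord (p : M) :
    ContMDiffOn 𝓘(ℝ, Base m × Base m) 𝓘(ℝ, SMModel m) ∞ (rayOfCoord (m := m) p) (slitTarget p) := by
  have : Fact (Module.finrank ℝ (Base m) = m + 1) := ⟨finrank_euclideanSpace_fin⟩
  intro q hq
  apply ContMDiffAt.contMDiffWithinAt
  let u : USphere m := -(unitDir q.2)
  let U := (OrthonormalBasis.fromOrthogonalSpanSingleton (𝕜 := ℝ)
      m (ne_zero_of_mem_unit_sphere u)).repr
  let N : Base m × Base m → Base m := fun r => ‖r.2‖⁻¹ • r.2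
  let B : Base m × Base m → Base m × Fib m := fun r => (r.1, U (stereoToFun (u : Base m) (N r)))
  have hne : unitDir q.2 ≠ u := ne_neg_of_mem_unit_sphere ℝ _
  have hN : ContDiffAt ℝ ∞ N q :=
    ((contDiffAt_snd.norm ℝ hq.2).inv (norm_ne_zero_iff.2 hq.2)).smul contDiffAt_snd
  have hopen : {r : Base m × Base m | r ∈ slitTarget p ∧ unitDir r.2 ≠ u} ∈ 𝓝 q := by
    refine Filter.inter_mem ((isOpen_slitTarget p).mem_nhds hq) ?_
    have : ContinuousAt (fun r : Base m × Base m => unitDir r.2) q :=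
      ContinuousAt.comp (f := fun r : Base m × Base m => r.2) (g := unitDir)
        (continuousOn_unitDir.continuousAt (isOpen_compl_singleton.mem_nhds hq.2))
        continuousAt_snd
    exact this.eventually_ne hne
  have hstereo : ContDiffAt ℝ ∞ (stereoToFun (u : Base m)) (N q) := by
    refine (contDiffOn_stereoToFun (n := ∞)).contDiffAt ?_
    refine IsOpen.mem_nhds ?_ ?_
    · exact isOpen_ne_fun (innerSL ℝ (u : Base m)).continuous continuous_const
    · rw [ne_comm, Ne, sphere_ext_iff, coe_unitDir hq.2] at hne
      exact hne
  have hB : ContDiffAt ℝ ∞ B q :=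
    contDiffAt_fst.prodMk (U.contDiff.contDiffAt.comp q (hstereo.comp q hN))
  have hBeq : ∀ r : Base m × Base m, r ∈ slitTarget p → unitDir r.2 ≠ u →
      sphereChart p u (rayOfCoord p r) = B r := by
    intro r hr hru
    change (((localCoord p (rayOfCoord p r)).1,
      stereographic' m u (localCoord p (rayOfCoord p r)).2) : Base m × Fib m) = _
    rw [localCoord_rayOfCoord hr]
    refine Prod.ext rfl ?_
    change U (stereoToFun (u : Base m) (unitDir r.2 : Base m)) = _
    rw [coe_unitDir hr.2]
  have hsrc : ∀ r : Base m × Base m, r ∈ slitTarget p → unitDir r.2 ≠ u →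
      rayOfCoord p r ∈ (sphereChart p u).source := by
    intro r hr hru
    refine mem_sphereChart_source.2 ⟨rayOfCoord_mem hr, ?_⟩
    rwa [localCoord_rayOfCoord hr]
  have htgt : B q ∈ (sphereChart (m := m) p u).target := by
    rw [← hBeq q hq hne]
    exact (sphereChart p u).map_source (hsrc q hq hne)
  have h1 := (contMDiffOn_symm_of_mem_maximalAtlas
    (sphereChart_mem_maximalAtlas (M := M) p u)).contMDiffAt
    ((sphereChart p u).open_target.mem_nhds htgt)
  have h2 := h1.comp q hB.contMDiffAt
  refine h2.congr_of_eventuallyEq ?_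
  filter_upwards [hopen] with r hr
  rw [Function.comp_apply, ← hBeq r hr.1 hr.2, (sphereChart p u).left_inv (hsrc r hr.1 hr.2)]

theorem contMDiff_proj : ContMDiff 𝓘(ℝ, SMModel m) (𝓡 (m + 1)) ∞ (proj m M) := by
  intro z
  have h1 := (contMDiffOn_natCoord (proj m M z)).contMDiffAt
    (coordDomain_mem_nhds (mem_coordDomain_self z))
  have h2 : ContMDiffAt 𝓘(ℝ, Base m × Base m) 𝓘(ℝ, Base m) ∞
      (Prod.fst : Base m × Base m → Base m) (natCoord (proj m M z) z) :=
    contDiff_fst.contMDiff.contMDiffAt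
  have h3 : ContMDiffAt 𝓘(ℝ, Base m) (𝓡 (m + 1)) ∞ (chartAt (Base m) (proj m M z)).symm
      (natCoord (proj m M z) z).1 :=
    contMDiffOn_chart_symm.contMDiffAt ((chartAt (Base m) _).open_target.mem_nhds
      (natCoord_mem (mem_coordDomain_self z)).1)
  refine (h3.comp z (h2.comp z h1)).congr_of_eventuallyEq ?_
  filter_upwards [coordDomain_mem_nhds (mem_coordDomain_self z)] with w hw
  simp only [Function.comp_apply]
  rw [natCoord_fst, (chartAt (Base m) (proj m M z)).left_inv hw]

/-! ### Tangent vectors of `SM` in natural coordinates -/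

/-- The derivative of the natural coordinates at `z`; it embeds `T_z(SM)`. -/
def dCoord (p : M) (z : SphereBundle m M) : TSM z →L[ℝ] Base m × Base m :=
  mvfderiv 𝓘(ℝ, SMModel m) (natCoord p) z

theorem dx_apply (p : M) (z : SphereBundle m M) (i : Fin (m + 1)) (X : TSM z) :
    dx p z i X = (dCoord p z X).1 i := rfl

theorem dy_apply (p : M) (z : SphereBundle m M) (i : Fin (m + 1)) (X : TSM z) :
    dy p z i X = (dCoord p z X).2 i := rfl

/-- The tangent vector of `SM` at `z` represented by the derivative `ξ` of a curve in the slit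
natural coordinates `(x, y)`, at the representative of `z` with `‖y‖ = 1`. -/
def ofCoord (p : M) (z : SphereBundle m M) : Base m × Base m →L[ℝ] TSM z :=
  mfderiv 𝓘(ℝ, Base m × Base m) 𝓘(ℝ, SMModel m) (rayOfCoord p) (natCoord p z)

theorem hasMFDerivAt_natCoord {p : M} {z : SphereBundle m M} (hz : z ∈ coordDomain p) :
    HasMFDerivAt 𝓘(ℝ, SMModel m) 𝓘(ℝ, Base m × Base m) (natCoord p) z (dCoord p z) :=
  (((contMDiffOn_natCoord p).contMDiffAt (coordDomain_mem_nhds hz)).mdifferentiableAt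
    (by simp)).hasMFDerivAt

theorem hasMFDerivAt_rayOfCoord {p : M} {z : SphereBundle m M} (hz : z ∈ coordDomain p) :
    HasMFDerivAt 𝓘(ℝ, Base m × Base m) 𝓘(ℝ, SMModel m) (rayOfCoord p) (natCoord p z)
      (ofCoord p z) :=
  (((contMDiffOn_rayOfCoord p).contMDiffAt
    ((isOpen_slitTarget p).mem_nhds (natCoord_mem hz))).mdifferentiableAt
    (by simp)).hasMFDerivAt

theorem ofCoord_dCoord {p : M} {z : SphereBundle m M} (hz : z ∈ coordDomain p) (X : TSM z) :
    ofCoord p z (dCoord p z X) = X := by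
  have h1 := (hasMFDerivAt_rayOfCoord hz).comp z (hasMFDerivAt_natCoord hz)
  have h2 : (rayOfCoord (m := m) p ∘ natCoord p) =ᶠ[𝓝 z] id := by
    filter_upwards [coordDomain_mem_nhds hz] with w hw using rayOfCoord_natCoord hw
  have h3 := hasMFDerivAt_unique h1 ((hasMFDerivAt_id z).congr_of_eventuallyEq h2)
  exact congrArg (fun T : SMModel m →L[ℝ] SMModel m => T X) h3

/-- The coordinates of `ofCoord p z ξ` are `ξ` up to a multiple of `(0, y)`, which restores the
normalization `‖y‖ = 1`. -/
theorem dCoord_ofCoord {p : M} {z : SphereBundle m M} (hz : z ∈ coordDomain p)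
    (ξ : Base m × Base m) :
    ∃ c : ℝ, dCoord p z (ofCoord p z ξ) = (ξ.1, ξ.2 + c • (natCoord p z).2) := by
  have h0 : HasMFDerivAt 𝓘(ℝ, SMModel m) 𝓘(ℝ, Base m × Base m) (natCoord p)
      (rayOfCoord p (natCoord p z)) (dCoord p z) := by
    rw [rayOfCoord_natCoord hz]
    exact hasMFDerivAt_natCoord hz
  let T₀ : Base m × Base m →L[ℝ] Base m × Base m := (dCoord p z).comp (ofCoord p z)
  have h1 : HasFDerivAt (natCoord p ∘ rayOfCoord (m := m) p) T₀ (natCoord p z) :=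
    (h0.comp _ (hasMFDerivAt_rayOfCoord hz)).hasFDerivAt
  have hne : (natCoord p z).2 ≠ 0 := (natCoord_mem hz).2
  obtain ⟨T, hκ⟩ : ∃ T, HasFDerivAt (fun r : Base m × Base m => ‖r.2‖⁻¹) T (natCoord p z) :=
    ⟨_, (((contDiffAt_snd.norm ℝ hne).inv (norm_ne_zero_iff.2 hne)).differentiableAt
      (n := ∞) (by simp)).hasFDerivAt⟩
  have h2 := (hasFDerivAt_fst (p := natCoord p z)).prodMk (hκ.smul (hasFDerivAt_snd (p := natCoord p z)))
  have h3 : (natCoord p ∘ rayOfCoord (m := m) p) =ᶠ[𝓝 (natCoord p z)]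
      fun r => (r.1, ‖r.2‖⁻¹ • r.2) := by
    filter_upwards [(isOpen_slitTarget p).mem_nhds (natCoord_mem hz)] with r hr
      using natCoord_rayOfCoord hr
  have h4 := congrArg (fun T : Base m × Base m →L[ℝ] Base m × Base m => T ξ)
    (h1.unique (h2.congr_of_eventuallyEq h3))
  refine ⟨T ξ, h4.trans ?_⟩
  simp [norm_natCoord_snd]

/-- The normalization `‖y‖ = 1` makes `dy` orthogonal to `y` for the Euclidean inner product. -/
theorem inner_dCoord {p : M} {z : SphereBundle m M} (hz : z ∈ coordDomain p) (X : TSM z) :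
    inner ℝ (natCoord p z).2 (dCoord p z X).2 = 0 := by
  have h1 := (hasMFDerivAt_natCoord hz)
  have h2 : HasFDerivAt (fun r : Base m × Base m => ‖r.2‖ ^ 2)
      (2 • (innerSL ℝ (natCoord p z).2).comp (ContinuousLinearMap.snd ℝ _ _)) (natCoord p z) :=
    (hasFDerivAt_snd (p := natCoord p z)).norm_sq
  have h3 := h2.hasMFDerivAt.comp z h1
  have h4 : ((fun r : Base m × Base m => ‖r.2‖ ^ 2) ∘ natCoord (M := M) p) = fun _ => 1 := by
    ext w; simp [norm_natCoord_snd]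
  rw [h4] at h3
  have h5 := hasMFDerivAt_unique h3 (hasMFDerivAt_const (1 : ℝ) z)
  have h6 := congrArg (fun T : SMModel m →L[ℝ] ℝ => T X) h5
  have h7 : 2 • inner ℝ (natCoord p z).2 (dCoord p z X).2 = (0 : ℝ) := h6
  simpa using h7

theorem dCoord_injective {p : M} {z : SphereBundle m M} (hz : z ∈ coordDomain p) :
    Function.Injective (dCoord p z) := fun X Y h => by
  rw [← ofCoord_dCoord hz X, h, ofCoord_dCoord hz]

theorem fiberCoord_eq_mfderiv {p x : M} (hx : x ∈ (chartAt (Base m) p).source) :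
    fiberCoord (m := m) p x = mfderiv (𝓡 (m + 1)) 𝓘(ℝ, Base m) (chartAt (Base m) p) x := by
  have : IsManifold (𝓡 (m + 1)) 1 M := IsManifold.of_le (n := ∞) (by simp)
  exact TangentBundle.continuousLinearMapAt_trivializationAt hx

theorem fiberCoord_bijective {p x : M} (hx : x ∈ (chartAt (Base m) p).source) :
    Function.Bijective (fiberCoord (m := m) p x) := by
  have h : ⇑(fiberCoord (m := m) p x) =
      (trivializationAt (Base m) (TangentSpace (𝓡 (m + 1))) p).continuousLinearEquivAt ℝ x
        (by simpa using hx) := by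
    ext1 a
    rw [fiberCoord, Bundle.Trivialization.continuousLinearMapAt_apply_of_mem]
    · rfl
    · simpa using hx
  rw [h]
  exact ContinuousLinearEquiv.bijective _

theorem mdifferentiableAt_chartAt {p x : M} (hx : x ∈ (chartAt (Base m) p).source) :
    MDifferentiableAt (𝓡 (m + 1)) 𝓘(ℝ, Base m) (chartAt (Base m) p) x :=
  (contMDiffOn_chart (I := 𝓡 (m + 1)) (n := ∞)).contMDiffAt
    ((chartAt (Base m) p).open_source.mem_nhds hx) |>.mdifferentiableAt (by simp)

theorem hasMFDerivAt_chartAt {p x : M} (hx : x ∈ (chartAt (Base m) p).source) :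
    HasMFDerivAt (𝓡 (m + 1)) 𝓘(ℝ, Base m) (chartAt (Base m) p) x (fiberCoord (m := m) p x) := by
  rw [fiberCoord_eq_mfderiv hx]
  exact (mdifferentiableAt_chartAt hx).hasMFDerivAt

/-- The first component of `dCoord` is the coordinate expression of `dπ`. -/
theorem dCoord_fst {p : M} {z : SphereBundle m M} (hz : z ∈ coordDomain p) (X : TSM z) :
    (dCoord p z X).1 = fiberCoord p (proj m M z) (dproj z X) := by
  have h1 := (hasMFDerivAt_chartAt hz).comp z
    ((contMDiff_proj (m := m) (M := M) z).mdifferentiableAt (by simp)).hasMFDerivAt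
  have h2 := (hasFDerivAt_fst (𝕜 := ℝ) (p := natCoord p z)).hasMFDerivAt.comp z (hasMFDerivAt_natCoord hz)
  have h3 : (Prod.fst ∘ natCoord (M := M) p) = chartAt (Base m) p ∘ proj m M := by
    ext1 w; exact natCoord_fst p w
  rw [h3] at h2
  exact congrArg (fun T : SMModel m →L[ℝ] Base m => T X) (hasMFDerivAt_unique h2 h1)

theorem dproj_eq_zero_iff {p : M} {z : SphereBundle m M} (hz : z ∈ coordDomain p) (X : TSM z) :
    dproj z X = 0 ↔ (dCoord p z X).1 = 0 := by
  rw [dCoord_fst hz]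
  constructor
  · intro h; rw [h, map_zero]
  · intro h; exact (fiberCoord_bijective hz).1 (h.trans (map_zero _).symm)

theorem mem_vert_iff {p : M} {z : SphereBundle m M} (hz : z ∈ coordDomain p) (X : TSM z) :
    X ∈ vert z ↔ (dCoord p z X).1 = 0 := by
  rw [← dproj_eq_zero_iff hz]
  rfl

end Coordinates

/-! ### Derivatives along vector fields and the Lie bracket -/

section Bracket
variable {E : Type*} [NormedAddCommGroup E] [NormedSpace ℝ E]
  {N : Type*} [TopologicalSpace N] [ChartedSpace E N] [IsManifold 𝓘(ℝ, E) ∞ N]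
  {G : Type*} [NormedAddCommGroup G] [NormedSpace ℝ G]

theorem contMDiffAt_tangentMap {E' N' : Type*} [NormedAddCommGroup E'] [NormedSpace ℝ E']
    [TopologicalSpace N'] [ChartedSpace E' N'] [IsManifold 𝓘(ℝ, E') ∞ N'] {f : N → N'} {s : Set N}
    (hs : IsOpen s) (hf : ContMDiffOn 𝓘(ℝ, E) 𝓘(ℝ, E') ∞ f s) {v : TangentBundle 𝓘(ℝ, E) N}
    (hv : v.proj ∈ s) :
    ContMDiffAt 𝓘(ℝ, E).tangent 𝓘(ℝ, E').tangent ∞ (tangentMap 𝓘(ℝ, E) 𝓘(ℝ, E') f) v := by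
  have i1 : IsManifold 𝓘(ℝ, E) 1 N := IsManifold.of_le (n := ∞) (by simp)
  have i2 : IsManifold 𝓘(ℝ, E') 1 N' := IsManifold.of_le (n := ∞) (by simp)
  have h := hf.contMDiffOn_tangentMapWithin (m := ∞) (by simp) hs.uniqueMDiffOn
  have ho : IsOpen (TotalSpace.proj ⁻¹' s : Set (TangentBundle 𝓘(ℝ, E) N)) :=
    hs.preimage (FiberBundle.continuous_proj E (TangentSpace 𝓘(ℝ, E)))
  refine (h.contMDiffAt (ho.mem_nhds hv)).congr_of_eventuallyEq ?_
  filter_upwards [ho.mem_nhds hv] with w hw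
  exact (tangentMapWithin_eq_tangentMap (hs.uniqueMDiffOn _ hw)
    ((hf.contMDiffAt (hs.mem_nhds hw)).mdifferentiableAt (by simp))).symm

theorem contMDiffAt_mvfderiv_apply {f : N → G} {s : Set N} (hs : IsOpen s)
    (hf : ContMDiffOn 𝓘(ℝ, E) 𝓘(ℝ, G) ∞ f s) {X : (w : N) → TangentSpace 𝓘(ℝ, E) w} {z : N}
    (hz : z ∈ s) (hX : ContMDiffAt 𝓘(ℝ, E) 𝓘(ℝ, E).tangent ∞
      (fun w => (⟨w, X w⟩ : TangentBundle 𝓘(ℝ, E) N)) z) :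
    ContMDiffAt 𝓘(ℝ, E) 𝓘(ℝ, G) ∞ (fun w => mvfderiv 𝓘(ℝ, E) f w (X w)) z :=
  ((contMDiff_snd_tangentBundle_modelSpace G 𝓘(ℝ, G)).contMDiffAt).comp z
    ((contMDiffAt_tangentMap hs hf hz).comp z hX)

theorem mdifferentiableAt_mvfderiv_apply {f : N → G} {s : Set N} (hs : IsOpen s)
    (hf : ContMDiffOn 𝓘(ℝ, E) 𝓘(ℝ, G) ∞ f s) {X : (w : N) → TangentSpace 𝓘(ℝ, E) w} {z : N}
    (hz : z ∈ s) (hX : MDifferentiableAt 𝓘(ℝ, E) 𝓘(ℝ, E).tangent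
      (fun w => (⟨w, X w⟩ : TangentBundle 𝓘(ℝ, E) N)) z) :
    MDifferentiableAt 𝓘(ℝ, E) 𝓘(ℝ, G) (fun w => mvfderiv 𝓘(ℝ, E) f w (X w)) z :=
  (((contMDiff_snd_tangentBundle_modelSpace (n := ∞) G 𝓘(ℝ, G)).contMDiffAt).mdifferentiableAt
    (by simp)).comp z (((contMDiffAt_tangentMap hs hf hz).mdifferentiableAt (by simp)).comp z hX)

theorem fderiv_comp_apply {k : N → G} {σ : E → N} {e : E}
    (hk : MDifferentiableAt 𝓘(ℝ, E) 𝓘(ℝ, G) k (σ e))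
    (hσ : MDifferentiableAt 𝓘(ℝ, E) 𝓘(ℝ, E) σ e) (v : E) :
    fderiv ℝ (k ∘ σ) e v = mvfderiv 𝓘(ℝ, E) k (σ e) (mfderiv 𝓘(ℝ, E) 𝓘(ℝ, E) σ e v) := by
  have h := mfderiv_comp e hk hσ
  rw [mfderiv_eq_fderiv] at h
  exact congrArg (fun T : E →L[ℝ] G => T v) h

/-- The Lie bracket is the commutator of derivations: `[X, Y] f = X (Y f) - Y (X f)`. -/
theorem mvfderiv_mlieBracket [CompleteSpace E] {f : N → G} {s : Set N} (hs : IsOpen s)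
    (hf : ContMDiffOn 𝓘(ℝ, E) 𝓘(ℝ, G) ∞ f s) {X Y : (w : N) → TangentSpace 𝓘(ℝ, E) w} {z : N}
    (hz : z ∈ s)
    (hX : MDifferentiableAt 𝓘(ℝ, E) 𝓘(ℝ, E).tangent
      (fun w => (⟨w, X w⟩ : TangentBundle 𝓘(ℝ, E) N)) z)
    (hY : MDifferentiableAt 𝓘(ℝ, E) 𝓘(ℝ, E).tangent
      (fun w => (⟨w, Y w⟩ : TangentBundle 𝓘(ℝ, E) N)) z) :
    mvfderiv 𝓘(ℝ, E) f z (VectorField.mlieBracket 𝓘(ℝ, E) X Y z) =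
      mvfderiv 𝓘(ℝ, E) (fun w => mvfderiv 𝓘(ℝ, E) f w (Y w)) z (X z) -
        mvfderiv 𝓘(ℝ, E) (fun w => mvfderiv 𝓘(ℝ, E) f w (X w)) z (Y z) := by
  have i1 : IsManifold 𝓘(ℝ, E) 1 N := IsManifold.of_le (n := ∞) (by simp)
  have i2 : IsManifold 𝓘(ℝ, E) 2 N := IsManifold.of_le (n := ∞) two_le_infty
  set φ := extChartAt 𝓘(ℝ, E) z with hφ
  let pull : ((w : N) → TangentSpace 𝓘(ℝ, E) w) → E → E := fun V =>
    VectorField.mpullbackWithin 𝓘(ℝ, E) 𝓘(ℝ, E) φ.symm V (Set.range 𝓘(ℝ, E))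
  have htgt : φ.target ∈ 𝓝 (φ z) := extChartAt_target_mem_nhds z
  have hsymm : ∀ e ∈ φ.target, MDifferentiableAt 𝓘(ℝ, E) 𝓘(ℝ, E) φ.symm e := fun e he =>
    (contMDiffOn_extChartAt_symm (n := ∞) z).contMDiffAt
      ((isOpen_extChartAt_target z).mem_nhds he) |>.mdifferentiableAt (by simp)
  have hinv : ∀ e ∈ φ.target, (mfderiv 𝓘(ℝ, E) 𝓘(ℝ, E) φ.symm e).IsInvertible := by
    intro e he
    have := isInvertible_mfderivWithin_extChartAt_symm (I := 𝓘(ℝ, E)) (x := z) he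
    rwa [modelWithCornersSelf_coe, Set.range_id, mfderivWithin_univ] at this
  have hpull : ∀ (V : (w : N) → TangentSpace 𝓘(ℝ, E) w) (e : E), e ∈ φ.target →
      mfderiv 𝓘(ℝ, E) 𝓘(ℝ, E) φ.symm e (pull V e) = V (φ.symm e) := by
    intro V e he
    simp only [pull, VectorField.mpullbackWithin_apply, modelWithCornersSelf_coe, Set.range_id,
      mfderivWithin_univ]
    obtain ⟨T, hT⟩ := hinv e he
    rw [← hT, ContinuousLinearMap.inverse_equiv]
    exact T.apply_symm_apply _
  -- A derivative along a field, read in the chart.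
  have key : ∀ {k : N → G} (V : (w : N) → TangentSpace 𝓘(ℝ, E) w) (e : E), e ∈ φ.target →
      MDifferentiableAt 𝓘(ℝ, E) 𝓘(ℝ, G) k (φ.symm e) →
      fderiv ℝ (k ∘ φ.symm) e (pull V e) = mvfderiv 𝓘(ℝ, E) k (φ.symm e) (V (φ.symm e)) := by
    intro k V e he hk
    rw [fderiv_comp_apply hk (hsymm e he), hpull V e he]
  have hzz : φ.symm (φ z) = z := extChartAt_to_inv z
  have hzt : φ z ∈ φ.target := mem_extChartAt_target z
  have hsn : ∀ᶠ e in 𝓝 (φ z), e ∈ φ.target ∧ φ.symm e ∈ s := by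
    refine Filter.inter_mem htgt ?_
    have : ContinuousAt φ.symm (φ z) := continuousAt_extChartAt_symm z
    exact this.preimage_mem_nhds (by rw [hzz]; exact hs.mem_nhds hz)
  have hfd : ∀ w ∈ s, MDifferentiableAt 𝓘(ℝ, E) 𝓘(ℝ, G) f w := fun w hw =>
    (hf.contMDiffAt (hs.mem_nhds hw)).mdifferentiableAt (by simp)
  have hset : φ.symm ⁻¹' Set.univ ∩ Set.range 𝓘(ℝ, E) = Set.univ := by simp
  have hdiff : ∀ V : (w : N) → TangentSpace 𝓘(ℝ, E) w,
      MDifferentiableAt 𝓘(ℝ, E) 𝓘(ℝ, E).tangent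
        (fun w => (⟨w, V w⟩ : TangentBundle 𝓘(ℝ, E) N)) z → DifferentiableAt ℝ (pull V) (φ z) := by
    intro V hV
    have : DifferentiableWithinAt ℝ (pull V) (φ.symm ⁻¹' Set.univ ∩ Set.range 𝓘(ℝ, E)) (φ z) :=
      (hV.mdifferentiableWithinAt
        (s := Set.univ)).differentiableWithinAt_mpullbackWithin_vectorField
    rwa [hset, differentiableWithinAt_univ] at this
  set f' := f ∘ φ.symm with hf'
  have hf2 : ContDiffAt ℝ 2 f' (φ z) := by
    have h1 : ContMDiffAt 𝓘(ℝ, E) 𝓘(ℝ, G) ∞ f (φ.symm (φ z)) := by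
      rw [hzz]; exact hf.contMDiffAt (hs.mem_nhds hz)
    have h2 := h1.comp (φ z) ((contMDiffOn_extChartAt_symm (n := ∞) z).contMDiffAt htgt)
    exact h2.contDiffAt.of_le two_le_infty
  have hDf : DifferentiableAt ℝ (fderiv ℝ f') (φ z) :=
    (hf2.fderiv_right (m := 1) le_rfl).differentiableAt one_ne_zero
  -- Second derivatives along fields, read in the chart.
  have second : ∀ V W : (w : N) → TangentSpace 𝓘(ℝ, E) w,
      MDifferentiableAt 𝓘(ℝ, E) 𝓘(ℝ, E).tangent
        (fun w => (⟨w, W w⟩ : TangentBundle 𝓘(ℝ, E) N)) z →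
      mvfderiv 𝓘(ℝ, E) (fun w => mvfderiv 𝓘(ℝ, E) f w (W w)) z (V z) =
        fderiv ℝ (fderiv ℝ f') (φ z) (pull V (φ z)) (pull W (φ z)) +
          fderiv ℝ f' (φ z) (fderiv ℝ (pull W) (φ z) (pull V (φ z))) := by
    intro V W hW
    have hg := mdifferentiableAt_mvfderiv_apply hs hf hz hW
    have h1 := key (k := fun w => mvfderiv 𝓘(ℝ, E) f w (W w)) V (φ z) hzt (by rwa [hzz])
    have h2 : ((fun w => mvfderiv 𝓘(ℝ, E) f w (W w)) ∘ φ.symm) =ᶠ[𝓝 (φ z)]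
        fun e => fderiv ℝ f' e (pull W e) := by
      filter_upwards [hsn] with e he
      exact (key W e he.1 (hfd _ he.2)).symm
    rw [h2.fderiv_eq, fderiv_clm_apply hDf (hdiff W hW)] at h1
    rw [hzz] at h1
    rw [← h1]
    simp [add_comm]
  have hbr : mvfderiv 𝓘(ℝ, E) f z (VectorField.mlieBracket 𝓘(ℝ, E) X Y z) =
      fderiv ℝ f' (φ z) (VectorField.lieBracket ℝ (pull X) (pull Y) (φ z)) := by
    have hφinv : (mfderiv 𝓘(ℝ, E) 𝓘(ℝ, E) φ z).IsInvertible :=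
      isInvertible_mfderiv_extChartAt (mem_extChartAt_source z)
    have hpz : mfderiv 𝓘(ℝ, E) 𝓘(ℝ, E) φ z (VectorField.mlieBracket 𝓘(ℝ, E) X Y z) =
        VectorField.lieBracket ℝ (pull X) (pull Y) (φ z) := by
      rw [← VectorField.mlieBracketWithin_univ, VectorField.mlieBracketWithin_apply]
      obtain ⟨T, hT⟩ := hφinv
      rw [← hT, ContinuousLinearMap.inverse_equiv]
      refine (T.apply_symm_apply _).trans ?_
      change VectorField.lieBracketWithin ℝ (pull X) (pull Y)
        (φ.symm ⁻¹' Set.univ ∩ Set.range 𝓘(ℝ, E)) (φ z) = _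
      rw [hset, VectorField.lieBracketWithin_univ]
    have hff : f =ᶠ[𝓝 z] f' ∘ φ := by
      filter_upwards [extChartAt_source_mem_nhds (I := 𝓘(ℝ, E)) z] with w hw
      rw [hf', Function.comp_apply, Function.comp_apply, φ.left_inv hw]
    have h1 : HasMFDerivAt 𝓘(ℝ, E) 𝓘(ℝ, G) f' (φ z) (fderiv ℝ f' (φ z)) :=
      (hf2.differentiableAt (by simp)).hasFDerivAt.hasMFDerivAt
    have h2 : HasMFDerivAt 𝓘(ℝ, E) 𝓘(ℝ, E) φ z (mfderiv 𝓘(ℝ, E) 𝓘(ℝ, E) φ z) :=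
      (mdifferentiableAt_extChartAt (mem_chart_source E z)).hasMFDerivAt
    have h3 := ((h1.comp z h2).congr_of_eventuallyEq hff).mfderiv
    rw [← hpz]
    exact congrArg (fun T : E →L[ℝ] G => T (VectorField.mlieBracket 𝓘(ℝ, E) X Y z)) h3
  rw [hbr, second X Y hY, second Y X hX, second_symm hf2 (pull X (φ z)), VectorField.lieBracket,
    map_sub]
  abel

end Bracket

/-! ### Vector fields on `SM` in natural coordinates -/

section Fields
variable {m : ℕ} {M : Type*} [TopologicalSpace M] [ChartedSpace (Base m) M]
  [IsManifold (𝓡 (m + 1)) ∞ M]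

theorem SmoothAt.diffAt {X : VField m M} {z : SphereBundle m M} (h : SmoothAt X z) : DiffAt X z :=
  ContMDiffAt.mdifferentiableAt h (by simp)

theorem totalSpace_mk_congr {z z' : SphereBundle m M} (h : z' = z) (v : SMModel m) :
    (⟨z', v⟩ : TSMBundle m M) = ⟨z, v⟩ := by subst h; rfl

theorem eventually_ofCoord_eq {p : M} {z : SphereBundle m M} (hz : z ∈ coordDomain p)
    (k : SphereBundle m M → Base m × Base m) :
    (fun w => (⟨w, ofCoord p w (k w)⟩ : TSMBundle m M)) =ᶠ[𝓝 z] fun w =>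
      tangentMap 𝓘(ℝ, Base m × Base m) 𝓘(ℝ, SMModel m) (rayOfCoord p)
        ⟨natCoord p w, k w⟩ := by
  filter_upwards [coordDomain_mem_nhds hz] with w hw
  exact (totalSpace_mk_congr (rayOfCoord_natCoord hw) _).symm

theorem contMDiffAt_tangent_modelSpace {p : M} {z : SphereBundle m M} (hz : z ∈ coordDomain p)
    {k : SphereBundle m M → Base m × Base m}
    (hk : ContMDiffAt 𝓘(ℝ, SMModel m) 𝓘(ℝ, Base m × Base m) ∞ k z) :
    ContMDiffAt 𝓘(ℝ, SMModel m) 𝓘(ℝ, Base m × Base m).tangent ∞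
      (fun w => (⟨natCoord p w, k w⟩ : TangentBundle 𝓘(ℝ, Base m × Base m) (Base m × Base m))) z := by
  rw [contMDiffAt_totalSpace]
  refine ⟨(contMDiffOn_natCoord p).contMDiffAt (coordDomain_mem_nhds hz), ?_⟩
  simpa only [trivializationAt_model_space_apply] using hk

theorem mdifferentiableAt_tangent_modelSpace {p : M} {z : SphereBundle m M}
    (hz : z ∈ coordDomain p) {k : SphereBundle m M → Base m × Base m}
    (hk : MDifferentiableAt 𝓘(ℝ, SMModel m) 𝓘(ℝ, Base m × Base m) k z) :
    MDifferentiableAt 𝓘(ℝ, SMModel m) 𝓘(ℝ, Base m × Base m).tangent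
      (fun w => (⟨natCoord p w, k w⟩ : TangentBundle 𝓘(ℝ, Base m × Base m) (Base m × Base m))) z := by
  rw [mdifferentiableAt_totalSpace]
  refine ⟨((contMDiffOn_natCoord p).contMDiffAt (coordDomain_mem_nhds hz)).mdifferentiableAt
    (by simp), ?_⟩
  simpa only [trivializationAt_model_space_apply] using hk

theorem smoothAt_ofCoord {p : M} {z : SphereBundle m M} (hz : z ∈ coordDomain p)
    {k : SphereBundle m M → Base m × Base m}
    (hk : ContMDiffAt 𝓘(ℝ, SMModel m) 𝓘(ℝ, Base m × Base m) ∞ k z) :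
    SmoothAt (fun w => ofCoord p w (k w)) z := by
  have h := contMDiffAt_tangentMap (isOpen_slitTarget (m := m) p) (contMDiffOn_rayOfCoord p)
    (v := ⟨natCoord p z, k z⟩) (natCoord_mem hz)
  refine ContMDiffAt.congr_of_eventuallyEq ?_ (eventually_ofCoord_eq hz k)
  exact ContMDiffAt.comp z h (contMDiffAt_tangent_modelSpace hz hk)

theorem diffAt_ofCoord {p : M} {z : SphereBundle m M} (hz : z ∈ coordDomain p)
    {k : SphereBundle m M → Base m × Base m}
    (hk : MDifferentiableAt 𝓘(ℝ, SMModel m) 𝓘(ℝ, Base m × Base m) k z) :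
    DiffAt (fun w => ofCoord p w (k w)) z := by
  have h := contMDiffAt_tangentMap (isOpen_slitTarget (m := m) p) (contMDiffOn_rayOfCoord p)
    (v := ⟨natCoord p z, k z⟩) (natCoord_mem hz)
  refine MDifferentiableAt.congr_of_eventuallyEq ?_ (eventually_ofCoord_eq hz k)
  exact MDifferentiableAt.comp z (h.mdifferentiableAt (by simp))
    (mdifferentiableAt_tangent_modelSpace hz hk)

/-- Smoothness of a field can be tested on its components in `Base m × Base m`, although these are not
independent, because `ofCoord` is a smooth left inverse of `dCoord`. -/
theorem smoothAt_iff {p : M} {z : SphereBundle m M} (hz : z ∈ coordDomain p) {X : VField m M} :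
    SmoothAt X z ↔
      ContMDiffAt 𝓘(ℝ, SMModel m) 𝓘(ℝ, Base m × Base m) ∞ (fun w => dCoord p w (X w)) z := by
  refine ⟨fun hX => contMDiffAt_mvfderiv_apply (isOpen_coordDomain p) (contMDiffOn_natCoord p) hz hX,
    fun h => (smoothAt_ofCoord hz h).congr_of_eventuallyEq ?_⟩
  filter_upwards [coordDomain_mem_nhds hz] with w hw
  rw [ofCoord_dCoord hw]

theorem diffAt_iff {p : M} {z : SphereBundle m M} (hz : z ∈ coordDomain p) {X : VField m M} :
    DiffAt X z ↔
      MDifferentiableAt 𝓘(ℝ, SMModel m) 𝓘(ℝ, Base m × Base m) (fun w => dCoord p w (X w)) z := by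
  refine ⟨fun hX => mdifferentiableAt_mvfderiv_apply (isOpen_coordDomain p) (contMDiffOn_natCoord p)
    hz hX, fun h => (diffAt_ofCoord hz h).congr_of_eventuallyEq ?_⟩
  filter_upwards [coordDomain_mem_nhds hz] with w hw
  rw [ofCoord_dCoord hw]

theorem SmoothAt.congr {X Y : VField m M} {z : SphereBundle m M} (h : SmoothAt X z)
    (he : ∀ᶠ w in 𝓝 z, Y w = X w) : SmoothAt Y z :=
  ContMDiffAt.congr_of_eventuallyEq h (he.mono fun w hw => congrArg (TotalSpace.mk w) hw)

theorem SmoothAt.sub {X Y : VField m M} {z : SphereBundle m M} (hX : SmoothAt X z)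
    (hY : SmoothAt Y z) : SmoothAt (fun w => X w - Y w) z := by
  have hz := mem_coordDomain_self z
  rw [smoothAt_iff hz] at *
  exact (hX.sub hY).congr_of_eventuallyEq (.of_forall fun w => map_sub _ _ _)

/-- Every tangent vector extends to a vector field which is smooth near the base point. -/
theorem exists_smooth_extension (z : SphereBundle m M) (v : TSM z) :
    ∃ X : VField m M, X z = v ∧ ∀ w ∈ coordDomain (proj m M z), SmoothAt X w := by
  refine ⟨fun w => ofCoord (proj m M z) w (dCoord (proj m M z) z v),
    ofCoord_dCoord (mem_coordDomain_self z) v, fun w hw => smoothAt_ofCoord hw contMDiffAt_const⟩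

/-- The coordinates of a Lie bracket. -/
theorem dCoord_lieBr {p : M} {z : SphereBundle m M} (hz : z ∈ coordDomain p) {X Y : VField m M}
    (hX : DiffAt X z) (hY : DiffAt Y z) :
    dCoord p z (lieBr X Y z) =
      mvfderiv 𝓘(ℝ, SMModel m) (fun w => dCoord p w (Y w)) z (X z) -
        mvfderiv 𝓘(ℝ, SMModel m) (fun w => dCoord p w (X w)) z (Y z) :=
  mvfderiv_mlieBracket (isOpen_coordDomain p) (contMDiffOn_natCoord p) hz hX hY

theorem SmoothAt.lieBr {X Y : VField m M} {z : SphereBundle m M} (hX : SmoothAt X z)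
    (hY : SmoothAt Y z) : SmoothAt (lieBr X Y) z :=
  have : IsManifold 𝓘(ℝ, SMModel m) (((⊤ : ℕ∞) : ℕ∞ω) + 1) (SphereBundle m M) :=
    IsManifold.of_le (n := ∞) le_rfl
  have : IsManifold 𝓘(ℝ, SMModel m) (minSmoothness ℝ 2) (SphereBundle m M) :=
    IsManifold.of_le (n := ∞) (by simpa using two_le_infty)
  have : IsManifold 𝓘(ℝ, SMModel m) (minSmoothness ℝ 3) (SphereBundle m M) :=
    IsManifold.of_le (n := ∞) (by simpa using WithTop.coe_le_coe.2 (le_top : (3 : ℕ∞) ≤ ⊤))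
  ContMDiffAt.mlieBracket_vectorField (m := ⊤) (n := ⊤) hX hY (by simp)

/-! ### Sections of `π^*TM` in natural coordinates -/

/-- The components of a section of `π^*TM` in the chart at `p`. -/
def pullCoord (p : M) (s : PullSection m M) (w : SphereBundle m M) : Base m :=
  fiberCoord p (proj m M w) (s w)

theorem eventually_pullCoord_eq {z : SphereBundle m M} (s : PullSection m M) :
    (fun w => (trivializationAt (Base m) (TangentSpace (𝓡 (m + 1))) (proj m M z)
      (⟨proj m M w, s w⟩ : TM m M)).2) =ᶠ[𝓝 z] pullCoord (proj m M z) s := by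
  filter_upwards [coordDomain_mem_nhds (mem_coordDomain_self z)] with w hw
  rw [pullCoord, fiberCoord, Bundle.Trivialization.continuousLinearMapAt_apply_of_mem]
  simpa using (show proj m M w ∈ (chartAt (Base m) (proj m M z)).source from hw)

theorem pullSmoothAt_iff {z : SphereBundle m M} {s : PullSection m M} :
    PullSmoothAt s z ↔
      ContMDiffAt 𝓘(ℝ, SMModel m) 𝓘(ℝ, Base m) ∞ (pullCoord (proj m M z) s) z := by
  rw [PullSmoothAt, contMDiffAt_totalSpace]
  refine (and_iff_right (contMDiff_proj z)).trans ?_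
  exact (eventually_pullCoord_eq s).contMDiffAt_iff

theorem pullDiffAt_iff {z : SphereBundle m M} {s : PullSection m M} :
    PullDiffAt s z ↔
      MDifferentiableAt 𝓘(ℝ, SMModel m) 𝓘(ℝ, Base m) (pullCoord (proj m M z) s) z := by
  rw [PullDiffAt, mdifferentiableAt_totalSpace]
  refine (and_iff_right ((contMDiff_proj z).mdifferentiableAt (by simp))).trans ?_
  exact (eventually_pullCoord_eq s).mdifferentiableAt_iff

theorem pullCoord_dproj {p : M} {w : SphereBundle m M} (hw : w ∈ coordDomain p) (X : VField m M) :
    pullCoord p (fun w => dproj w (X w)) w = (dCoord p w (X w)).1 := (dCoord_fst hw _).symm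

theorem eventually_pullCoord_dproj (z : SphereBundle m M) (X : VField m M) :
    pullCoord (proj m M z) (fun w => dproj w (X w)) =ᶠ[𝓝 z]
      fun w => (dCoord (proj m M z) w (X w)).1 := by
  filter_upwards [coordDomain_mem_nhds (mem_coordDomain_self z)] with w hw using pullCoord_dproj hw X

theorem SmoothAt.dproj {X : VField m M} {z : SphereBundle m M} (hX : SmoothAt X z) :
    PullSmoothAt (fun w => dproj w (X w)) z := by
  rw [pullSmoothAt_iff]
  refine ContMDiffAt.congr_of_eventuallyEq ?_ (eventually_pullCoord_dproj z X)
  exact (contDiff_fst.contMDiff.contMDiffAt (n := ∞)).comp z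
    ((smoothAt_iff (mem_coordDomain_self z)).1 hX)

theorem PullSmoothAt.pullDiffAt {s : PullSection m M} {z : SphereBundle m M}
    (h : PullSmoothAt s z) : PullDiffAt s z := ContMDiffAt.mdifferentiableAt h (by simp)

end Fields

/-! ### Changes of natural coordinates -/

section Change
variable {m : ℕ} {M : Type*} [TopologicalSpace M] [ChartedSpace (Base m) M]
  [IsManifold (𝓡 (m + 1)) ∞ M]

/-- The change of charts from the chart of `M` at `p` to the chart at `p'`. -/
def chartChange (p p' : M) (x : Base m) : Base m := chartAt (Base m) p' ((chartAt (Base m) p).symm x)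

/-- The domain of `chartChange p p'`. -/
def changeDomain (p p' : M) : Set (Base m) :=
  ((chartAt (Base m) p).symm.trans (chartAt (Base m) p')).source

theorem mem_changeDomain {p p' : M} {x : Base m} : x ∈ changeDomain p p' ↔
    x ∈ (chartAt (Base m) p).target ∧
      (chartAt (Base m) p).symm x ∈ (chartAt (Base m) p').source := by
  simp [changeDomain]

theorem isOpen_changeDomain (p p' : M) : IsOpen (changeDomain (m := m) p p') :=
  OpenPartialHomeomorph.open_source _

theorem contDiffOn_chartChange (p p' : M) :
    ContDiffOn ℝ ∞ (chartChange (m := m) p p') (changeDomain p p') := by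
  rw [← contMDiffOn_iff_contDiffOn]
  refine (contMDiffOn_chart (I := 𝓡 (m + 1)) (n := ∞) (x := p')).comp
    ((contMDiffOn_chart_symm (I := 𝓡 (m + 1)) (n := ∞) (x := p)).mono fun x hx =>
      (mem_changeDomain.1 hx).1) fun x hx => (mem_changeDomain.1 hx).2

theorem chartAt_mem_changeDomain {p p' x : M} (hx : x ∈ (chartAt (Base m) p).source)
    (hx' : x ∈ (chartAt (Base m) p').source) : chartAt (Base m) p x ∈ changeDomain p p' := by
  rw [mem_changeDomain, (chartAt (Base m) p).left_inv hx]
  exact ⟨(chartAt (Base m) p).map_source hx, hx'⟩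

theorem fiberCoord_change {p p' x : M} (hx : x ∈ (chartAt (Base m) p).source)
    (hx' : x ∈ (chartAt (Base m) p').source) (a : TangentSpace (𝓡 (m + 1)) x) :
    fiberCoord (m := m) p' x a =
      fderiv ℝ (chartChange p p') (chartAt (Base m) p x) (fiberCoord p x a) := by
  have h1 : HasMFDerivAt 𝓘(ℝ, Base m) 𝓘(ℝ, Base m) (chartChange (m := m) p p')
      (chartAt (Base m) p x) (fderiv ℝ (chartChange p p') (chartAt (Base m) p x)) :=
    (((contDiffOn_chartChange p p').contDiffAt ((isOpen_changeDomain p p').mem_nhds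
      (chartAt_mem_changeDomain hx hx'))).differentiableAt (by simp)).hasFDerivAt.hasMFDerivAt
  have h2 := h1.comp x (hasMFDerivAt_chartAt hx)
  have h3 : (chartAt (Base m) p' : M → Base m) =ᶠ[𝓝 x] chartChange p p' ∘ chartAt (Base m) p := by
    filter_upwards [(chartAt (Base m) p).open_source.mem_nhds hx] with w hw
    rw [Function.comp_apply, chartChange, (chartAt (Base m) p).left_inv hw]
  exact congrArg (fun T : Base m →L[ℝ] Base m => T a)
    (hasMFDerivAt_unique (hasMFDerivAt_chartAt hx') (h2.congr_of_eventuallyEq h3))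

theorem injective_fderiv_chartChange {p p' : M} {x : Base m} (hx : x ∈ changeDomain p p') :
    Function.Injective (fderiv ℝ (chartChange (m := m) p p') x) := by
  obtain ⟨h1, h2⟩ := mem_changeDomain.1 hx
  have h3 := (chartAt (Base m) p).map_target h1
  intro a b hab
  obtain ⟨a', rfl⟩ := (fiberCoord_bijective (m := m) h3).2 a
  obtain ⟨b', rfl⟩ := (fiberCoord_bijective (m := m) h3).2 b
  have e := fiberCoord_change (m := m) h3 h2
  rw [(chartAt (Base m) p).right_inv h1] at e
  rw [← e, ← e] at hab
  rw [(fiberCoord_bijective h2).1 hab]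

theorem tChart_symm_fibreLift {p p' : M} {q : Base m × Base m} (hq : q.1 ∈ changeDomain p p')
    (c : ℝ) : (tChart p').symm (fibreLift (chartChange p p') c q) =
      (⟨((tChart p).symm q).proj, c • ((tChart p).symm q).2⟩ : TM m M) := by
  obtain ⟨h1, h2⟩ := mem_changeDomain.1 hq
  have ht : q ∈ (tChart (m := m) p).target := mem_tChart_target.2 h1
  have e := tChart_apply ((tChart p).map_target ht)
  rw [(tChart p).right_inv ht] at e
  have hs : (⟨((tChart p).symm q).proj, c • ((tChart p).symm q).2⟩ : TM m M) ∈
      (tChart p').source := mem_tChart_source.2 h2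
  rw [← (tChart p').left_inv hs, tChart_apply hs]
  congr 1
  refine Prod.ext rfl ?_
  have h3 : ((tChart p).symm q).proj ∈ (chartAt (Base m) p).source := (chartAt (Base m) p).map_target h1
  have h4 : q.2 = fiberCoord p ((tChart p).symm q).proj ((tChart p).symm q).2 := congrArg Prod.snd e
  have h5 : q.1 = chartAt (Base m) p ((tChart p).symm q).proj := congrArg Prod.fst e
  rw [fibreLift, h5, h4, map_smul, fiberCoord_change h3 h2]

theorem rayOfCoord_fibreLift {p p' : M} {q : Base m × Base m} (hq : q ∈ slit (changeDomain p p'))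
    {c : ℝ} (hc : 0 < c) :
    rayOfCoord p' (fibreLift (chartChange p p') c q) = rayOfCoord (M := M) p q := by
  have h1 := tChart_symm_snd_ne (p := p) ⟨(mem_changeDomain.1 hq.1).1, hq.2⟩
  have h2 : (⟨((tChart p).symm q).proj, c • ((tChart p).symm q).2⟩ : TM m M).2 ≠ 0 :=
    smul_ne_zero hc.ne' h1
  rw [rayOfCoord, rayOfCoord, tChart_symm_fibreLift hq.1, toRay_of_ne h1, toRay_of_ne h2]
  exact (Quotient.sound ⟨c, hc, rfl⟩ : ray (m := m) (M := M) _ = ray _).symm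

end Change

namespace FinslerStructure
variable {m : ℕ} {M : Type*} [TopologicalSpace M] [ChartedSpace (Base m) M]
  [IsManifold (𝓡 (m + 1)) ∞ M] (F : FinslerStructure m M)

theorem isLocalFinsler (p : M) : IsLocalFinsler (F.loc p) (chartAt (Base m) p).target where
  isOpen := (chartAt (Base m) p).open_target
  smooth := by
    rw [← contMDiffOn_iff_contDiffOn]
    have h1 := contMDiffOn_extChartAt_symm (I := (𝓡 (m + 1)).tangent) (n := ∞) (⟨p, 0⟩ : TM m M)
    refine F.smooth.comp (h1.mono fun q hq => ?_) fun q hq => tChart_symm_snd_ne hq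
    rw [extChartAt_target]
    refine ⟨mem_tChart_target.2 hq.1, ?_⟩
    exact ⟨q, rfl⟩
  pos q hq := F.pos _ (tChart_symm_snd_ne hq)
  homog q hq c hc := by
    have h := tChart_symm_fibreLift (p := p) (p' := p) (q := q)
      (mem_changeDomain.2 ⟨hq.1, (chartAt (Base m) p).map_target hq.1⟩) c
    have h1 : fibreLift (chartChange (m := m) p p) c q = (q.1, c • q.2) := by
      have h2 : chartChange (m := m) p p =ᶠ[𝓝 q.1] id := by
        filter_upwards [(chartAt (Base m) p).open_target.mem_nhds hq.1] with x hx
        exact (chartAt (Base m) p).right_inv hx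
      rw [fibreLift, h2.fderiv_eq, h2.eq_of_nhds]
      simp
    rw [h1] at h
    rw [loc, loc, h]
    exact F.homog _ (tChart_symm_snd_ne hq) c hc
  posDef q hq := by
    have h := F.posDef p ((tChart p).symm q) ((chartAt (Base m) p).map_target hq.1)
      (tChart_symm_snd_ne hq)
    rwa [(tChart p).right_inv (mem_tChart_target.2 hq.1)] at h

theorem isCoordChange (p p' : M) : IsCoordChange (F.loc p) (F.loc p') (changeDomain p p')
    (chartAt (Base m) p').target (chartChange p p') where
  left := (F.isLocalFinsler p).mono (isOpen_changeDomain p p') fun x hx => (mem_changeDomain.1 hx).1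
  right := F.isLocalFinsler p'
  smooth := contDiffOn_chartChange p p'
  mapsTo x hx := (chartAt (Base m) p').map_source (mem_changeDomain.1 hx).2
  injective x hx := injective_fderiv_chartChange hx
  compat q hq := by
    have h := tChart_symm_fibreLift hq.1 1
    rw [fibreLift, one_smul, one_smul] at h
    rw [loc, h]
    rfl

theorem loc_pos {p : M} {z : SphereBundle m M} (hz : z ∈ coordDomain p) :
    0 < F.loc p (natCoord p z) := (F.isLocalFinsler p).pos _ (natCoord_mem hz)

theorem natCoord_mem_change {p p' : M} {z : SphereBundle m M} (hz : z ∈ coordDomain p)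
    (hz' : z ∈ coordDomain p') : natCoord p z ∈ slit (changeDomain (m := m) p p') := by
  refine ⟨?_, (natCoord_mem hz).2⟩
  rw [natCoord_fst]
  exact chartAt_mem_changeDomain hz hz'

/-- The dilation by `c` restores the normalization `‖y‖ = 1` in the second chart. -/
theorem exists_natCoord_eq_fibreLift {p p' : M} {z : SphereBundle m M} (hz : z ∈ coordDomain p)
    (hz' : z ∈ coordDomain p') :
    ∃ c : ℝ, 0 < c ∧ natCoord p' z = fibreLift (chartChange p p') c (natCoord p z) := by
  have hq := natCoord_mem_change hz hz'
  have h0 : fderiv ℝ (chartChange (m := m) p p') (natCoord p z).1 (natCoord p z).2 ≠ 0 := fun h =>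
    hq.2 (injective_fderiv_chartChange hq.1 (h.trans (map_zero _).symm))
  refine ⟨‖fderiv ℝ (chartChange (m := m) p p') (natCoord p z).1 (natCoord p z).2‖⁻¹,
    inv_pos.2 (norm_pos_iff.2 h0), ?_⟩
  have h1 := rayOfCoord_fibreLift hq one_pos
  rw [rayOfCoord_natCoord hz] at h1
  have h2 : fibreLift (chartChange (m := m) p p') 1 (natCoord p z) ∈ slitTarget p' := by
    refine ⟨(chartAt (Base m) p').map_source (mem_changeDomain.1 hq.1).2, ?_⟩
    simpa [fibreLift] using h0
  have h3 := natCoord_rayOfCoord h2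
  rw [h1] at h3
  rw [h3]
  simp [fibreLift]

/-- The effect of a change of charts on the coordinates of tangent vectors of `SM`. -/
theorem exists_dCoord_eq (F : FinslerStructure m M) {p p' : M} {z : SphereBundle m M}
    (hz : z ∈ coordDomain p) (hz' : z ∈ coordDomain p') {c : ℝ} (hc : 0 < c)
    (h : natCoord p' z = fibreLift (chartChange p p') c (natCoord p z)) (X : TSM z) :
    ∃ k : ℝ, dCoord p' z X = fibreLiftDeriv (chartChange p p') c (natCoord p z) (dCoord p z X) +
      (0, k • (natCoord p' z).2) := by
  have hq := natCoord_mem_change hz hz'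
  have h1 : HasMFDerivAt 𝓘(ℝ, Base m × Base m) 𝓘(ℝ, Base m × Base m)
      (fibreLift (chartChange (m := m) p p') c) (natCoord p z)
      (fibreLiftDeriv (chartChange p p') c (natCoord p z)) :=
    ((F.isCoordChange p p').hasFDerivAt_fibreLift hq.1 c).hasMFDerivAt
  have h2 := hasMFDerivAt_rayOfCoord hz'
  rw [h] at h2
  have h3 := h2.comp (natCoord p z) h1
  have h4 : rayOfCoord (M := M) p =ᶠ[𝓝 (natCoord p z)]
      rayOfCoord p' ∘ fibreLift (chartChange (m := m) p p') c := by
    filter_upwards [(isOpen_slit (isOpen_changeDomain p p')).mem_nhds hq] with r hr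
    exact (rayOfCoord_fibreLift hr hc).symm
  have h5 := congrArg (fun T : Base m × Base m →L[ℝ] SMModel m => T (dCoord p z X))
    (hasMFDerivAt_unique (hasMFDerivAt_rayOfCoord hz) (h3.congr_of_eventuallyEq h4))
  have h6 : X = ofCoord p' z (fibreLiftDeriv (chartChange p p') c (natCoord p z) (dCoord p z X)) :=
    (ofCoord_dCoord hz X).symm.trans h5
  obtain ⟨k, hk⟩ := dCoord_ofCoord hz'
    (fibreLiftDeriv (chartChange p p') c (natCoord p z) (dCoord p z X))
  refine ⟨k, ?_⟩
  rw [← h6] at hk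
  rw [hk]
  exact Prod.ext (add_zero _).symm rfl

end FinslerStructure

/-! ### The metrics in natural coordinates -/

namespace FinslerStructure
variable {m : ℕ} {M : Type*} [TopologicalSpace M] [ChartedSpace (Base m) M]
  [IsManifold (𝓡 (m + 1)) ∞ M] (F : FinslerStructure m M)

/-- The vector `(δyⁱ(X))`. -/
def deltaVec (p : M) (z : SphereBundle m M) : TSM z →ₗ[ℝ] Base m :=
  (F.loc p (natCoord p z))⁻¹ • (LinearMap.snd ℝ (Base m) (Base m) ∘ₗ (dCoord p z).toLinearMap +
    (nonlinMap (F.loc p) (natCoord p z)).toLinearMap ∘ₗ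
      LinearMap.fst ℝ (Base m) (Base m) ∘ₗ (dCoord p z).toLinearMap)

theorem deltaVec_apply (p : M) (z : SphereBundle m M) (X : TSM z) :
    F.deltaVec p z X = (F.loc p (natCoord p z))⁻¹ •
      ((dCoord p z X).2 + nonlinMap (F.loc p) (natCoord p z) (dCoord p z X).1) := rfl

theorem deltaVec_apply_coord {p : M} {z : SphereBundle m M} (hz : z ∈ coordDomain p) (X : TSM z)
    (i : Fin (m + 1)) : F.deltaVec p z X i = F.deltaY p z i X := by
  rw [deltaVec_apply, deltaY]
  simp only [PiLp.smul_apply, PiLp.add_apply, (F.isLocalFinsler p).nonlin_sum (natCoord_mem hz),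
    LinearMap.smul_apply, LinearMap.add_apply, LinearMap.sum_apply, dx_apply, dy_apply, nonlin,
    smul_eq_mul]

theorem dCoord_snd {p : M} {z : SphereBundle m M} (hz : z ∈ coordDomain p) (X : TSM z) :
    (dCoord p z X).2 = F.loc p (natCoord p z) • F.deltaVec p z X -
      nonlinMap (F.loc p) (natCoord p z) (dCoord p z X).1 := by
  rw [deltaVec_apply, smul_inv_smul₀ (F.loc_pos hz).ne']
  abel

theorem sasakiIn_apply {p : M} {z : SphereBundle m M} (hz : z ∈ coordDomain p) (X Y : TSM z) :
    F.sasakiIn p z X Y = gForm (F.loc p) (natCoord p z) (dCoord p z X).1 (dCoord p z Y).1 +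
      hForm (F.loc p) (natCoord p z) (F.deltaVec p z X) (F.deltaVec p z Y) := by
  rw [sasakiIn, hForm, clm_snd_eq_sum _ (F.deltaVec p z X), clm_snd_eq_sum _ (F.deltaVec p z Y)]
  simp only [LinearMap.sum_apply, LinearMap.add_apply, LinearMap.smul_apply,
    LinearMap.BilinForm.linMulLin_apply, dx_apply, smul_eq_mul, gForm, Finset.sum_add_distrib,
    F.deltaVec_apply_coord hz, sub_mul, Finset.sum_sub_distrib, Finset.sum_mul_sum]
  congr 1
  · exact Finset.sum_congr rfl fun i _ => Finset.sum_congr rfl fun j _ => by ring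
  · congr 1
    · exact Finset.sum_congr rfl fun i _ => Finset.sum_congr rfl fun j _ => by ring
    · exact Finset.sum_congr rfl fun i _ => Finset.sum_congr rfl fun j _ => by rw [pdy, pdy]; ring

/-- `δy` transforms as a vector, up to a multiple of `y`. -/
theorem exists_deltaVec_eq {p p' : M} {z : SphereBundle m M} (hz : z ∈ coordDomain p)
    (hz' : z ∈ coordDomain p') {c : ℝ} (hc : 0 < c)
    (h : natCoord p' z = fibreLift (chartChange p p') c (natCoord p z)) (X : TSM z) :
    ∃ k : ℝ, F.deltaVec p' z X =
      fderiv ℝ (chartChange p p') (natCoord p z).1 (F.deltaVec p z X) + k • (natCoord p' z).2 := by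
  have hq := natCoord_mem_change hz hz'
  have hf := (F.loc_pos hz).ne'
  obtain ⟨k, hk⟩ := F.exists_dCoord_eq hz hz' hc h X
  refine ⟨(F.loc p' (natCoord p' z))⁻¹ * k, ?_⟩
  rw [deltaVec_apply, hk, fibreLiftDeriv_apply]
  simp only [Prod.fst_add, Prod.snd_add, add_zero]
  rw [h, (F.isCoordChange p p').nonlinMap_fibreLift hq hc, (F.isCoordChange p p').apply_fibreLift hq hc,
    dCoord_snd F hz]
  simp only [map_sub, map_smul]
  match_scalars <;> field_simp <;> ring

/-- The Sasaki-type metric does not depend on the chart: the multiples of `y` by which `δy` fails to be a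
vector lie in the kernel of the angular form. -/
theorem sasakiIn_change {p p' : M} {z : SphereBundle m M} (hz : z ∈ coordDomain p)
    (hz' : z ∈ coordDomain p') (X Y : TSM z) : F.sasakiIn p' z X Y = F.sasakiIn p z X Y := by
  have hq := natCoord_mem_change hz hz'
  obtain ⟨c, hc, h⟩ := exists_natCoord_eq_fibreLift hz hz'
  obtain ⟨k, hk⟩ := F.exists_deltaVec_eq hz hz' hc h X
  obtain ⟨l, hl⟩ := F.exists_deltaVec_eq hz hz' hc h Y
  obtain ⟨k', hk'⟩ := F.exists_dCoord_eq hz hz' hc h X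
  obtain ⟨l', hl'⟩ := F.exists_dCoord_eq hz hz' hc h Y
  have F' := F.isLocalFinsler p'
  have hm := natCoord_mem (m := m) hz'
  rw [F.sasakiIn_apply hz', F.sasakiIn_apply hz, hk, hl, hk', hl']
  simp only [hForm_add_left, hForm_add_right, hForm_smul_left, hForm_smul_right,
    F'.hForm_self_left hm, F'.hForm_symm hm _ (natCoord p' z).2, mul_zero, add_zero]
  rw [fibreLiftDeriv_apply, fibreLiftDeriv_apply, h, (F.isCoordChange p p').hForm_fibreLift hq hc]
  simp only [Prod.fst_add, add_zero]
  rw [(F.isCoordChange p p').gForm_fibreLift hq hc]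

theorem sasaki_apply {p : M} {z : SphereBundle m M} (hz : z ∈ coordDomain p) (X Y : TSM z) :
    F.sasaki z X Y = gForm (F.loc p) (natCoord p z) (dCoord p z X).1 (dCoord p z Y).1 +
      hForm (F.loc p) (natCoord p z) (F.deltaVec p z X) (F.deltaVec p z Y) := by
  rw [sasaki, F.sasakiIn_change hz (mem_coordDomain_self z), F.sasakiIn_apply hz]

theorem fund_apply {p : M} {z : SphereBundle m M} (hz : z ∈ coordDomain p) (a b : PullTM z) :
    F.fund z a b = gForm (F.loc p) (natCoord p z) (fiberCoord p (proj m M z) a)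
      (fiberCoord p (proj m M z) b) := by
  have hz' := mem_coordDomain_self z
  obtain ⟨c, hc, h⟩ := exists_natCoord_eq_fibreLift hz hz'
  change gForm _ _ _ _ = _
  rw [fiberCoord_change hz hz', fiberCoord_change hz hz', h, ← natCoord_fst,
    (F.isCoordChange _ _).gForm_fibreLift (natCoord_mem_change hz hz') hc]

theorem fund_add_left (z : SphereBundle m M) (a a' b : PullTM z) :
    F.fund z (a + a') b = F.fund z a b + F.fund z a' b := by
  simp only [F.fund_apply (mem_coordDomain_self z), map_add, gForm_add_left]

theorem fund_smul_left (z : SphereBundle m M) (c : ℝ) (a b : PullTM z) :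
    F.fund z (c • a) b = c * F.fund z a b := by
  simp only [F.fund_apply (mem_coordDomain_self z), map_smul, gForm_smul_left]

theorem fund_symm (z : SphereBundle m M) (a b : PullTM z) : F.fund z a b = F.fund z b a := by
  simp only [F.fund_apply (mem_coordDomain_self z)]
  exact (F.isLocalFinsler _).gForm_symm (natCoord_mem (mem_coordDomain_self z)) _ _

theorem fund_add_right (z : SphereBundle m M) (a b b' : PullTM z) :
    F.fund z a (b + b') = F.fund z a b + F.fund z a b' := by
  simp only [F.fund_symm z a, fund_add_left]

theorem fund_smul_right (z : SphereBundle m M) (c : ℝ) (a b : PullTM z) :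
    F.fund z a (c • b) = c * F.fund z a b := by
  simp only [F.fund_symm z a, fund_smul_left]

/-- The metric on the fibre of `π^*TM` as a bilinear form. -/
def fundBilin (z : SphereBundle m M) : LinearMap.BilinForm ℝ (PullTM z) :=
  LinearMap.mk₂ ℝ (F.fund z) (F.fund_add_left z) (F.fund_smul_left z) (F.fund_add_right z)
    (F.fund_smul_right z)

@[simp]
theorem fundBilin_apply (z : SphereBundle m M) (a b : PullTM z) :
    F.fundBilin z a b = F.fund z a b := rfl

theorem fund_eq_zero {z : SphereBundle m M} {a : PullTM z} (h : F.fund z a a = 0) : a = 0 := by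
  have hz := mem_coordDomain_self z
  by_contra ha
  rw [F.fund_apply hz] at h
  refine ((F.isLocalFinsler _).gForm_pos (natCoord_mem hz) fun h0 => ha ?_).ne' h
  exact (fiberCoord_bijective hz).1 (h0.trans (map_zero _).symm)

theorem fund_ext {z : SphereBundle m M} {a a' : PullTM z} (h : ∀ b, F.fund z a b = F.fund z a' b) :
    a = a' := by
  rw [← sub_eq_zero]
  apply F.fund_eq_zero
  rw [← fundBilin_apply, LinearMap.BilinForm.sub_left]
  exact sub_eq_zero.2 (h _)

theorem nondegenerate_fundBilin (z : SphereBundle m M) : (F.fundBilin z).Nondegenerate :=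
  ⟨fun a h => F.fund_eq_zero (h a), fun a h => F.fund_eq_zero (h a)⟩

/-- A linear form on the fibre of `π^*TM` is represented by a vector. -/
theorem exists_fund_eq (z : SphereBundle m M) (φ : PullTM z →ₗ[ℝ] ℝ) :
    ∃ a : PullTM z, ∀ b, F.fund z a b = φ b :=
  have : FiniteDimensional ℝ (PullTM z) := inferInstanceAs (FiniteDimensional ℝ (Base m))
  ⟨((F.fundBilin z).toDual (F.nondegenerate_fundBilin z)).symm φ, fun b =>
    LinearMap.BilinForm.apply_toDual_symm_apply (hB := F.nondegenerate_fundBilin z) φ b⟩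

/-! ### The Sasaki-type metric and the horizontal bundle -/

theorem sasaki_symm (z : SphereBundle m M) (X Y : TSM z) : F.sasaki z X Y = F.sasaki z Y X := by
  have hz := mem_coordDomain_self z
  have hF := F.isLocalFinsler (proj m M z)
  rw [F.sasaki_apply hz, F.sasaki_apply hz, hF.gForm_symm (natCoord_mem hz),
    hF.hForm_symm (natCoord_mem hz)]

/-- The Sasaki-type metric is definite: if `⟨X, X⟩ = 0` then `dx(X) = 0` and `dy(X)` is a multiple of `y`,
which the normalization `‖y‖ = 1` forces to vanish. -/
theorem sasaki_eq_zero {z : SphereBundle m M} {X : TSM z} (h : F.sasaki z X X = 0) : X = 0 := by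
  have hz := mem_coordDomain_self z
  have hF := F.isLocalFinsler (proj m M z)
  have hq := natCoord_mem (m := m) hz
  rw [F.sasaki_apply hz] at h
  have h1 := hF.hForm_self_nonneg hq (F.deltaVec (proj m M z) z X)
  have hx : (dCoord (proj m M z) z X).1 = 0 := by
    by_contra hx
    have := hF.gForm_pos hq hx
    linarith
  have h2 : hForm (F.loc (proj m M z)) (natCoord (proj m M z) z) (F.deltaVec (proj m M z) z X)
      (F.deltaVec (proj m M z) z X) = 0 := by
    rw [hx] at h
    simpa [gForm] using h
  obtain ⟨c, hc⟩ := hF.exists_smul_of_hForm_self_eq_zero hq h2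
  have h3 : (dCoord (proj m M z) z X).2 =
      (F.loc (proj m M z) (natCoord (proj m M z) z) * c) • (natCoord (proj m M z) z).2 := by
    rw [F.dCoord_snd hz, hc, hx, map_zero, sub_zero, smul_smul]
  have h4 := inner_dCoord hz X
  rw [h3, inner_smul_right, real_inner_self_eq_norm_sq, norm_natCoord_snd, one_pow, mul_one] at h4
  rw [h4, zero_smul] at h3
  exact dCoord_injective hz ((Prod.ext hx h3).trans (map_zero _).symm)

theorem sasaki_ext {z : SphereBundle m M} {X X' : TSM z} (h : ∀ Y, F.sasaki z X Y = F.sasaki z X' Y) :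
    X = X' := by
  rw [← sub_eq_zero]
  apply F.sasaki_eq_zero
  rw [LinearMap.BilinForm.sub_left, h, sub_self]

theorem nondegenerate_sasaki (z : SphereBundle m M) : (F.sasaki z).Nondegenerate :=
  ⟨fun a h => F.sasaki_eq_zero (h a), fun a h => F.sasaki_eq_zero (h a)⟩

/-- The horizontal vector of `SM` at `z` with `dx = a`. -/
def horLift (p : M) (z : SphereBundle m M) (a : Base m) : TSM z :=
  ofCoord p z (a, -nonlinMap (F.loc p) (natCoord p z) a)

theorem dCoord_horLift_fst {p : M} {z : SphereBundle m M} (hz : z ∈ coordDomain p) (a : Base m) :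
    (dCoord p z (F.horLift p z a)).1 = a := by
  obtain ⟨c, hc⟩ := dCoord_ofCoord hz (a, -nonlinMap (F.loc p) (natCoord p z) a)
  rw [horLift, hc]

/-- A vector is horizontal when `δy` vanishes on it modulo `y`. -/
theorem mem_hor_iff {p : M} {z : SphereBundle m M} (hz : z ∈ coordDomain p) (X : TSM z) :
    X ∈ F.hor z ↔ ∃ c : ℝ, F.deltaVec p z X = c • (natCoord p z).2 := by
  have hF := F.isLocalFinsler p
  have hq := natCoord_mem (m := m) hz
  have hf := F.loc_pos hz
  rw [hor, LinearMap.BilinForm.mem_orthogonal_iff]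
  constructor
  · intro h
    obtain ⟨k, hk⟩ := dCoord_ofCoord hz (0, F.deltaVec p z X)
    have h1 := h _ ((mem_vert_iff hz (ofCoord p z (0, F.deltaVec p z X))).2 (by rw [hk]))
    rw [F.sasaki_apply hz, F.deltaVec_apply p z (ofCoord _ _ _), hk] at h1
    simp only [map_zero, add_zero, hForm_smul_left, hForm_add_left, hF.hForm_self_left hq,
      mul_zero] at h1
    refine hF.exists_smul_of_hForm_self_eq_zero hq ?_
    have h2 : gForm (F.loc p) (natCoord p z) 0 (dCoord p z X).1 = 0 := by simp [gForm]
    rw [h2, zero_add] at h1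
    exact (mul_eq_zero.1 h1).resolve_left (inv_ne_zero hf.ne')
  · rintro ⟨c, hc⟩ V hV
    rw [mem_vert_iff hz] at hV
    rw [F.sasaki_apply hz, hV, hc, hForm_smul_right,
      hF.hForm_symm hq, hF.hForm_self_left hq]
    simp [gForm]

theorem horLift_mem {p : M} {z : SphereBundle m M} (hz : z ∈ coordDomain p) (a : Base m) :
    F.horLift p z a ∈ F.hor z := by
  obtain ⟨c, hc⟩ := dCoord_ofCoord hz (a, -nonlinMap (F.loc p) (natCoord p z) a)
  refine (F.mem_hor_iff hz _).2 ⟨(F.loc p (natCoord p z))⁻¹ * c, ?_⟩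
  rw [deltaVec_apply, horLift, hc, mul_smul]
  congr 1
  simp only
  abel

theorem sub_horLift_mem {p : M} {z : SphereBundle m M} (hz : z ∈ coordDomain p) (X : TSM z) :
    X - F.horLift p z (dCoord p z X).1 ∈ vert z := by
  rw [mem_vert_iff hz, map_sub, Prod.fst_sub, F.dCoord_horLift_fst hz, sub_self]

theorem isCompl_vert_hor (z : SphereBundle m M) : IsCompl (vert z) (F.hor z) := by
  have hz := mem_coordDomain_self z
  refine IsCompl.of_eq (Submodule.eq_bot_iff _ |>.2 ?_) (Submodule.eq_top_iff'.2 fun X => ?_)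
  · rintro X ⟨hX, hX'⟩
    exact F.sasaki_eq_zero (hX' X hX)
  · rw [← sub_add_cancel X (F.horLift (proj m M z) z (dCoord (proj m M z) z X).1)]
    exact Submodule.add_mem_sup (F.sub_horLift_mem hz X) (F.horLift_mem hz _)

theorem horProj_apply {p : M} {z : SphereBundle m M} (hz : z ∈ coordDomain p) (X : TSM z) :
    F.horProj z X = F.horLift p z (dCoord p z X).1 := by
  have h := (F.isCompl_vert_hor z).symm
  rw [horProj, dif_pos h]
  nth_rewrite 1 [← sub_add_cancel X (F.horLift p z (dCoord p z X).1)]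
  rw [map_add, (Submodule.projection_apply_eq_zero_iff h).2 (F.sub_horLift_mem hz X), zero_add]
  exact Submodule.projection_apply_left h ⟨_, F.horLift_mem hz _⟩

theorem vertProj_apply (z : SphereBundle m M) (X : TSM z) : F.vertProj z X = X - F.horProj z X := by
  have h := F.isCompl_vert_hor z
  rw [vertProj, dif_pos h, horProj, dif_pos h.symm, eq_sub_iff_add_eq]
  exact Submodule.projection_add_projection_eq_self h X

theorem horProj_mem (z : SphereBundle m M) (X : TSM z) : F.horProj z X ∈ F.hor z := by
  rw [F.horProj_apply (mem_coordDomain_self z)]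
  exact F.horLift_mem (mem_coordDomain_self z) _

theorem vertProj_mem (z : SphereBundle m M) (X : TSM z) : F.vertProj z X ∈ vert z := by
  rw [vertProj_apply, F.horProj_apply (mem_coordDomain_self z)]
  exact F.sub_horLift_mem (mem_coordDomain_self z) _

theorem dproj_eq_zero {z : SphereBundle m M} {X : TSM z} (h : X ∈ vert z) : dproj z X = 0 := h

theorem dproj_horProj (z : SphereBundle m M) (X : TSM z) : dproj z (F.horProj z X) = dproj z X := by
  have := F.vertProj_mem z X
  rw [vertProj_apply] at this
  have h := dproj_eq_zero this
  rw [map_sub, sub_eq_zero] at h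
  exact h.symm

theorem horProj_of_mem {z : SphereBundle m M} {X : TSM z} (h : X ∈ F.hor z) : F.horProj z X = X := by
  have hc := (F.isCompl_vert_hor z).symm
  rw [horProj, dif_pos hc]
  exact Submodule.projection_apply_left hc ⟨X, h⟩

theorem horProj_add_vertProj (z : SphereBundle m M) (X : TSM z) :
    F.horProj z X + F.vertProj z X = X := by
  rw [vertProj_apply, add_sub_cancel]

/-- On horizontal vectors the Sasaki-type metric is the metric of `π^*TM`. -/
theorem sasaki_of_hor_left {z : SphereBundle m M} {X : TSM z} (h : X ∈ F.hor z) (Y : TSM z) :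
    F.sasaki z X Y = F.fund z (dproj z X) (dproj z Y) := by
  have hz := mem_coordDomain_self z
  obtain ⟨c, hc⟩ := (F.mem_hor_iff hz X).1 h
  rw [F.sasaki_apply hz, F.fund_apply hz, hc, hForm_smul_left,
    (F.isLocalFinsler _).hForm_self_left (natCoord_mem hz), mul_zero, add_zero, dCoord_fst hz,
    dCoord_fst hz]

theorem sasaki_of_hor_right {z : SphereBundle m M} (X : TSM z) {Y : TSM z} (h : Y ∈ F.hor z) :
    F.sasaki z X Y = F.fund z (dproj z X) (dproj z Y) := by
  rw [F.sasaki_symm, F.sasaki_of_hor_left h, F.fund_symm]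

theorem dproj_injOn_hor {z : SphereBundle m M} {X Y : TSM z} (hX : X ∈ F.hor z) (hY : Y ∈ F.hor z)
    (h : dproj z X = dproj z Y) : X = Y := by
  rw [← F.horProj_of_mem hX, ← F.horProj_of_mem hY, F.horProj_apply (mem_coordDomain_self z),
    F.horProj_apply (mem_coordDomain_self z), dCoord_fst (mem_coordDomain_self z),
    dCoord_fst (mem_coordDomain_self z), h]

theorem exists_mem_hor_dproj_eq {z : SphereBundle m M} (a : PullTM z) :
    ∃ X ∈ F.hor z, dproj z X = a := by
  have hz := mem_coordDomain_self z
  refine ⟨F.horLift _ z (fiberCoord (proj m M z) (proj m M z) a), F.horLift_mem hz _, ?_⟩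
  apply (fiberCoord_bijective hz).1
  rw [← dCoord_fst hz, F.dCoord_horLift_fst hz]

/-! ### The Cartan tensor -/

/-- The Cartan tensor is half the derivative of `g` along the fibre, in the direction `F δy(X)`. -/
theorem cartanTensor_apply (z : SphereBundle m M) (a b : PullTM z) (X : TSM z) :
    F.cartanTensor z a b X = 1 / 2 * F.loc (proj m M z) (natCoord (proj m M z) z) *
      fderiv ℝ (fun r => gForm (F.loc (proj m M z)) r (fiberCoord (proj m M z) (proj m M z) a)
        (fiberCoord (proj m M z) (proj m M z) b)) (natCoord (proj m M z) z)
        (0, F.deltaVec (proj m M z) z X) := by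
  have hz := mem_coordDomain_self z
  have hF := F.isLocalFinsler (proj m M z)
  set q := natCoord (proj m M z) z
  set f := F.loc (proj m M z)
  have hd : ∀ i j, DifferentiableAt ℝ (fun r => gMat f r i j) q := fun i j =>
    ((hF.contDiffOn_gMat i j).contDiffAt (hF.slit_mem_nhds (natCoord_mem hz))).differentiableAt
      (by simp)
  set a' := fiberCoord (proj m M z) (proj m M z) a
  set b' := fiberCoord (proj m M z) (proj m M z) b
  have h1 : HasFDerivAt (fun r => gForm f r a' b')
      (∑ i, ∑ j, (a' i * b' j) • fderiv ℝ (fun r => gMat f r i j) q) q := by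
    refine HasFDerivAt.fun_sum fun i _ => HasFDerivAt.fun_sum fun j _ => ?_
    refine (((hd i j).hasFDerivAt.mul_const (a' i)).mul_const (b' j)).congr_fderiv ?_
    rw [smul_smul, mul_comm]
  rw [h1.fderiv]
  simp only [_root_.sum_apply, _root_.smul_apply, smul_eq_mul, Finset.mul_sum]
  rw [cartanTensor]
  refine Finset.sum_congr rfl fun i _ => Finset.sum_congr rfl fun j _ => ?_
  rw [clm_snd_eq_sum, Finset.mul_sum, Finset.mul_sum]
  refine Finset.sum_congr rfl fun k _ => ?_
  rw [F.deltaVec_apply_coord hz, cartanCoeff, smul_eq_mul]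
  have h2 : pdy j (pdy i fun r => f r ^ 2) = fun r => 2 * gMat f r i j := by
    ext r
    simp [gMat]
  rw [h2, pdy, fderiv_const_mul (hd i j), _root_.smul_apply, smul_eq_mul]
  ring

theorem cartanTensor_symm (z : SphereBundle m M) (a b : PullTM z) (X : TSM z) :
    F.cartanTensor z a b X = F.cartanTensor z b a X := by
  rw [cartanTensor_apply, cartanTensor_apply, (F.isLocalFinsler _).fderiv_gForm_symm
    (natCoord_mem (mem_coordDomain_self z))]

theorem cartanTensor_add_left (z : SphereBundle m M) (a a' b : PullTM z) (X : TSM z) :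
    F.cartanTensor z (a + a') b X = F.cartanTensor z a b X + F.cartanTensor z a' b X := by
  simp only [cartanTensor, map_add, PiLp.add_apply, mul_add, add_mul, Finset.sum_add_distrib]

theorem cartanTensor_smul_left (z : SphereBundle m M) (c : ℝ) (a b : PullTM z) (X : TSM z) :
    F.cartanTensor z (c • a) b X = c * F.cartanTensor z a b X := by
  simp only [cartanTensor, map_smul, PiLp.smul_apply, smul_eq_mul, Finset.mul_sum]
  refine Finset.sum_congr rfl fun i _ => Finset.sum_congr rfl fun j _ =>
    Finset.sum_congr rfl fun k _ => by ring

theorem cartanTensor_add_right (z : SphereBundle m M) (a b b' : PullTM z) (X : TSM z) :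
    F.cartanTensor z a (b + b') X = F.cartanTensor z a b X + F.cartanTensor z a b' X := by
  simp only [F.cartanTensor_symm z a, cartanTensor_add_left]

theorem cartanTensor_smul_right (z : SphereBundle m M) (c : ℝ) (a b : PullTM z) (X : TSM z) :
    F.cartanTensor z a (c • b) X = c * F.cartanTensor z a b X := by
  simp only [F.cartanTensor_symm z a, cartanTensor_smul_left]

/-- The Cartan tensor with fixed first two arguments, as a one-form. -/
def cartanForm (z : SphereBundle m M) (a b : PullTM z) : TSM z →ₗ[ℝ] ℝ :=
  ∑ i, ∑ j, ∑ k, (cartanCoeff (F.loc (proj m M z)) i j k (natCoord (proj m M z) z) *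
    fiberCoord (proj m M z) (proj m M z) a i * fiberCoord (proj m M z) (proj m M z) b j) •
    F.deltaY (proj m M z) z k

theorem cartanForm_apply (z : SphereBundle m M) (a b : PullTM z) (X : TSM z) :
    F.cartanForm z a b X = F.cartanTensor z a b X := by
  simp [cartanForm, cartanTensor]

/-- On horizontal vectors `δy` is a multiple of `y`, along which `g` is constant. -/
theorem cartanTensor_of_hor {z : SphereBundle m M} (a b : PullTM z) {X : TSM z} (h : X ∈ F.hor z) :
    F.cartanTensor z a b X = 0 := by
  have hz := mem_coordDomain_self z
  obtain ⟨c, hc⟩ := (F.mem_hor_iff hz X).1 h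
  have : ((0, c • (natCoord (proj m M z) z).2) : Base m × Base m) =
    c • (0, (natCoord (proj m M z) z).2) := by simp
  rw [cartanTensor_apply, hc, this, map_smul,
    (F.isLocalFinsler _).fderiv_gForm_self (natCoord_mem hz), smul_zero, mul_zero]

end FinslerStructure

/-! ### Differentiability of the metrics along fields -/

namespace IsLocalFinsler
variable {m : ℕ} {f : Base m × Base m → ℝ} {O : Set (Base m)} (hf : IsLocalFinsler f O)
  {q : Base m × Base m}
include hf

theorem contDiffAt_gForm (hq : q ∈ slit O) (ab : Base m × Base m) :
    ContDiffAt ℝ ∞ (fun t : (Base m × Base m) × (Base m × Base m) => gForm f t.1 t.2.1 t.2.2)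
      (q, ab) := by
  refine ContDiffAt.sum fun i _ => ContDiffAt.sum fun j _ => ?_
  have h1 : ContDiffAt ℝ ∞ (fun r => gMat f r i j) q :=
    (hf.contDiffOn_gMat i j).contDiffAt (hf.slit_mem_nhds hq)
  have h2 : ContDiffAt ℝ ∞ (fun t : (Base m × Base m) × (Base m × Base m) => gMat f t.1 i j) (q, ab) :=
    ContDiffAt.comp (q, ab) (g := fun r => gMat f r i j) h1 contDiffAt_fst
  have h3 : ContDiff ℝ ∞ (fun t : (Base m × Base m) × (Base m × Base m) => t.2.1 i) :=
    (EuclideanSpace.proj (𝕜 := ℝ) i).contDiff.comp (contDiff_fst.comp contDiff_snd)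
  have h4 : ContDiff ℝ ∞ (fun t : (Base m × Base m) × (Base m × Base m) => t.2.2 j) :=
    (EuclideanSpace.proj (𝕜 := ℝ) j).contDiff.comp (contDiff_snd.comp contDiff_snd)
  exact (h2.mul h3.contDiffAt).mul h4.contDiffAt

theorem contDiffAt_hForm (hq : q ∈ slit O) (ab : Base m × Base m) :
    ContDiffAt ℝ ∞ (fun t : (Base m × Base m) × (Base m × Base m) => hForm f t.1 t.2.1 t.2.2)
      (q, ab) := by
  have h1 : ContDiffAt ℝ ∞ (fderiv ℝ f) q :=
    (hf.smooth.fderiv_of_isOpen (isOpen_slit hf.isOpen) (by simp)).contDiffAt (hf.slit_mem_nhds hq)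
  have h2 : ContDiffAt ℝ ∞ (fun t : (Base m × Base m) × (Base m × Base m) => fderiv ℝ f t.1) (q, ab) :=
    ContDiffAt.comp (q, ab) (g := fderiv ℝ f) h1 contDiffAt_fst
  have h3 : ContDiff ℝ ∞
      (fun t : (Base m × Base m) × (Base m × Base m) => ((0, t.2.1) : Base m × Base m)) :=
    contDiff_const.prodMk (contDiff_fst.comp contDiff_snd)
  have h4 : ContDiff ℝ ∞
      (fun t : (Base m × Base m) × (Base m × Base m) => ((0, t.2.2) : Base m × Base m)) :=
    contDiff_const.prodMk (contDiff_snd.comp contDiff_snd)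
  exact (hf.contDiffAt_gForm hq ab).sub ((h2.clm_apply h3.contDiffAt).mul (h2.clm_apply h4.contDiffAt))

/-- The map `(q, ξ) ↦ δy(ξ)` is smooth in coordinates. -/
theorem contDiffAt_delta (hq : q ∈ slit O) (ξ : Base m × Base m) :
    ContDiffAt ℝ ∞ (fun t : (Base m × Base m) × (Base m × Base m) =>
      (f t.1)⁻¹ • (t.2.2 + nonlinMap f t.1 t.2.1)) (q, ξ) := by
  have h1 : ContDiffAt ℝ ∞ (fun t : (Base m × Base m) × (Base m × Base m) => f t.1) (q, ξ) :=
    ContDiffAt.comp (q, ξ) (g := f) (hf.contDiffAt hq) contDiffAt_fst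
  have h2 : ContDiffAt ℝ ∞ (fun t : (Base m × Base m) × (Base m × Base m) => nonlinMap f t.1) (q, ξ) :=
    ContDiffAt.comp (q, ξ) (g := nonlinMap f)
      (hf.contDiffOn_nonlinMap.contDiffAt (hf.slit_mem_nhds hq)) contDiffAt_fst
  refine (h1.inv (hf.pos q hq).ne').smul ((contDiff_snd.comp contDiff_snd).contDiffAt.add
    (h2.clm_apply (contDiff_fst.comp contDiff_snd).contDiffAt))

/-- The Sasaki-type metric is smooth in coordinates. -/
theorem contDiffAt_sasaki (hq : q ∈ slit O) (ξη : (Base m × Base m) × (Base m × Base m)) :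
    ContDiffAt ℝ ∞ (fun t : (Base m × Base m) × (Base m × Base m) × (Base m × Base m) =>
      gForm f t.1 t.2.1.1 t.2.2.1 +
        hForm f t.1 ((f t.1)⁻¹ • (t.2.1.2 + nonlinMap f t.1 t.2.1.1))
          ((f t.1)⁻¹ • (t.2.2.2 + nonlinMap f t.1 t.2.2.1))) (q, ξη) := by
  obtain ⟨ξ, η⟩ := ξη
  have a1 : ContDiffAt ℝ ∞ (fun t : (Base m × Base m) × (Base m × Base m) × (Base m × Base m) =>
      (t.1, t.2.1)) (q, (ξ, η)) := (contDiff_fst.prodMk (contDiff_fst.comp contDiff_snd)).contDiffAt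
  have a2 : ContDiffAt ℝ ∞ (fun t : (Base m × Base m) × (Base m × Base m) × (Base m × Base m) =>
      (t.1, t.2.2)) (q, (ξ, η)) := (contDiff_fst.prodMk (contDiff_snd.comp contDiff_snd)).contDiffAt
  have b1 := ContDiffAt.comp (q, (ξ, η)) (hf.contDiffAt_delta hq ξ) a1
  have b2 := ContDiffAt.comp (q, (ξ, η)) (hf.contDiffAt_delta hq η) a2
  have c1 : ContDiffAt ℝ ∞ (fun t : (Base m × Base m) × (Base m × Base m) × (Base m × Base m) =>
      (t.1, (t.2.1.1, t.2.2.1))) (q, (ξ, η)) :=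
    (contDiff_fst.prodMk ((contDiff_fst.comp (contDiff_fst.comp contDiff_snd)).prodMk
      (contDiff_fst.comp (contDiff_snd.comp contDiff_snd)))).contDiffAt
  exact (ContDiffAt.comp (q, (ξ, η)) (hf.contDiffAt_gForm hq (ξ.1, η.1)) c1).add
    (ContDiffAt.comp (q, (ξ, η)) (hf.contDiffAt_hForm hq _) (contDiffAt_fst.prodMk (b1.prodMk b2)))

theorem exists_hasFDerivAt_gForm (hq : q ∈ slit O) (a b : Base m) :
    ∃ T : (Base m × Base m) × (Base m × Base m) →L[ℝ] ℝ,
      HasFDerivAt (fun t : (Base m × Base m) × (Base m × Base m) => gForm f t.1 t.2.1 t.2.2) T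
      (q, (a, b)) ∧ ∀ ν σ τ, T (ν, (σ, τ)) =
        fderiv ℝ (fun r => gForm f r a b) q ν + gForm f q σ b + gForm f q a τ := by
  have hT := ((hf.contDiffAt_gForm hq (a, b)).differentiableAt (by simp)).hasFDerivAt
  refine ⟨_, hT, fun ν σ τ => ?_⟩
  set T := fderiv ℝ (fun t : (Base m × Base m) × (Base m × Base m) => gForm f t.1 t.2.1 t.2.2)
    (q, (a, b))
  have h1 : fderiv ℝ (fun r => gForm f r a b) q ν = T (ν, 0) := by
    have := HasFDerivAt.comp q (f := fun r : Base m × Base m => (r, (a, b))) hT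
      ((hasFDerivAt_id q).prodMk (hasFDerivAt_const (a, b) q))
    have h := this.fderiv
    exact congrArg (fun S : Base m × Base m →L[ℝ] ℝ => S ν) h
  have h2 : gForm f q σ b = T (0, (σ, 0)) := by
    have := HasFDerivAt.comp a (f := fun s : Base m => (q, (s, b))) hT
      ((hasFDerivAt_const q a).prodMk ((hasFDerivAt_id a).prodMk (hasFDerivAt_const b a)))
    have h := this.unique ((gBilin f q).flip b).toContinuousLinearMap.hasFDerivAt
    exact (congrArg (fun S : Base m →L[ℝ] ℝ => S σ) h).symm
  have h3 : gForm f q a τ = T (0, (0, τ)) := by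
    have := HasFDerivAt.comp b (f := fun s : Base m => (q, (a, s))) hT
      ((hasFDerivAt_const q b).prodMk ((hasFDerivAt_const a b).prodMk (hasFDerivAt_id b)))
    have h := this.unique (gBilin f q a).toContinuousLinearMap.hasFDerivAt
    exact (congrArg (fun S : Base m →L[ℝ] ℝ => S τ) h).symm
  rw [h1, h2, h3, ← map_add, ← map_add]
  simp

end IsLocalFinsler

section Along
variable {m : ℕ} {M : Type*} [TopologicalSpace M] [ChartedSpace (Base m) M]
  [IsManifold (𝓡 (m + 1)) ∞ M] {f g : SphereBundle m M → ℝ} {z : SphereBundle m M}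

theorem hasMFDerivAt_prodMk_space {G G' : Type*} [NormedAddCommGroup G] [NormedSpace ℝ G]
    [NormedAddCommGroup G'] [NormedSpace ℝ G'] {k : SphereBundle m M → G}
    {l : SphereBundle m M → G'} {k' : SMModel m →L[ℝ] G} {l' : SMModel m →L[ℝ] G'}
    (hk : HasMFDerivAt 𝓘(ℝ, SMModel m) 𝓘(ℝ, G) k z k')
    (hl : HasMFDerivAt 𝓘(ℝ, SMModel m) 𝓘(ℝ, G') l z l') :
    HasMFDerivAt 𝓘(ℝ, SMModel m) 𝓘(ℝ, G × G') (fun w => (k w, l w)) z (k'.prod l') :=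
  ⟨hk.1.prodMk hl.1, hk.2.prodMk hl.2⟩

theorem dAlong_add (hf : MDifferentiableAt 𝓘(ℝ, SMModel m) 𝓘(ℝ, ℝ) f z)
    (hg : MDifferentiableAt 𝓘(ℝ, SMModel m) 𝓘(ℝ, ℝ) g z) (X : TSM z) :
    dAlong (fun w => f w + g w) z X = dAlong f z X + dAlong g z X :=
  congrArg (fun T : SMModel m →L[ℝ] ℝ => T X) (mvfderiv_add hf hg)

theorem dAlong_mul (hf : MDifferentiableAt 𝓘(ℝ, SMModel m) 𝓘(ℝ, ℝ) f z)
    (hg : MDifferentiableAt 𝓘(ℝ, SMModel m) 𝓘(ℝ, ℝ) g z) (X : TSM z) :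
    dAlong (fun w => f w * g w) z X = f z * dAlong g z X + g z * dAlong f z X := by
  have := congrArg (fun T : SMModel m →L[ℝ] ℝ => T X) (mvfderiv_mul hf hg)
  exact this

theorem dAlong_congr (h : f =ᶠ[𝓝 z] g) (X : TSM z) : dAlong f z X = dAlong g z X := by
  rw [dAlong, dAlong, mvfderiv, mvfderiv, h.mfderiv_eq]
  rfl

theorem dAlong_const (c : ℝ) (X : TSM z) : dAlong (fun _ => c) z X = 0 := by
  have := congrArg (fun T : SMModel m →L[ℝ] ℝ => T X) (mvfderiv_const (I := 𝓘(ℝ, SMModel m)) c (x := z))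
  exact this

end Along

namespace FinslerStructure
variable {m : ℕ} {M : Type*} [TopologicalSpace M] [ChartedSpace (Base m) M]
  [IsManifold (𝓡 (m + 1)) ∞ M] (F : FinslerStructure m M) {X Y U : VField m M}
  {s t : PullSection m M} {z : SphereBundle m M}

theorem eventually_sasaki_eq (X Y : VField m M) (z : SphereBundle m M) :
    (fun w => F.sasaki w (X w) (Y w)) =ᶠ[𝓝 z]
      (fun t : (Base m × Base m) × (Base m × Base m) × (Base m × Base m) =>
      gForm (F.loc (proj m M z)) t.1 t.2.1.1 t.2.2.1 +
        hForm (F.loc (proj m M z)) t.1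
          ((F.loc (proj m M z) t.1)⁻¹ • (t.2.1.2 + nonlinMap (F.loc (proj m M z)) t.1 t.2.1.1))
          ((F.loc (proj m M z) t.1)⁻¹ • (t.2.2.2 + nonlinMap (F.loc (proj m M z)) t.1 t.2.2.1))) ∘
      fun w => (natCoord (proj m M z) w,
        (dCoord (proj m M z) w (X w), dCoord (proj m M z) w (Y w))) := by
  filter_upwards [coordDomain_mem_nhds (mem_coordDomain_self z)] with w hw
  rw [F.sasaki_apply hw]
  rfl

theorem contMDiffAt_sasaki (hX : SmoothAt X z) (hY : SmoothAt Y z) :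
    ContMDiffAt 𝓘(ℝ, SMModel m) 𝓘(ℝ, ℝ) ∞ (fun w => F.sasaki w (X w) (Y w)) z := by
  have hz := mem_coordDomain_self z
  refine ContMDiffAt.congr_of_eventuallyEq ?_ (F.eventually_sasaki_eq X Y z)
  exact ContMDiffAt.comp z ((F.isLocalFinsler _).contDiffAt_sasaki (natCoord_mem hz) _).contMDiffAt
    (((contMDiffOn_natCoord _).contMDiffAt (coordDomain_mem_nhds hz)).prodMk_space
      (((smoothAt_iff hz).1 hX).prodMk_space ((smoothAt_iff hz).1 hY)))

theorem mdifferentiableAt_sasaki (hX : DiffAt X z) (hY : DiffAt Y z) :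
    MDifferentiableAt 𝓘(ℝ, SMModel m) 𝓘(ℝ, ℝ) (fun w => F.sasaki w (X w) (Y w)) z := by
  have hz := mem_coordDomain_self z
  refine MDifferentiableAt.congr_of_eventuallyEq ?_ (F.eventually_sasaki_eq X Y z)
  exact MDifferentiableAt.comp z
    (((F.isLocalFinsler _).contDiffAt_sasaki (natCoord_mem hz) _).differentiableAt
      (by simp)).mdifferentiableAt
    (((hasMFDerivAt_natCoord hz).mdifferentiableAt).prodMk_space
      (((diffAt_iff hz).1 hX).prodMk_space ((diffAt_iff hz).1 hY)))

theorem eventually_fund_eq (s t : PullSection m M) (z : SphereBundle m M) :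
    (fun w => F.fund w (s w) (t w)) =ᶠ[𝓝 z]
      (fun r : (Base m × Base m) × (Base m × Base m) =>
        gForm (F.loc (proj m M z)) r.1 r.2.1 r.2.2) ∘
      fun w => (natCoord (proj m M z) w,
        (pullCoord (proj m M z) s w, pullCoord (proj m M z) t w)) := by
  filter_upwards [coordDomain_mem_nhds (mem_coordDomain_self z)] with w hw
  rw [F.fund_apply hw]
  rfl

theorem contMDiffAt_fund (hs : PullSmoothAt s z) (ht : PullSmoothAt t z) :
    ContMDiffAt 𝓘(ℝ, SMModel m) 𝓘(ℝ, ℝ) ∞ (fun w => F.fund w (s w) (t w)) z := by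
  have hz := mem_coordDomain_self z
  refine ContMDiffAt.congr_of_eventuallyEq ?_ (F.eventually_fund_eq s t z)
  exact ContMDiffAt.comp z ((F.isLocalFinsler _).contDiffAt_gForm (natCoord_mem hz) _).contMDiffAt
    (((contMDiffOn_natCoord _).contMDiffAt (coordDomain_mem_nhds hz)).prodMk_space
      ((pullSmoothAt_iff.1 hs).prodMk_space (pullSmoothAt_iff.1 ht)))

/-- The derivative of `g(s, t)` in natural coordinates. -/
theorem dAlong_fund (hs : PullDiffAt s z) (ht : PullDiffAt t z) (X : TSM z) :
    dAlong (fun w => F.fund w (s w) (t w)) z X =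
      fderiv ℝ (fun r => gForm (F.loc (proj m M z)) r (pullCoord (proj m M z) s z)
        (pullCoord (proj m M z) t z)) (natCoord (proj m M z) z) (dCoord (proj m M z) z X) +
      gForm (F.loc (proj m M z)) (natCoord (proj m M z) z)
        (mvfderiv 𝓘(ℝ, SMModel m) (pullCoord (proj m M z) s) z X) (pullCoord (proj m M z) t z) +
      gForm (F.loc (proj m M z)) (natCoord (proj m M z) z)
        (pullCoord (proj m M z) s z) (mvfderiv 𝓘(ℝ, SMModel m) (pullCoord (proj m M z) t) z X) := by
  have hz := mem_coordDomain_self z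
  obtain ⟨T, hT, hT'⟩ := (F.isLocalFinsler (proj m M z)).exists_hasFDerivAt_gForm (natCoord_mem hz)
    (pullCoord (proj m M z) s z) (pullCoord (proj m M z) t z)
  have h1 := (pullDiffAt_iff.1 hs).hasMFDerivAt
  have h2 := (pullDiffAt_iff.1 ht).hasMFDerivAt
  have h3 := HasMFDerivAt.comp z (f := fun w => (natCoord (proj m M z) w,
      (pullCoord (proj m M z) s w, pullCoord (proj m M z) t w))) hT.hasMFDerivAt
    (hasMFDerivAt_prodMk_space (hasMFDerivAt_natCoord hz) (hasMFDerivAt_prodMk_space h1 h2))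
  have h4 := (h3.congr_of_eventuallyEq (F.eventually_fund_eq s t z)).mfderiv
  rw [← hT']
  exact congrArg (fun S : SMModel m →L[ℝ] ℝ => S X) h4

theorem eventually_horProj_eq (U : VField m M) (z : SphereBundle m M) :
    ∀ᶠ w in 𝓝 z, F.horProj w (U w) = ofCoord (proj m M z) w
      ((dCoord (proj m M z) w (U w)).1,
        -nonlinMap (F.loc (proj m M z)) (natCoord (proj m M z) w) (dCoord (proj m M z) w (U w)).1) := by
  filter_upwards [coordDomain_mem_nhds (mem_coordDomain_self z)] with w hw using F.horProj_apply hw _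

theorem contDiffAt_horCoord {f : Base m × Base m → ℝ} {O : Set (Base m)} (hf : IsLocalFinsler f O)
    {q : Base m × Base m} (hq : q ∈ slit O) (ξ : Base m × Base m) :
    ContDiffAt ℝ ∞ (fun t : (Base m × Base m) × (Base m × Base m) =>
      (t.2.1, -nonlinMap f t.1 t.2.1)) (q, ξ) := by
  have h2 : ContDiffAt ℝ ∞ (fun t : (Base m × Base m) × (Base m × Base m) => nonlinMap f t.1) (q, ξ) :=
    ContDiffAt.comp (q, ξ) (g := nonlinMap f)
      (hf.contDiffOn_nonlinMap.contDiffAt (hf.slit_mem_nhds hq)) contDiffAt_fst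
  exact (contDiff_fst.comp contDiff_snd).contDiffAt.prodMk
    (h2.clm_apply (contDiff_fst.comp contDiff_snd).contDiffAt).neg

theorem smoothAt_horProj (hU : SmoothAt U z) : SmoothAt (fun w => F.horProj w (U w)) z := by
  have hz := mem_coordDomain_self z
  refine SmoothAt.congr (smoothAt_ofCoord hz ?_) (F.eventually_horProj_eq U z)
  exact ContMDiffAt.comp z (contDiffAt_horCoord (F.isLocalFinsler _) (natCoord_mem hz) _).contMDiffAt
    (((contMDiffOn_natCoord _).contMDiffAt (coordDomain_mem_nhds hz)).prodMk_space
      ((smoothAt_iff hz).1 hU))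

theorem smoothAt_vertProj (hU : SmoothAt U z) : SmoothAt (fun w => F.vertProj w (U w)) z :=
  (hU.sub (F.smoothAt_horProj hU)).congr (.of_forall fun w => F.vertProj_apply w _)

end FinslerStructure

/-! ### Algebra of differentiable vector fields -/

section FieldAlgebra
variable {m : ℕ} {M : Type*} [TopologicalSpace M] [ChartedSpace (Base m) M]
  [IsManifold (𝓡 (m + 1)) ∞ M] {X X' Y : VField m M} {f : SphereBundle m M → ℝ}
  {z : SphereBundle m M}

theorem DiffAt.add (hX : DiffAt X z) (hY : DiffAt Y z) : DiffAt (X + Y) z :=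
  mdifferentiableAt_add_section hX hY

theorem DiffAt.smul (hf : MDifferentiableAt 𝓘(ℝ, SMModel m) 𝓘(ℝ, ℝ) f z) (hX : DiffAt X z) :
    DiffAt (f • X) z := hf.smul_section hX

theorem isManifold_two : IsManifold 𝓘(ℝ, SMModel m) 2 (SphereBundle m M) :=
  IsManifold.of_le (n := ∞) two_le_infty

theorem lieBr_swap (X Y : VField m M) (z : SphereBundle m M) : lieBr X Y z = -lieBr Y X z :=
  VectorField.mlieBracket_swap_apply

theorem lieBr_add_left (hX : DiffAt X z) (hX' : DiffAt X' z) :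
    lieBr (X + X') Y z = lieBr X Y z + lieBr X' Y z :=
  have := isManifold_two (m := m) (M := M)
  VectorField.mlieBracket_add_left hX hX'

theorem lieBr_smul_left (hf : MDifferentiableAt 𝓘(ℝ, SMModel m) 𝓘(ℝ, ℝ) f z) (hX : DiffAt X z) :
    lieBr (f • X) Y z = -dAlong f z (Y z) • X z + f z • lieBr X Y z :=
  have := isManifold_two (m := m) (M := M)
  VectorField.mlieBracket_smul_left hf hX

theorem lieBr_add_right (hX : DiffAt X z) (hX' : DiffAt X' z) :
    lieBr Y (X + X') z = lieBr Y X z + lieBr Y X' z := by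
  rw [lieBr_swap, lieBr_add_left hX hX', lieBr_swap X, lieBr_swap X', neg_add, neg_neg, neg_neg]

theorem lieBr_smul_right (hf : MDifferentiableAt 𝓘(ℝ, SMModel m) 𝓘(ℝ, ℝ) f z) (hX : DiffAt X z) :
    lieBr Y (f • X) z = dAlong f z (Y z) • X z + f z • lieBr Y X z := by
  rw [lieBr_swap, lieBr_smul_left hf hX, lieBr_swap X]
  module

end FieldAlgebra

/-! ### The Levi-Civita connection of the Sasaki-type metric -/

namespace FinslerStructure
variable {m : ℕ} {M : Type*} [TopologicalSpace M] [ChartedSpace (Base m) M]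
  [IsManifold (𝓡 (m + 1)) ∞ M] (F : FinslerStructure m M) {X X' Y Y' Z Z' : VField m M}
  {f : SphereBundle m M → ℝ} {z : SphereBundle m M}

theorem sasaki_add_left (z : SphereBundle m M) (u u' v : TSM z) :
    F.sasaki z (u + u') v = F.sasaki z u v + F.sasaki z u' v := LinearMap.BilinForm.add_left u u' v

theorem sasaki_add_right (z : SphereBundle m M) (u v v' : TSM z) :
    F.sasaki z u (v + v') = F.sasaki z u v + F.sasaki z u v' := LinearMap.BilinForm.add_right u v v'

theorem sasaki_smul_left (z : SphereBundle m M) (c : ℝ) (u v : TSM z) :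
    F.sasaki z (c • u) v = c * F.sasaki z u v := LinearMap.BilinForm.smul_left c u v

theorem sasaki_smul_right (z : SphereBundle m M) (c : ℝ) (u v : TSM z) :
    F.sasaki z u (c • v) = c * F.sasaki z u v := LinearMap.BilinForm.smul_right c u v

theorem dAlong_sasaki_add_left (hX : DiffAt X z) (hX' : DiffAt X' z) (hY : DiffAt Y z) (v : TSM z) :
    dAlong (fun w => F.sasaki w ((X + X') w) (Y w)) z v =
      dAlong (fun w => F.sasaki w (X w) (Y w)) z v +
        dAlong (fun w => F.sasaki w (X' w) (Y w)) z v := by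
  rw [← dAlong_add (F.mdifferentiableAt_sasaki hX hY) (F.mdifferentiableAt_sasaki hX' hY)]
  congr 1
  ext w
  exact F.sasaki_add_left w _ _ _

theorem dAlong_sasaki_smul_left (hf : MDifferentiableAt 𝓘(ℝ, SMModel m) 𝓘(ℝ, ℝ) f z)
    (hX : DiffAt X z) (hY : DiffAt Y z) (v : TSM z) :
    dAlong (fun w => F.sasaki w ((f • X) w) (Y w)) z v =
      f z * dAlong (fun w => F.sasaki w (X w) (Y w)) z v +
        dAlong f z v * F.sasaki z (X z) (Y z) := by
  rw [mul_comm (dAlong f z v), ← dAlong_mul hf (F.mdifferentiableAt_sasaki hX hY)]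
  congr 1
  ext w
  exact F.sasaki_smul_left w _ _ _

theorem dAlong_sasaki_symm (X Y : VField m M) (z : SphereBundle m M) (v : TSM z) :
    dAlong (fun w => F.sasaki w (X w) (Y w)) z v = dAlong (fun w => F.sasaki w (Y w) (X w)) z v := by
  congr 1
  ext w
  exact F.sasaki_symm w _ _

/-- The right-hand side of the Koszul formula for `2⟨∇_X Y, Z⟩`. -/
def koszul (X Y Z : VField m M) (z : SphereBundle m M) : ℝ :=
  dAlong (fun w => F.sasaki w (Y w) (Z w)) z (X z) + dAlong (fun w => F.sasaki w (X w) (Z w)) z (Y z) -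
    dAlong (fun w => F.sasaki w (X w) (Y w)) z (Z z) + F.sasaki z (lieBr X Y z) (Z z) -
    F.sasaki z (lieBr X Z z) (Y z) - F.sasaki z (lieBr Y Z z) (X z)

theorem koszul_add_first (hX : DiffAt X z) (hX' : DiffAt X' z) (hY : DiffAt Y z) (hZ : DiffAt Z z) :
    F.koszul (X + X') Y Z z = F.koszul X Y Z z + F.koszul X' Y Z z := by
  have e : ∀ k : SphereBundle m M → ℝ, dAlong k z ((X + X') z) = dAlong k z (X z) + dAlong k z (X' z) :=
    fun k => map_add (mvfderiv 𝓘(ℝ, SMModel m) k z) _ _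
  have e' : (X + X') z = X z + X' z := rfl
  simp only [koszul, e, F.dAlong_sasaki_add_left hX hX' hZ, F.dAlong_sasaki_add_left hX hX' hY,
    lieBr_add_left hX hX']
  simp only [e', sasaki_add_left, sasaki_add_right]
  ring

theorem koszul_smul_first (hf : MDifferentiableAt 𝓘(ℝ, SMModel m) 𝓘(ℝ, ℝ) f z) (hX : DiffAt X z)
    (hY : DiffAt Y z) (hZ : DiffAt Z z) : F.koszul (f • X) Y Z z = f z * F.koszul X Y Z z := by
  have e : ∀ k : SphereBundle m M → ℝ, dAlong k z ((f • X) z) = f z * dAlong k z (X z) :=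
    fun k => map_smul (mvfderiv 𝓘(ℝ, SMModel m) k z) _ _
  have e' : (f • X) z = f z • X z := rfl
  simp only [koszul, e, F.dAlong_sasaki_smul_left hf hX hZ, F.dAlong_sasaki_smul_left hf hX hY,
    lieBr_smul_left hf hX]
  simp only [e', sasaki_add_left, sasaki_smul_left, sasaki_smul_right]
  ring

/-- The Koszul formula defines a metric connection. -/
theorem koszul_symm (X Y Z : VField m M) (z : SphereBundle m M) :
    F.koszul X Y Z z + F.koszul X Z Y z = 2 * dAlong (fun w => F.sasaki w (Y w) (Z w)) z (X z) := by
  rw [koszul, koszul, F.dAlong_sasaki_symm Z Y, lieBr_swap Z Y, LinearMap.BilinForm.neg_left]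
  ring

/-- The Koszul formula defines a torsion-free connection. -/
theorem koszul_sub (X Y Z : VField m M) (z : SphereBundle m M) :
    F.koszul X Y Z z - F.koszul Y X Z z = 2 * F.sasaki z (lieBr X Y z) (Z z) := by
  rw [koszul, koszul, F.dAlong_sasaki_symm Y X, lieBr_swap Y X, LinearMap.BilinForm.neg_left]
  ring

/-- The Koszul expression with its first and last arguments interchanged; it reduces linearity in `Z`
to linearity in `X`. -/
theorem koszul_reverse (X Y Z : VField m M) (z : SphereBundle m M) :
    F.koszul X Y Z z = 2 * F.sasaki z (lieBr X Y z) (Z z) +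
      2 * dAlong (fun w => F.sasaki w (Z w) (X w)) z (Y z) - F.koszul Z Y X z -
      2 * F.sasaki z (lieBr Y Z z) (X z) := by
  have h1 := F.koszul_sub X Y Z z
  have h2 := F.koszul_symm Y X Z z
  have h3 := F.koszul_sub Y Z X z
  rw [F.dAlong_sasaki_symm X Z] at h2
  linarith

theorem koszul_add_third (hX : DiffAt X z) (hY : DiffAt Y z) (hZ : DiffAt Z z) (hZ' : DiffAt Z' z) :
    F.koszul X Y (Z + Z') z = F.koszul X Y Z z + F.koszul X Y Z' z := by
  have e' : (Z + Z') z = Z z + Z' z := rfl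
  rw [F.koszul_reverse X Y (Z + Z'), F.koszul_reverse X Y Z, F.koszul_reverse X Y Z',
    F.koszul_add_first hZ hZ' hY hX, F.dAlong_sasaki_add_left hZ hZ' hX, lieBr_add_right hZ hZ', e',
    sasaki_add_right, sasaki_add_left]
  ring

theorem koszul_smul_third (hf : MDifferentiableAt 𝓘(ℝ, SMModel m) 𝓘(ℝ, ℝ) f z) (hX : DiffAt X z)
    (hY : DiffAt Y z) (hZ : DiffAt Z z) : F.koszul X Y (f • Z) z = f z * F.koszul X Y Z z := by
  have e' : (f • Z) z = f z • Z z := rfl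
  rw [F.koszul_reverse X Y (f • Z), F.koszul_reverse X Y Z, F.koszul_smul_first hf hZ hY hX,
    F.dAlong_sasaki_smul_left hf hZ hX, lieBr_smul_right hf hZ, e', sasaki_smul_right,
    sasaki_add_left, sasaki_smul_left, sasaki_smul_left]
  ring

theorem koszul_add_second (hX : DiffAt X z) (hY : DiffAt Y z) (hY' : DiffAt Y' z) (hZ : DiffAt Z z) :
    F.koszul X (Y + Y') Z z = F.koszul X Y Z z + F.koszul X Y' Z z := by
  have h := F.koszul_symm X (Y + Y') Z z
  have h1 := F.koszul_symm X Y Z z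
  have h2 := F.koszul_symm X Y' Z z
  rw [F.koszul_add_third hX hZ hY hY', F.dAlong_sasaki_add_left hY hY' hZ] at h
  linarith

theorem koszul_smul_second (hf : MDifferentiableAt 𝓘(ℝ, SMModel m) 𝓘(ℝ, ℝ) f z) (hX : DiffAt X z)
    (hY : DiffAt Y z) (hZ : DiffAt Z z) :
    F.koszul X (f • Y) Z z = f z * F.koszul X Y Z z +
      2 * (dAlong f z (X z) * F.sasaki z (Y z) (Z z)) := by
  have h := F.koszul_symm X (f • Y) Z z
  have h1 := F.koszul_symm X Y Z z
  rw [F.koszul_smul_third hf hX hZ hY, F.dAlong_sasaki_smul_left hf hY hZ] at h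
  linear_combination h - f z * h1

/-- For a differentiable field `Y`, the Koszul expression is tensorial in `X` and `Z`, hence it is
represented by an endomorphism `X ↦ ∇_X Y` of the tangent space. -/
theorem exists_koszul_map (hY : DiffAt Y z) : ∃ T : TSM z →L[ℝ] TSM z,
    ∀ X Z : VField m M, DiffAt X z → DiffAt Z z →
      2 * F.sasaki z (T (X z)) (Z z) = F.koszul X Y Z z := by
  have i1 : IsManifold 𝓘(ℝ, SMModel m) 2 (SphereBundle m M) := isManifold_two
  have i2 : FiniteDimensional ℝ (TSM z) := inferInstanceAs (FiniteDimensional ℝ (SMModel m))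
  have h1 : ∀ Z : VField m M, DiffAt Z z →
      TensorialAt 𝓘(ℝ, SMModel m) (SMModel m) (fun X : VField m M => F.koszul X Y Z z) z :=
    fun Z hZ => ⟨fun hf hX => F.koszul_smul_first hf hX hY hZ,
      fun hX hX' => F.koszul_add_first hX hX' hY hZ⟩
  have h2 : ∀ X : VField m M, DiffAt X z →
      TensorialAt 𝓘(ℝ, SMModel m) (SMModel m) (fun Z : VField m M => F.koszul X Y Z z) z :=
    fun X hX => ⟨fun hf hZ => F.koszul_smul_third hf hX hY hZ,
      fun hZ hZ' => F.koszul_add_third hX hY hZ hZ'⟩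
  let K := TensorialAt.mkHom₂ (fun X Z : VField m M => F.koszul X Y Z z) z h1 h2
  have hK : ∀ X Z : VField m M, DiffAt X z → DiffAt Z z → K (X z) (Z z) = F.koszul X Y Z z :=
    fun X Z hX hZ => TensorialAt.mkHom₂_apply h1 h2 hX hZ
  let L : TSM z →ₗ[ℝ] Module.Dual ℝ (TSM z) :=
    { toFun := fun v => (K v).toLinearMap
      map_add' := fun v w => by ext; simp
      map_smul' := fun c v => by ext; simp }
  let T : TSM z →ₗ[ℝ] TSM z :=
    (1 / 2 : ℝ) • (((F.sasaki z).toDual (F.nondegenerate_sasaki z)).symm.toLinearMap ∘ₗ L)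
  let T' : SMModel m →L[ℝ] SMModel m := LinearMap.toContinuousLinearMap (E := SMModel m) (F' := SMModel m) T
  refine ⟨T', fun X Z hX hZ => ?_⟩
  have h3 : F.sasaki z (T (X z)) (Z z) = 1 / 2 * K (X z) (Z z) := by
    change F.sasaki z ((1 / 2 : ℝ) • ((F.sasaki z).toDual (F.nondegenerate_sasaki z)).symm (L (X z)))
      (Z z) = _
    rw [sasaki_smul_left, LinearMap.BilinForm.apply_toDual_symm_apply]
    rfl
  rw [← hK X Z hX hZ]
  refine (congrArg (fun r => 2 * r) h3).trans ?_
  ring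

theorem exists_diff_extension (z : SphereBundle m M) (v : TSM z) :
    ∃ X : VField m M, X z = v ∧ DiffAt X z := by
  obtain ⟨X, h1, h2⟩ := exists_smooth_extension z v
  exact ⟨X, h1, (h2 z (mem_coordDomain_self z)).diffAt⟩

open Classical in
/-- The covariant derivative of the Levi-Civita connection, defined by the Koszul formula at the
points where the field is differentiable, and zero elsewhere. -/

def leviCivitaMap (Y : VField m M) (z : SphereBundle m M) : TSM z →L[ℝ] TSM z :=
  if h : DiffAt Y z then (F.exists_koszul_map h).choose else 0

theorem two_mul_sasaki_leviCivitaMap (hX : DiffAt X z) (hY : DiffAt Y z) (hZ : DiffAt Z z) :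
    2 * F.sasaki z (F.leviCivitaMap Y z (X z)) (Z z) = F.koszul X Y Z z := by
  rw [leviCivitaMap, dif_pos hY]
  exact (F.exists_koszul_map hY).choose_spec X Z hX hZ

/-- The Levi-Civita connection of the Sasaki-type metric. -/
def leviCivita : SMConn m M where
  toFun := F.leviCivitaMap
  isCovariantDerivativeOnUniv :=
    { add := fun {Y Y'} z hY hY' _ => by
        ext1 v
        obtain ⟨X, rfl, hX⟩ := exists_diff_extension z v
        refine F.sasaki_ext fun u => ?_
        obtain ⟨Z, rfl, hZ⟩ := exists_diff_extension z u
        have h1 := F.two_mul_sasaki_leviCivitaMap hX (DiffAt.add hY hY') hZ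
        have h2 := F.two_mul_sasaki_leviCivitaMap hX hY hZ
        have h3 := F.two_mul_sasaki_leviCivitaMap hX hY' hZ
        rw [F.koszul_add_second hX hY hY' hZ] at h1
        have h4 : F.sasaki z (F.leviCivitaMap Y z (X z) + F.leviCivitaMap Y' z (X z)) (Z z) =
            F.sasaki z (F.leviCivitaMap Y z (X z)) (Z z) +
              F.sasaki z (F.leviCivitaMap Y' z (X z)) (Z z) := F.sasaki_add_left z _ _ _
        refine Eq.trans ?_ h4.symm
        linarith
      leibniz := fun {Y f} z hY hf _ => by
        ext1 v
        obtain ⟨X, rfl, hX⟩ := exists_diff_extension z v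
        refine F.sasaki_ext fun u => ?_
        obtain ⟨Z, rfl, hZ⟩ := exists_diff_extension z u
        have h1 := F.two_mul_sasaki_leviCivitaMap hX (DiffAt.smul hf hY) hZ
        have h2 := F.two_mul_sasaki_leviCivitaMap hX hY hZ
        rw [F.koszul_smul_second hf hX hY hZ] at h1
        have h3 : F.sasaki z (f z • F.leviCivitaMap Y z (X z) + dAlong f z (X z) • Y z) (Z z) =
            f z * F.sasaki z (F.leviCivitaMap Y z (X z)) (Z z) +
              dAlong f z (X z) * F.sasaki z (Y z) (Z z) := by
          rw [sasaki_add_left, sasaki_smul_left, sasaki_smul_left]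
        refine Eq.trans ?_ h3.symm
        linear_combination h1 / 2 - f z / 2 * h2 }

theorem isLeviCivita_leviCivita : F.IsLeviCivita F.leviCivita where
  torsion_free := by
    have := isManifold_two (m := m) (M := M)
    refine (CovariantDerivative.torsion_eq_zero_iff _).2 fun {X Y z} hX hY => ?_
    refine F.sasaki_ext fun u => ?_
    obtain ⟨Z, rfl, hZ⟩ := exists_diff_extension z u
    have h1 := F.two_mul_sasaki_leviCivitaMap hX hY hZ
    have h2 := F.two_mul_sasaki_leviCivitaMap hY hX hZ
    have h3 := F.koszul_sub X Y Z z
    rw [LinearMap.BilinForm.sub_left]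
    change F.sasaki z (F.leviCivitaMap Y z (X z)) (Z z) - F.sasaki z (F.leviCivitaMap X z (Y z)) (Z z) =
      F.sasaki z (lieBr X Y z) (Z z)
    linarith
  metric z X Y hX hY v := by
    obtain ⟨W, rfl, hW⟩ := exists_diff_extension z v
    have h1 := F.two_mul_sasaki_leviCivitaMap hW hX hY
    have h2 := F.two_mul_sasaki_leviCivitaMap hW hY hX
    have h3 := F.koszul_symm W X Y z
    rw [F.sasaki_symm z (X z)]
    change _ = F.sasaki z (F.leviCivitaMap X z (W z)) (Y z) +
      F.sasaki z (F.leviCivitaMap Y z (W z)) (X z)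
    linarith

theorem IsLeviCivita.sub_eq_lieBr {nab : SMConn m M} (h : F.IsLeviCivita nab) (hX : DiffAt X z)
    (hY : DiffAt Y z) : nab Y z (X z) - nab X z (Y z) = lieBr X Y z :=
  have := isManifold_two (m := m) (M := M)
  (CovariantDerivative.torsion_eq_zero_iff nab).1 h.torsion_free hX hY

end FinslerStructure

/-! ### The Chern connection -/

namespace IsLocalFinsler
variable {m : ℕ} {f : Base m × Base m → ℝ} {O : Set (Base m)} (hf : IsLocalFinsler f O)
  {q : Base m × Base m}
include hf

theorem differentiableAt_gForm (hq : q ∈ slit O) (a b : Base m) :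
    DifferentiableAt ℝ (fun r => gForm f r a b) q :=
  ((hf.contDiffOn_gForm a b).contDiffAt (hf.slit_mem_nhds hq)).differentiableAt (by simp)

theorem fderiv_gForm_add_left (hq : q ∈ slit O) (a a' b : Base m) (ξ : Base m × Base m) :
    fderiv ℝ (fun r => gForm f r (a + a') b) q ξ =
      fderiv ℝ (fun r => gForm f r a b) q ξ + fderiv ℝ (fun r => gForm f r a' b) q ξ := by
  simp only [gForm_add_left]
  rw [fderiv_fun_add (hf.differentiableAt_gForm hq _ _) (hf.differentiableAt_gForm hq _ _),
    _root_.add_apply]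

theorem fderiv_gForm_smul_left (hq : q ∈ slit O) (c : ℝ) (a b : Base m) (ξ : Base m × Base m) :
    fderiv ℝ (fun r => gForm f r (c • a) b) q ξ = c * fderiv ℝ (fun r => gForm f r a b) q ξ := by
  simp only [gForm_smul_left]
  rw [fderiv_const_mul (hf.differentiableAt_gForm hq _ _), _root_.smul_apply, smul_eq_mul]

theorem gForm_ext (hq : q ∈ slit O) {a a' : Base m} (h : ∀ b, gForm f q a b = gForm f q a' b) :
    a = a' := by
  rw [← sub_eq_zero]
  refine hf.gForm_eq_zero hq fun b => ?_
  rw [sub_eq_add_neg, ← neg_one_smul ℝ a', gForm_add_left, gForm_smul_left, h]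
  ring

/-- The symmetric Christoffel symbols of the metric `g` with respect to the horizontal derivatives
`a ↦ (a, -N a)`. -/
theorem exists_christoffel (hq : q ∈ slit O) (N : Base m →L[ℝ] Base m) :
    ∃ Γ : Base m →ₗ[ℝ] Base m →ₗ[ℝ] Base m, (∀ s a, Γ s a = Γ a s) ∧
      ∀ s t a, gForm f q (Γ s a) t + gForm f q s (Γ t a) =
        fderiv ℝ (fun r => gForm f r s t) q (a, -N a) := by
  let T : Base m → Base m → Base m → ℝ := fun a s t => fderiv ℝ (fun r => gForm f r s t) q (a, -N a)
  have hT : ∀ a s t, T a s t = T a t s := fun a s t => by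
    simp only [T, hf.fderiv_gForm_symm hq s t]
  have add1 : ∀ a a' s t, T (a + a') s t = T a s t + T a' s t := fun a a' s t => by
    simp only [T]
    rw [← map_add, Prod.mk_add_mk, map_add, neg_add]
  have smul1 : ∀ (c : ℝ) a s t, T (c • a) s t = c * T a s t := fun c a s t => by
    simp only [T]
    rw [← smul_eq_mul, ← map_smul, Prod.smul_mk, map_smul, smul_neg]
  have add2 : ∀ a s s' t, T a (s + s') t = T a s t + T a s' t := fun a s s' t =>
    hf.fderiv_gForm_add_left hq _ _ _ _
  have smul2 : ∀ (c : ℝ) a s t, T a (c • s) t = c * T a s t := fun c a s t =>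
    hf.fderiv_gForm_smul_left hq _ _ _ _
  have add3 : ∀ a s t t', T a s (t + t') = T a s t + T a s t' := fun a s t t' => by
    rw [hT, add2, hT a t, hT a t']
  have smul3 : ∀ (c : ℝ) a s t, T a s (c • t) = c * T a s t := fun c a s t => by
    rw [hT, smul2, hT a t]
  have hex : ∀ s a, ∃ u, ∀ t, gForm f q u t = 1 / 2 * (T a s t + T s a t - T t a s) := fun s a => by
    let φ : Base m →ₗ[ℝ] ℝ :=
      { toFun := fun t => 1 / 2 * (T a s t + T s a t - T t a s)
        map_add' := fun t t' => by rw [add3, add3, add1]; ring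
        map_smul' := fun c t => by rw [smul3, smul3, smul1, RingHom.id_apply, smul_eq_mul]; ring }
    exact ⟨((gBilin f q).toDual (hf.nondegenerate_gBilin hq)).symm φ, fun t =>
      LinearMap.BilinForm.apply_toDual_symm_apply (hB := hf.nondegenerate_gBilin hq) φ t⟩
  choose Γ hΓ using hex
  refine ⟨LinearMap.mk₂ ℝ Γ (fun s s' a => ?_) (fun c s a => ?_) (fun s a a' => ?_)
    (fun c s a => ?_), fun s a => ?_, fun s t a => ?_⟩
  · refine hf.gForm_ext hq fun t => ?_
    rw [gForm_add_left, hΓ, hΓ, hΓ, add2, add1, add3]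
    ring
  · refine hf.gForm_ext hq fun t => ?_
    rw [gForm_smul_left, hΓ, hΓ, smul2, smul1, smul3]
    ring
  · refine hf.gForm_ext hq fun t => ?_
    rw [gForm_add_left, hΓ, hΓ, hΓ, add1, add2, add2]
    ring
  · refine hf.gForm_ext hq fun t => ?_
    rw [gForm_smul_left, hΓ, hΓ, smul1, smul2, smul2]
    ring
  · refine hf.gForm_ext hq fun t => ?_
    rw [LinearMap.mk₂_apply, LinearMap.mk₂_apply, hΓ, hΓ, hT t a s]
    ring
  · rw [LinearMap.mk₂_apply, LinearMap.mk₂_apply, hf.gForm_symm hq s, hΓ, hΓ, hT a t s]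
    change _ = T a s t
    ring

end IsLocalFinsler

namespace FinslerStructure
variable {m : ℕ} {M : Type*} [TopologicalSpace M] [ChartedSpace (Base m) M]
  [IsManifold (𝓡 (m + 1)) ∞ M] (F : FinslerStructure m M)
  {s t : PullSection m M} {z : SphereBundle m M}

theorem exists_christoffel (z : SphereBundle m M) :
    ∃ Γ : Base m →ₗ[ℝ] Base m →ₗ[ℝ] Base m, (∀ s a, Γ s a = Γ a s) ∧
      ∀ s t a, gForm (F.loc (proj m M z)) (natCoord (proj m M z) z) (Γ s a) t +
        gForm (F.loc (proj m M z)) (natCoord (proj m M z) z) s (Γ t a) =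
        fderiv ℝ (fun r => gForm (F.loc (proj m M z)) r s t) (natCoord (proj m M z) z)
          (a, -nonlinMap (F.loc (proj m M z)) (natCoord (proj m M z) z) a) :=
  (F.isLocalFinsler _).exists_christoffel (natCoord_mem (mem_coordDomain_self z)) _

/-- The symmetric connection coefficients of the Chern connection at `z`, in natural coordinates. -/
def christoffel (z : SphereBundle m M) : Base m →ₗ[ℝ] Base m →ₗ[ℝ] Base m :=
  (F.exists_christoffel z).choose

theorem christoffel_symm (z : SphereBundle m M) (s a : Base m) :
    F.christoffel z s a = F.christoffel z a s := (F.exists_christoffel z).choose_spec.1 s a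

theorem christoffel_metric (z : SphereBundle m M) (s t a : Base m) :
    gForm (F.loc (proj m M z)) (natCoord (proj m M z) z) (F.christoffel z s a) t +
        gForm (F.loc (proj m M z)) (natCoord (proj m M z) z) s (F.christoffel z t a) =
        fderiv ℝ (fun r => gForm (F.loc (proj m M z)) r s t) (natCoord (proj m M z) z)
          (a, -nonlinMap (F.loc (proj m M z)) (natCoord (proj m M z) z) a) :=
  (F.exists_christoffel z).choose_spec.2 s t a

theorem exists_chernMap (s : PullSection m M) (z : SphereBundle m M) :
    ∃ T : TSM z →L[ℝ] PullTM z, ∀ X, fiberCoord (proj m M z) (proj m M z) (T X) =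
      mvfderiv 𝓘(ℝ, SMModel m) (pullCoord (proj m M z) s) z X +
        F.christoffel z (pullCoord (proj m M z) s z) (dCoord (proj m M z) z X).1 := by
  have hb := fiberCoord_bijective (m := m) (mem_coordDomain_self z)
  let e := LinearEquiv.ofBijective (fiberCoord (m := m) (proj m M z) (proj m M z)).toLinearMap hb
  let D : SMModel m →ₗ[ℝ] Base m :=
    (mvfderiv 𝓘(ℝ, SMModel m) (pullCoord (proj m M z) s) z).toLinearMap +
      F.christoffel z (pullCoord (proj m M z) s z) ∘ₗ
        LinearMap.fst ℝ (Base m) (Base m) ∘ₗ (dCoord (proj m M z) z).toLinearMap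
  let T : SMModel m →L[ℝ] Base m := LinearMap.toContinuousLinearMap (E := SMModel m) (F' := Base m)
    (e.symm.toLinearMap ∘ₗ D)
  exact ⟨T, fun X => e.apply_symm_apply (D X)⟩

/-- The covariant derivative of the Chern connection, computed at `z` in the chart of `M` at `π z`. -/
def chernMap (s : PullSection m M) (z : SphereBundle m M) : TSM z →L[ℝ] PullTM z :=
  (F.exists_chernMap s z).choose

theorem fiberCoord_chernMap (s : PullSection m M) (z : SphereBundle m M) (X : TSM z) :
    fiberCoord (proj m M z) (proj m M z) (F.chernMap s z X) =
      mvfderiv 𝓘(ℝ, SMModel m) (pullCoord (proj m M z) s) z X +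
        F.christoffel z (pullCoord (proj m M z) s z) (dCoord (proj m M z) z X).1 :=
  (F.exists_chernMap s z).choose_spec X

/-- The Chern connection. -/
def chern : PullConnection m M where
  toFun := F.chernMap
  add s t z hs ht X := by
    have hb := fiberCoord_bijective (m := m) (mem_coordDomain_self z)
    apply hb.1
    have h1 := congrArg (fun T : SMModel m →L[ℝ] Base m => T X)
      (mvfderiv_add (pullDiffAt_iff.1 hs) (pullDiffAt_iff.1 ht))
    have h2 : pullCoord (proj m M z) (fun w => s w + t w) =
        pullCoord (proj m M z) s + pullCoord (proj m M z) t := by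
      ext1 w; exact map_add _ _ _
    have h3 : mvfderiv 𝓘(ℝ, SMModel m) (pullCoord (proj m M z) s + pullCoord (proj m M z) t) z X =
      mvfderiv 𝓘(ℝ, SMModel m) (pullCoord (proj m M z) s) z X +
        mvfderiv 𝓘(ℝ, SMModel m) (pullCoord (proj m M z) t) z X := h1
    rw [map_add, fiberCoord_chernMap, fiberCoord_chernMap, fiberCoord_chernMap, h2, h3, Pi.add_apply,
      map_add, LinearMap.add_apply]
    module
  leibniz f s z hf hs X := by
    have hb := fiberCoord_bijective (m := m) (mem_coordDomain_self z)
    apply hb.1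
    have h1 := congrArg (fun T : SMModel m →L[ℝ] Base m => T X)
      (mvfderiv_smul hf (pullDiffAt_iff.1 hs))
    have h2 : pullCoord (proj m M z) (fun w => f w • s w) = f • pullCoord (proj m M z) s := by
      ext1 w; exact map_smul _ _ _
    have h3 : mvfderiv 𝓘(ℝ, SMModel m) (f • pullCoord (proj m M z) s) z X =
      f z • mvfderiv 𝓘(ℝ, SMModel m) (pullCoord (proj m M z) s) z X +
        dAlong f z X • pullCoord (proj m M z) s z := h1
    rw [map_add, map_smul, map_smul, fiberCoord_chernMap, fiberCoord_chernMap, h2, h3, Pi.smul_apply',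
      map_smul, LinearMap.smul_apply, pullCoord]
    module

theorem mvfderiv_pullCoord_dproj {Y : VField m M} (hY : DiffAt Y z) (X : TSM z) :
    mvfderiv 𝓘(ℝ, SMModel m) (pullCoord (proj m M z) fun w => dproj w (Y w)) z X =
      (mvfderiv 𝓘(ℝ, SMModel m) (fun w => dCoord (proj m M z) w (Y w)) z X).1 := by
  have h1 := ((diffAt_iff (mem_coordDomain_self z)).1 hY).hasMFDerivAt
  have h2 := (hasFDerivAt_fst (𝕜 := ℝ) (p := dCoord (proj m M z) z (Y z))).hasMFDerivAt.comp z h1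
  have h3 := (h2.congr_of_eventuallyEq (eventually_pullCoord_dproj z Y)).mfderiv
  exact congrArg (fun T : SMModel m →L[ℝ] Base m => T X) h3

theorem isChern_chern : F.IsChern F.chern where
  torsion_free z X Y hX hY := by
    have hz := mem_coordDomain_self z
    apply (fiberCoord_bijective (m := m) hz).1
    change fiberCoord _ _ (F.chernMap _ z (X z) - F.chernMap _ z (Y z)) = _
    rw [← dCoord_fst hz, dCoord_lieBr hz hX.diffAt hY.diffAt, map_sub, fiberCoord_chernMap,
      fiberCoord_chernMap, mvfderiv_pullCoord_dproj hY.diffAt, mvfderiv_pullCoord_dproj hX.diffAt,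
      pullCoord_dproj hz, pullCoord_dproj hz, F.christoffel_symm z (dCoord _ z (Y z)).1,
      Prod.fst_sub]
    abel
  almost_metric z s t hs ht X := by
    have hz := mem_coordDomain_self z
    change _ - F.fund z (F.chernMap s z X) (t z) - F.fund z (s z) (F.chernMap t z X) = _
    rw [F.dAlong_fund hs.pullDiffAt ht.pullDiffAt, F.fund_apply hz, F.fund_apply hz,
      fiberCoord_chernMap, fiberCoord_chernMap, gForm_add_left, gForm_add_right, cartanTensor_apply]
    have h := F.christoffel_metric z (pullCoord (proj m M z) s z)
      (pullCoord (proj m M z) t z) (dCoord (proj m M z) z X).1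
    have h1 : dCoord (proj m M z) z X = ((dCoord (proj m M z) z X).1,
        -nonlinMap (F.loc (proj m M z)) (natCoord (proj m M z) z) (dCoord (proj m M z) z X).1) +
        F.loc (proj m M z) (natCoord (proj m M z) z) • (0, F.deltaVec (proj m M z) z X) := by
      refine Prod.ext (by simp) ?_
      rw [F.dCoord_snd hz, Prod.snd_add, Prod.smul_snd]
      exact sub_eq_neg_add _ _
    nth_rewrite 1 [h1]
    rw [map_add, map_smul, ← h, smul_eq_mul]
    simp only [pullCoord]
    ring

end FinslerStructure

/-! ### The Chern connection is the Bott connection -/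

namespace FinslerStructure
variable {m : ℕ} {M : Type*} [TopologicalSpace M] [ChartedSpace (Base m) M]
  [IsManifold (𝓡 (m + 1)) ∞ M] (F : FinslerStructure m M) {X Y Z U V W : VField m M}
  {z : SphereBundle m M}

/-- A metric and torsion-free expression is given by the Koszul formula. Only the six instances of these
properties that involve `X`, `Y`, `Z` are needed, so it applies to the Levi-Civita connection and, on
horizontal fields, to the Chern connection. -/
theorem koszul_unique (P : VField m M → VField m M → VField m M → ℝ)
    (m1 : P X Y Z + P X Z Y = dAlong (fun w => F.sasaki w (Y w) (Z w)) z (X z))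
    (m2 : P Y X Z + P Y Z X = dAlong (fun w => F.sasaki w (X w) (Z w)) z (Y z))
    (m3 : P Z X Y + P Z Y X = dAlong (fun w => F.sasaki w (X w) (Y w)) z (Z z))
    (t1 : P X Y Z - P Y X Z = F.sasaki z (lieBr X Y z) (Z z))
    (t2 : P X Z Y - P Z X Y = F.sasaki z (lieBr X Z z) (Y z))
    (t3 : P Y Z X - P Z Y X = F.sasaki z (lieBr Y Z z) (X z)) :
    2 * P X Y Z = F.koszul X Y Z z := by
  rw [koszul]
  linarith

theorem two_mul_sasaki_eq_koszul {nab : SMConn m M} (h : F.IsLeviCivita nab) (hX : DiffAt X z)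
    (hY : DiffAt Y z) (hZ : DiffAt Z z) : 2 * F.sasaki z (nab Y z (X z)) (Z z) = F.koszul X Y Z z := by
  have met : ∀ {X Y Z : VField m M}, DiffAt Y z → DiffAt Z z →
      F.sasaki z (nab Y z (X z)) (Z z) + F.sasaki z (nab Z z (X z)) (Y z) =
        dAlong (fun w => F.sasaki w (Y w) (Z w)) z (X z) := fun {X Y Z} hY hZ => by
    rw [h.metric z Y Z hY hZ, F.sasaki_symm z (Y z)]
  have tor : ∀ {X Y Z : VField m M}, DiffAt X z → DiffAt Y z →
      F.sasaki z (nab Y z (X z)) (Z z) - F.sasaki z (nab X z (Y z)) (Z z) =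
        F.sasaki z (lieBr X Y z) (Z z) := fun {X Y Z} hX hY => by
    rw [← IsLeviCivita.sub_eq_lieBr F h hX hY, LinearMap.BilinForm.sub_left]
  exact F.koszul_unique (fun X Y Z => F.sasaki z (nab Y z (X z)) (Z z)) (met hY hZ) (met hX hZ)
    (met hX hY) (tor hX hY) (tor hX hZ) (tor hY hZ)

/-- On horizontal fields a Chern connection satisfies the Koszul formula, because the Cartan tensor
vanishes on horizontal vectors. -/
theorem IsChern.two_mul_fund_eq_koszul {C : PullConnection m M} (h : F.IsChern C) (hX : SmoothAt X z)
    (hY : SmoothAt Y z) (hZ : SmoothAt Z z) (hX' : ∀ w, X w ∈ F.hor w) (hY' : ∀ w, Y w ∈ F.hor w)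
    (hZ' : ∀ w, Z w ∈ F.hor w) :
    2 * F.fund z (C.toFun (fun w => dproj w (Y w)) z (X z)) (dproj z (Z z)) = F.koszul X Y Z z := by
  have met : ∀ {X Y Z : VField m M}, SmoothAt Y z → SmoothAt Z z → (∀ w, X w ∈ F.hor w) →
      (∀ w, Y w ∈ F.hor w) →
      F.fund z (C.toFun (fun w => dproj w (Y w)) z (X z)) (dproj z (Z z)) +
        F.fund z (C.toFun (fun w => dproj w (Z w)) z (X z)) (dproj z (Y z)) =
        dAlong (fun w => F.sasaki w (Y w) (Z w)) z (X z) := fun {X Y Z} hY hZ hX' hY' => by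
    have h1 := h.almost_metric z _ _ hY.dproj hZ.dproj (X z)
    have h2 : (fun w => F.sasaki w (Y w) (Z w)) = fun w => F.fund w (dproj w (Y w)) (dproj w (Z w)) :=
      funext fun w => F.sasaki_of_hor_left (hY' w) _
    rw [F.cartanTensor_of_hor _ _ (hX' z), F.fund_symm z (dproj z (Y z))] at h1
    rw [h2]
    linarith
  have tor : ∀ {X Y Z : VField m M}, SmoothAt X z → SmoothAt Y z → (∀ w, Z w ∈ F.hor w) →
      F.fund z (C.toFun (fun w => dproj w (Y w)) z (X z)) (dproj z (Z z)) -
        F.fund z (C.toFun (fun w => dproj w (X w)) z (Y z)) (dproj z (Z z)) =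
        F.sasaki z (lieBr X Y z) (Z z) := fun {X Y Z} hX hY hZ' => by
    rw [F.sasaki_of_hor_right _ (hZ' z), ← h.torsion_free z X Y hX hY]
    exact (LinearMap.BilinForm.sub_left (B₁ := F.fundBilin z) _ _ _).symm
  exact F.koszul_unique
    (fun X Y Z => F.fund z (C.toFun (fun w => dproj w (Y w)) z (X z)) (dproj z (Z z)))
    (met hY hZ hX' hY') (met hX hZ hY' hX') (met hX hY hZ' hX') (tor hX hY hZ') (tor hX hZ hY')
    (tor hY hZ hX')

theorem toFun_zero (C : PullConnection m M) (z : SphereBundle m M) (v : TSM z) :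
    C.toFun (fun w => (0 : PullTM w)) z v = 0 := by
  have h0 : PullDiffAt (fun w => (0 : PullTM w)) z := by
    rw [pullDiffAt_iff]
    have : pullCoord (proj m M z) (fun w => (0 : PullTM w)) = fun _ => 0 := funext fun w =>
      (fiberCoord (proj m M z) (proj m M w)).map_zero
    rw [this]
    exact mdifferentiableAt_const
  have h1 := C.leibniz (fun _ => 0) (fun w => (0 : PullTM w)) z mdifferentiableAt_const h0 v
  simpa using h1

/-- The Chern connection in vertical directions is a Lie bracket, by torsion-freeness. -/
theorem IsChern.toFun_vertProj {C : PullConnection m M} (h : F.IsChern C) (hX : SmoothAt X z)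
    (hU : SmoothAt U z) :
    C.toFun (fun w => dproj w (U w)) z (F.vertProj z (X z)) =
      dproj z (lieBr (fun w => F.vertProj w (X w)) U z) := by
  have h1 := h.torsion_free z _ U (F.smoothAt_vertProj hX) hU
  have h2 : (fun w => dproj w (F.vertProj w (X w))) = fun w => (0 : PullTM w) :=
    funext fun w => dproj_eq_zero (F.vertProj_mem w _)
  rw [h2, toFun_zero, sub_zero] at h1
  exact h1

theorem exists_hor_extension (b : PullTM z) :
    ∃ W : VField m M, SmoothAt W z ∧ (∀ w, W w ∈ F.hor w) ∧ dproj z (W z) = b := by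
  obtain ⟨v, -, rfl⟩ := F.exists_mem_hor_dproj_eq b
  obtain ⟨W, rfl, hW⟩ := exists_smooth_extension z v
  exact ⟨fun w => F.horProj w (W w), F.smoothAt_horProj (hW z (mem_coordDomain_self z)),
    fun w => F.horProj_mem w _, F.dproj_horProj z _⟩

theorem bott_mem_hor (nab : SMConn m M) (X U : VField m M) (z : SphereBundle m M) :
    F.bott nab X U z ∈ F.hor z :=
  Submodule.add_mem _ (F.horProj_mem z _) (F.horProj_mem z _)

/-- The Bott connection is the Chern connection. Both are additive in `X`; on the vertical part of `X` both
are given by the Lie bracket, on the horizontal part both satisfy the Koszul formula. -/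
theorem corresponds_bott {nab : SMConn m M} (hn : F.IsLeviCivita nab) {C : PullConnection m M}
    (hC : F.IsChern C) : F.Corresponds (F.bott nab) C := by
  intro z X U hX hU _
  refine ⟨F.bott_mem_hor nab X U z, ?_⟩
  have hX' := F.smoothAt_horProj hX
  have hU' := F.smoothAt_horProj hU
  have h1 : (fun w => dproj w (F.horProj w (U w))) = fun w => dproj w (U w) :=
    funext fun w => F.dproj_horProj w _
  have h2 : dproj z (nab (fun w => F.horProj w (U w)) z (F.horProj z (X z))) =
      C.toFun (fun w => dproj w (U w)) z (F.horProj z (X z)) := by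
    refine F.fund_ext fun b => ?_
    obtain ⟨W, hW, hW', rfl⟩ := F.exists_hor_extension b
    have h3 := F.two_mul_sasaki_eq_koszul hn hX'.diffAt hU'.diffAt hW.diffAt
    have h4 := IsChern.two_mul_fund_eq_koszul F hC hX' hU' hW (fun w => F.horProj_mem w _)
      (fun w => F.horProj_mem w _) hW'
    rw [h1] at h4
    rw [F.sasaki_of_hor_right _ (hW' z)] at h3
    linarith
  have h5 : dproj z (F.bott nab X U z) = dproj z (lieBr (fun w => F.vertProj w (X w)) U z) +
      dproj z (nab (fun w => F.horProj w (U w)) z (F.horProj z (X z))) := by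
    rw [bott, normalConn, map_add, F.dproj_horProj, F.dproj_horProj]
  rw [h5, h2, ← IsChern.toFun_vertProj F hC hX hU, add_comm, ← map_add, F.horProj_add_vertProj]

/-! ### The dual connection and the Cartan endomorphism -/

section Dual
variable {D : Op m M} {C : PullConnection m M}

theorem sub_fund_left (z : SphereBundle m M) (a a' b : PullTM z) :
    F.fund z (a - a') b = F.fund z a b - F.fund z a' b :=
  LinearMap.BilinForm.sub_left (B₁ := F.fundBilin z) a a' b

/-- The values of the dual connection: `g(D*_X U, b) = g(D_X U, b) + 2 A(U, b, δy(X))`. -/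
theorem isDualValue_iff (hC : F.IsChern C) (hD : F.Corresponds D C) (hX : SmoothAt X z)
    (hU : SmoothAt U z) (b : TSM z) :
    F.IsDualValue D X U z b ↔ b ∈ F.hor z ∧ ∀ c, F.fund z (dproj z b) c =
      F.fund z (C.toFun (fun w => dproj w (U w)) z (X z)) c +
        2 * F.cartanTensor z (dproj z (U z)) c (X z) := by
  refine and_congr_right fun hb => ?_
  have key : ∀ V : VField m M, SmoothAt V z → F.HorizontalNear V z →
      (dAlong (fun w => F.sasaki w (V w) (U w)) z (X z) =
        F.sasaki z (D X V z) (U z) + F.sasaki z (V z) b ↔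
      F.fund z (dproj z b) (dproj z (V z)) =
        F.fund z (C.toFun (fun w => dproj w (U w)) z (X z)) (dproj z (V z)) +
          2 * F.cartanTensor z (dproj z (U z)) (dproj z (V z)) (X z)) := by
    intro V hV hV'
    have h1 : (fun w => F.sasaki w (V w) (U w)) =ᶠ[𝓝 z]
        fun w => F.fund w (dproj w (V w)) (dproj w (U w)) :=
      hV'.mono fun w hw => F.sasaki_of_hor_left hw _
    have h2 := hC.almost_metric z _ _ hV.dproj hU.dproj (X z)
    obtain ⟨h3, h4⟩ := hD z X V hX hV hV'
    rw [dAlong_congr h1, F.sasaki_of_hor_left h3, h4, F.sasaki_of_hor_left hV'.self_of_nhds,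
      F.fund_symm z (dproj z b), F.fund_symm z _ (dproj z (V z)),
      F.cartanTensor_symm z (dproj z (U z))]
    constructor <;> intro h <;> linarith
  constructor
  · intro h c
    obtain ⟨V, hV, hV', rfl⟩ := F.exists_hor_extension c
    exact (key V hV (.of_forall hV')).1 (h V hV (.of_forall hV'))
  · intro h V hV hV'
    exact (key V hV hV').2 (h _)

theorem exists_isDualValue (hC : F.IsChern C) (hD : F.Corresponds D C) (hX : SmoothAt X z)
    (hU : SmoothAt U z) : ∃ b, F.IsDualValue D X U z b := by
  let φ : PullTM z →ₗ[ℝ] ℝ :=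
    { toFun := fun c => F.fund z (C.toFun (fun w => dproj w (U w)) z (X z)) c +
        2 * F.cartanTensor z (dproj z (U z)) c (X z)
      map_add' := fun c c' => by rw [fund_add_right, cartanTensor_add_right]; ring
      map_smul' := fun r c => by
        rw [fund_smul_right, cartanTensor_smul_right, RingHom.id_apply, smul_eq_mul]; ring }
  obtain ⟨a, ha⟩ := F.exists_fund_eq z φ
  obtain ⟨b, hb, rfl⟩ := F.exists_mem_hor_dproj_eq a
  exact ⟨b, (F.isDualValue_iff hC hD hX hU b).2 ⟨hb, ha⟩⟩

theorem isDualValue_dualConn (hC : F.IsChern C) (hD : F.Corresponds D C) (hX : SmoothAt X z)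
    (hU : SmoothAt U z) : F.IsDualValue D X U z (F.dualConn D X U z) := by
  have h := F.exists_isDualValue hC hD hX hU
  rw [dualConn, dif_pos h]
  exact h.choose_spec

/-- The Cartan endomorphism is the Cartan tensor: `⟨H(X) U, b⟩ = A(U, b, δy(X))`. -/
theorem cartanEndo_spec (hC : F.IsChern C) (hD : F.Corresponds D C) (hX : SmoothAt X z)
    (hU : SmoothAt U z) (hU' : F.HorizontalNear U z) :
    F.cartanEndo D X U z ∈ F.hor z ∧ ∀ c, F.fund z (dproj z (F.cartanEndo D X U z)) c =
      F.cartanTensor z (dproj z (U z)) c (X z) := by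
  obtain ⟨h1, h2⟩ := (F.isDualValue_iff hC hD hX hU _).1 (F.isDualValue_dualConn hC hD hX hU)
  obtain ⟨h3, h4⟩ := hD z X U hX hU hU'
  refine ⟨Submodule.smul_mem _ _ (Submodule.sub_mem _ h1 h3), fun c => ?_⟩
  rw [cartanEndo, map_smul, map_sub, fund_smul_left, sub_fund_left, h2, h4]
  ring

/-- If `D` is the Chern connection and `C'` is obtained from it by adding the Cartan tensor, then `C'` is
the symmetrization of `D`. -/
theorem corresponds_symmetrization (hC : F.IsChern C) (hD : F.Corresponds D C)
    {C' : PullConnection m M}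
    (h : ∀ (z : SphereBundle m M) (s : PullSection m M), PullSmoothAt s z →
      ∀ (X : TSM z) (b : PullTM z),
        F.fund z (C'.toFun s z X) b = F.fund z (C.toFun s z X) b + F.cartanTensor z (s z) b X) :
    F.Corresponds (F.symmetrization D) C' := by
  intro z X U hX hU hU'
  obtain ⟨h1, h2⟩ := F.cartanEndo_spec hC hD hX hU hU'
  obtain ⟨h3, h4⟩ := hD z X U hX hU hU'
  refine ⟨Submodule.add_mem _ h3 h1, F.fund_ext fun b => ?_⟩
  rw [symmetrization, map_add, fund_add_left, h2, h4, h z _ hU.dproj]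

end Dual

/-! ### The Cartan connection -/

theorem exists_cartanMap (z : SphereBundle m M) (a : PullTM z) :
    ∃ T : TSM z →L[ℝ] PullTM z, ∀ X b, F.fund z (T X) b = F.cartanTensor z a b X := by
  have : FiniteDimensional ℝ (PullTM z) := inferInstanceAs (FiniteDimensional ℝ (Base m))
  let L : TSM z →ₗ[ℝ] Module.Dual ℝ (PullTM z) := LinearMap.flip
    { toFun := fun b => F.cartanForm z a b
      map_add' := fun b b' => by
        ext X
        simp only [LinearMap.add_apply, cartanForm_apply, cartanTensor_add_right]
      map_smul' := fun c b => by
        ext X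
        simp only [LinearMap.smul_apply, cartanForm_apply, cartanTensor_smul_right, smul_eq_mul,
          RingHom.id_apply] }
  let T : SMModel m →L[ℝ] Base m := LinearMap.toContinuousLinearMap (E := SMModel m) (F' := Base m)
    (((F.fundBilin z).toDual (F.nondegenerate_fundBilin z)).symm.toLinearMap ∘ₗ L)
  refine ⟨T, fun X b => ?_⟩
  refine (LinearMap.BilinForm.apply_toDual_symm_apply (hB := F.nondegenerate_fundBilin z) (L X) b).trans
    (F.cartanForm_apply z a b X)

/-- The endomorphism-valued one-form `A` with one index raised. -/
def cartanMap (z : SphereBundle m M) (a : PullTM z) : TSM z →L[ℝ] PullTM z :=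
  (F.exists_cartanMap z a).choose

theorem fund_cartanMap (z : SphereBundle m M) (a b : PullTM z) (X : TSM z) :
    F.fund z (F.cartanMap z a X) b = F.cartanTensor z a b X :=
  (F.exists_cartanMap z a).choose_spec X b

/-- The Cartan connection. -/
def cartan : PullConnection m M where
  toFun s z := F.chern.toFun s z + F.cartanMap z (s z)
  add s t z hs ht X := by
    have h : F.cartanMap z (s z + t z) X = F.cartanMap z (s z) X + F.cartanMap z (t z) X :=
      F.fund_ext fun b => by simp only [fund_add_left, fund_cartanMap, cartanTensor_add_left]
    rw [_root_.add_apply, _root_.add_apply, _root_.add_apply, F.chern.add s t z hs ht, h]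
    abel
  leibniz f s z hf hs X := by
    have h : F.cartanMap z (f z • s z) X = f z • F.cartanMap z (s z) X :=
      F.fund_ext fun b => by simp only [fund_smul_left, fund_cartanMap, cartanTensor_smul_left]
    rw [_root_.add_apply, _root_.add_apply, F.chern.leibniz f s z hf hs, h]
    module

theorem isCartan_cartan : F.IsCartan F.cartan :=
  ⟨F.chern, F.isChern_chern, fun z s _ X b => by
    rw [← fund_cartanMap, ← fund_add_left]
    rfl⟩

end FinslerStructure

/-! ### Smoothness of the Koszul expression -/

namespace FinslerStructure
variable {m : ℕ} {M : Type*} [TopologicalSpace M] [ChartedSpace (Base m) M]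
  [IsManifold (𝓡 (m + 1)) ∞ M] (F : FinslerStructure m M) {X Y Z : VField m M}
  {z : SphereBundle m M} {s t : Set (SphereBundle m M)} {e : Fin (m + 1) → VField m M}

theorem contMDiffAt_dAlong {f : SphereBundle m M → ℝ} (ht : IsOpen t)
    (hf : ∀ w ∈ t, ContMDiffAt 𝓘(ℝ, SMModel m) 𝓘(ℝ, ℝ) ∞ f w) (hz : z ∈ t) (hX : SmoothAt X z) :
    ContMDiffAt 𝓘(ℝ, SMModel m) 𝓘(ℝ, ℝ) ∞ (fun w => dAlong f w (X w)) z :=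
  contMDiffAt_mvfderiv_apply ht (fun w hw => (hf w hw).contMDiffWithinAt) hz hX

theorem contMDiffAt_koszul (ht : IsOpen t) (hX : ∀ w ∈ t, SmoothAt X w) (hY : ∀ w ∈ t, SmoothAt Y w)
    (hZ : ∀ w ∈ t, SmoothAt Z w) (hz : z ∈ t) :
    ContMDiffAt 𝓘(ℝ, SMModel m) 𝓘(ℝ, ℝ) ∞ (F.koszul X Y Z) z := by
  have h1 := contMDiffAt_dAlong ht (fun w hw => F.contMDiffAt_sasaki (hY w hw) (hZ w hw)) hz (hX z hz)
  have h2 := contMDiffAt_dAlong ht (fun w hw => F.contMDiffAt_sasaki (hX w hw) (hZ w hw)) hz (hY z hz)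
  have h3 := contMDiffAt_dAlong ht (fun w hw => F.contMDiffAt_sasaki (hX w hw) (hY w hw)) hz (hZ z hz)
  have h4 := F.contMDiffAt_sasaki ((hX z hz).lieBr (hY z hz)) (hZ z hz)
  have h5 := F.contMDiffAt_sasaki ((hX z hz).lieBr (hZ z hz)) (hY z hz)
  have h6 := F.contMDiffAt_sasaki ((hY z hz).lieBr (hZ z hz)) (hX z hz)
  exact ((((h1.add h2).sub h3).add h4).sub h5).sub h6

/-! ### The connection matrix in an adapted frame -/

theorem coframe_apply (e : Fin (m + 1) → VField m M) (i : Fin (m + 1)) (z : SphereBundle m M)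
    (v : TSM z) : F.coframe e i z v = F.sasaki z (e i z) v := rfl

theorem IsAdaptedFrame.fund_eq (h : F.IsAdaptedFrame s e) (hz : z ∈ s) (i j : Fin (m + 1)) :
    F.fund z (dproj z (e i z)) (dproj z (e j z)) = if i = j then 1 else 0 := by
  rw [← F.sasaki_of_hor_left (h.horizontal i z hz), h.orthonormal i j z hz]

/-- The expansion of a vector in the orthonormal basis given by an adapted frame. -/
theorem IsAdaptedFrame.sum_eq (h : F.IsAdaptedFrame s e) (hz : z ∈ s) (a : PullTM z) :
    ∑ j, F.fund z a (dproj z (e j z)) • dproj z (e j z) = a := by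
  have fd : FiniteDimensional ℝ (PullTM z) := inferInstanceAs (FiniteDimensional ℝ (Base m))
  let b : Fin (m + 1) → PullTM z := fun j => dproj z (e j z)
  have hb : ∀ (c : Fin (m + 1) → ℝ) (j : Fin (m + 1)), F.fund z (∑ i, c i • b i) (b j) = c j := by
    intro c j
    rw [← fundBilin_apply, map_sum, LinearMap.sum_apply]
    simp only [map_smul, LinearMap.smul_apply, fundBilin_apply, smul_eq_mul]
    rw [Finset.sum_eq_single j]
    · rw [IsAdaptedFrame.fund_eq F h hz, if_pos rfl, mul_one]
    · intro i _ hij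
      rw [IsAdaptedFrame.fund_eq F h hz, if_neg hij, mul_zero]
    · simp
  have hli : LinearIndependent ℝ b := by
    rw [Fintype.linearIndependent_iff]
    intro c hc i
    rw [← hb c i, hc, ← fundBilin_apply, map_zero, LinearMap.zero_apply]
  have hcard : Fintype.card (Fin (m + 1)) = Module.finrank ℝ (PullTM z) := by
    change _ = Module.finrank ℝ (Base m)
    rw [finrank_euclideanSpace]
  let B := basisOfLinearIndependentOfCardEqFinrank hli hcard
  have h1 : ∑ j, B.repr a j • b j = a := by
    conv_rhs => rw [← B.sum_repr a]
    exact Finset.sum_congr rfl fun j _ => by rw [coe_basisOfLinearIndependentOfCardEqFinrank]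
  have h2 : ∀ j, F.fund z a (b j) = B.repr a j := fun j => by
    conv_lhs => rw [← h1]
    exact hb _ j
  conv_rhs => rw [← h1]
  exact Finset.sum_congr rfl fun j _ => by rw [← h2]

theorem IsAdaptedFrame.horizontalNear (h : F.IsAdaptedFrame s e) (hs : IsOpen s) (hz : z ∈ s)
    (i : Fin (m + 1)) : F.HorizontalNear (e i) z := by
  filter_upwards [hs.mem_nhds hz] with w hw using h.horizontal i w hw

/-- The matrix `g(∇e_i, e_j)` of one-forms of the Chern connection. -/
def chernForms (e : Fin (m + 1) → VField m M) : FormMatrix m M := fun i j z =>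
  (F.fundBilin z).flip (dproj z (e j z)) ∘ₗ (F.chern.toFun (fun w => dproj w (e i w)) z).toLinearMap

theorem chernForms_apply (e : Fin (m + 1) → VField m M) (i j : Fin (m + 1)) (z : SphereBundle m M)
    (v : TSM z) : F.chernForms e i j z v =
      F.fund z (F.chern.toFun (fun w => dproj w (e i w)) z v) (dproj z (e j z)) := rfl

theorem isConnectionMatrix_chernForms {nab : SMConn m M} (hn : F.IsLeviCivita nab) (hs : IsOpen s)
    (h : F.IsAdaptedFrame s e) : IsConnectionMatrix (F.bott nab) s e (F.chernForms e) := by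
  intro z hz X hX i
  obtain ⟨h1, h2⟩ := F.corresponds_bott hn F.isChern_chern z X (e i) hX (h.smooth i z hz)
    (IsAdaptedFrame.horizontalNear F h hs hz i)
  refine F.dproj_injOn_hor h1 (Submodule.sum_mem _ fun j _ => Submodule.smul_mem _ _
    (h.horizontal j z hz)) ?_
  rw [map_sum]
  simp only [map_smul]
  rw [h2]
  exact (IsAdaptedFrame.sum_eq F h hz _).symm

/-- The metric equation of the Chern connection in an adapted frame. -/
theorem chernForms_add (hs : IsOpen s) (h : F.IsAdaptedFrame s e) (hz : z ∈ s) (i j : Fin (m + 1))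
    (v : TSM z) : F.chernForms e i j z v + F.chernForms e j i z v =
      -2 * F.cartanTensor z (dproj z (e i z)) (dproj z (e j z)) v := by
  have h1 := F.isChern_chern.almost_metric z _ _ (h.smooth i z hz).dproj (h.smooth j z hz).dproj v
  have h2 : (fun w => F.fund w (dproj w (e i w)) (dproj w (e j w))) =ᶠ[𝓝 z]
      fun _ => if i = j then 1 else 0 := by
    filter_upwards [hs.mem_nhds hz] with w hw using IsAdaptedFrame.fund_eq F h hw i j
  rw [dAlong_congr h2, dAlong_const, F.fund_symm z (dproj z (e i z))] at h1
  rw [chernForms_apply, chernForms_apply]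
  linarith

/-- The derivative of the coframe along a vector, in terms of the covariant derivative. -/
theorem dAlong_coframe (hs : IsOpen s) (h : F.IsAdaptedFrame s e) (hz : z ∈ s) (i : Fin (m + 1))
    (hY : SmoothAt Y z) (v : TSM z) :
    dAlong (fun w => F.coframe e i w (Y w)) z v =
      F.fund z (dproj z (e i z)) (F.chern.toFun (fun w => dproj w (Y w)) z v) -
        ∑ j, F.coframe e j z (Y z) * F.chernForms e j i z v := by
  have h1 : (fun w => F.coframe e i w (Y w)) =ᶠ[𝓝 z]
      fun w => F.fund w (dproj w (e i w)) (dproj w (Y w)) := by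
    filter_upwards [hs.mem_nhds hz] with w hw using F.sasaki_of_hor_left (h.horizontal i w hw) _
  have h2 := F.isChern_chern.almost_metric z _ _ (h.smooth i z hz).dproj hY.dproj v
  have h3 : ∀ j, F.fund z (dproj z (Y z)) (dproj z (e j z)) = F.coframe e j z (Y z) := fun j => by
    rw [coframe_apply, F.sasaki_of_hor_left (h.horizontal j z hz), F.fund_symm]
  have h4 : F.fund z (F.chern.toFun (fun w => dproj w (e i w)) z v) (dproj z (Y z)) =
      ∑ j, F.coframe e j z (Y z) * F.chernForms e i j z v := by
    conv_lhs => rw [← IsAdaptedFrame.sum_eq F h hz (dproj z (Y z))]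
    rw [← fundBilin_apply, map_sum]
    refine Finset.sum_congr rfl fun j _ => ?_
    rw [map_smul, fundBilin_apply, h3, smul_eq_mul, chernForms_apply]
  have h5 : F.cartanTensor z (dproj z (e i z)) (dproj z (Y z)) v =
      ∑ j, F.coframe e j z (Y z) * F.cartanTensor z (dproj z (e i z)) (dproj z (e j z)) v := by
    let A : PullTM z →ₗ[ℝ] ℝ :=
      { toFun := fun b => F.cartanTensor z (dproj z (e i z)) b v
        map_add' := fun b b' => F.cartanTensor_add_right z _ b b' v
        map_smul' := fun c b => F.cartanTensor_smul_right z c _ b v }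
    change A (dproj z (Y z)) = ∑ j, F.coframe e j z (Y z) * A (dproj z (e j z))
    conv_lhs => rw [← IsAdaptedFrame.sum_eq F h hz (dproj z (Y z))]
    rw [map_sum]
    exact Finset.sum_congr rfl fun j _ => by rw [map_smul, h3, smul_eq_mul]
  have h6 : ∑ j, F.coframe e j z (Y z) * F.chernForms e j i z v =
      -∑ j, F.coframe e j z (Y z) * F.chernForms e i j z v -
        2 * ∑ j, F.coframe e j z (Y z) *
          F.cartanTensor z (dproj z (e i z)) (dproj z (e j z)) v := by
    rw [Finset.mul_sum, ← Finset.sum_neg_distrib, ← Finset.sum_sub_distrib]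
    refine Finset.sum_congr rfl fun j _ => ?_
    have := F.chernForms_add hs h hz i j v
    linear_combination F.coframe e j z (Y z) * this
  rw [dAlong_congr h1, h6, ← h4, ← h5]
  linarith

theorem structureEquations_chernForms {nab : SMConn m M} (hn : F.IsLeviCivita nab) (hs : IsOpen s)
    (h : F.IsAdaptedFrame s e) :
    F.StructureEquations (F.cartanEndo (F.bott nab)) s e (F.chernForms e) where
  first z hz X Y hX hY i := by
    have h1 := F.isChern_chern.torsion_free z X Y hX hY
    have h2 : F.coframe e i z (lieBr X Y z) =
        F.fund z (dproj z (e i z)) (F.chern.toFun (fun w => dproj w (Y w)) z (X z)) -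
          F.fund z (dproj z (e i z)) (F.chern.toFun (fun w => dproj w (X w)) z (Y z)) := by
      rw [coframe_apply, F.sasaki_of_hor_left (h.horizontal i z hz), ← h1]
      exact LinearMap.BilinForm.sub_right (B₁ := F.fundBilin z) _ _ _
    rw [extD, F.dAlong_coframe hs h hz i hY, F.dAlong_coframe hs h hz i hX, h2,
      Finset.sum_sub_distrib]
    ring
  second z hz X hX i j := by
    obtain ⟨h1, h2⟩ := F.cartanEndo_spec F.isChern_chern (F.corresponds_bott hn F.isChern_chern) hX
      (h.smooth i z hz) (IsAdaptedFrame.horizontalNear F h hs hz i)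
    rw [F.chernForms_add hs h hz, F.sasaki_of_hor_left h1, h2]

/-- A tensor `d` that is antisymmetric by the metric equation and symmetric by the torsion equation
vanishes; hence the structure equations have at most one solution. -/
theorem structureEquations_unique {H : Op m M} (h : F.IsAdaptedFrame s e) {om om' : FormMatrix m M}
    (h1 : F.StructureEquations H s e om) (h2 : F.StructureEquations H s e om') (i j : Fin (m + 1))
    (hz : z ∈ s) : om' i j z = om i j z := by
  let d : Fin (m + 1) → Fin (m + 1) → TSM z →ₗ[ℝ] ℝ := fun i j => om' i j z - om i j z
  have anti : ∀ i j v, d i j v = -d j i v := by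
    intro i j v
    obtain ⟨X, rfl, hX⟩ := exists_smooth_extension z v
    have e1 := h1.second z hz X (hX z (mem_coordDomain_self z)) i j
    have e2 := h2.second z hz X (hX z (mem_coordDomain_self z)) i j
    simp only [d, LinearMap.sub_apply]
    linarith
  have sym : ∀ i u v, ∑ k, F.coframe e k z u * d k i v = ∑ k, F.coframe e k z v * d k i u := by
    intro i u v
    obtain ⟨X, rfl, hX⟩ := exists_smooth_extension z u
    obtain ⟨Y, rfl, hY⟩ := exists_smooth_extension z v
    have e1 := h1.first z hz X Y (hX z (mem_coordDomain_self z)) (hY z (mem_coordDomain_self z)) i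
    have e2 := h2.first z hz X Y (hX z (mem_coordDomain_self z)) (hY z (mem_coordDomain_self z)) i
    rw [e1] at e2
    simp only [d, LinearMap.sub_apply, mul_sub, Finset.sum_sub_distrib] at e2 ⊢
    linarith
  have hcof : ∀ (k : Fin (m + 1)) (c : Fin (m + 1) → ℝ),
      ∑ l, F.coframe e l z (e k z) * c l = c k := by
    intro k c
    simp only [coframe_apply, h.orthonormal _ _ z hz, ite_mul, one_mul, zero_mul, Finset.sum_ite_eq',
      Finset.mem_univ, if_true]
  have hd : ∀ k i l, d k i (e l z) = 0 := by
    -- Antisymmetry in the first two indices and symmetry in the outer two force `d` to vanish.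
    have swap : ∀ k i l, d k i (e l z) = d l i (e k z) := fun k i l => by
      have := sym i (e k z) (e l z)
      rwa [hcof k fun k => d k i (e l z), hcof l fun l => d l i (e k z)] at this
    intro k i l
    have a1 := swap k i l
    have a2 := anti l i (e k z)
    have a3 := swap i l k
    have a4 := anti k l (e i z)
    have a5 := swap l k i
    have a6 := anti i k (e l z)
    linarith
  have h0 : ∀ v, d i j v = 0 := fun v => by
    have := sym j (e i z) v
    rw [hcof i fun k => d k j v] at this
    rw [this]
    exact Finset.sum_eq_zero fun k _ => by rw [hd, mul_zero]
  ext v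
  exact sub_eq_zero.1 (h0 v)

/-! ### Smoothness of the connection matrix -/

/-- Along a field that is smooth near `z`, the vertical part of the connection matrix is given by Lie
brackets and the horizontal part by the Koszul formula. -/
theorem contMDiffAt_chernForms_of_smooth (hs : IsOpen s) (h : F.IsAdaptedFrame s e) (ht : IsOpen t)
    (hX : ∀ w ∈ t, SmoothAt X w) (hz : z ∈ s) (hzt : z ∈ t) (i j : Fin (m + 1)) :
    ContMDiffAt 𝓘(ℝ, SMModel m) 𝓘(ℝ, ℝ) ∞ (fun w => F.chernForms e i j w (X w)) z := by
  have ho : IsOpen (s ∩ t) := hs.inter ht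
  have hE : ∀ k, ∀ w ∈ s ∩ t, SmoothAt (fun w => F.horProj w (e k w)) w := fun k w hw =>
    F.smoothAt_horProj (h.smooth k w hw.1)
  have h1 := F.contMDiffAt_koszul ho (fun w hw => F.smoothAt_horProj (hX w hw.2)) (hE i) (hE j)
    ⟨hz, hzt⟩
  have h2 := F.contMDiffAt_fund ((F.smoothAt_vertProj (hX z hzt)).lieBr (h.smooth i z hz)).dproj
    (h.smooth j z hz).dproj
  refine ContMDiffAt.congr_of_eventuallyEq (h2.add
    ((contMDiffAt_const (c := (1 / 2 : ℝ))).mul h1)) ?_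
  filter_upwards [ho.mem_nhds ⟨hz, hzt⟩] with w hw
  have e1 : (fun w => dproj w (F.horProj w (e i w))) = fun w => dproj w (e i w) :=
    funext fun w => F.dproj_horProj w _
  have e2 := IsChern.two_mul_fund_eq_koszul F F.isChern_chern (F.smoothAt_horProj (hX w hw.2))
    (hE i w hw) (hE j w hw) (fun w => F.horProj_mem w _) (fun w => F.horProj_mem w _)
    (fun w => F.horProj_mem w _)
  rw [e1, F.dproj_horProj] at e2
  have e3 := IsChern.toFun_vertProj F F.isChern_chern (hX w hw.2) (h.smooth i w hw.1)
  rw [← F.horProj_add_vertProj w (X w), map_add, chernForms_apply, chernForms_apply, e3]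
  change _ = _ + 1 / 2 * F.koszul _ _ _ w
  rw [← e2]
  ring

/-- A field that is only smooth at `z` is a combination of coordinate fields, which are smooth in a
neighbourhood, with coefficients that are smooth at `z`. -/
theorem smoothForms_chernForms (hs : IsOpen s) (h : F.IsAdaptedFrame s e) :
    SmoothForms s (F.chernForms e) := by
  intro i j z hz X hX
  have hzd := mem_coordDomain_self z
  have hc := (smoothAt_iff hzd).1 hX
  let E₁ : Fin (m + 1) → VField m M := fun k w =>
    ofCoord (proj m M z) w (EuclideanSpace.single k 1, 0)
  let E₂ : Fin (m + 1) → VField m M := fun k w =>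
    ofCoord (proj m M z) w (0, EuclideanSpace.single k 1)
  have hE₁ : ∀ k, ∀ w ∈ coordDomain (proj m M z), SmoothAt (E₁ k) w := fun k w hw =>
    smoothAt_ofCoord hw contMDiffAt_const
  have hE₂ : ∀ k, ∀ w ∈ coordDomain (proj m M z), SmoothAt (E₂ k) w := fun k w hw =>
    smoothAt_ofCoord hw contMDiffAt_const
  have c1 : ∀ k, ContMDiffAt 𝓘(ℝ, SMModel m) 𝓘(ℝ, ℝ) ∞
      (fun w => (dCoord (proj m M z) w (X w)).1 k) z := fun k =>
    (((EuclideanSpace.proj (𝕜 := ℝ) k).contDiff.comp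
      (contDiff_fst (𝕜 := ℝ) (E := Base m) (F := Base m))).contMDiff.contMDiffAt (n := ∞)).comp z hc
  have c2 : ∀ k, ContMDiffAt 𝓘(ℝ, SMModel m) 𝓘(ℝ, ℝ) ∞
      (fun w => (dCoord (proj m M z) w (X w)).2 k) z := fun k =>
    (((EuclideanSpace.proj (𝕜 := ℝ) k).contDiff.comp
      (contDiff_snd (𝕜 := ℝ) (E := Base m) (F := Base m))).contMDiff.contMDiffAt (n := ∞)).comp z hc
  have h1 : ContMDiffAt 𝓘(ℝ, SMModel m) 𝓘(ℝ, ℝ) ∞ (fun w =>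
      ∑ k, (dCoord (proj m M z) w (X w)).1 k * F.chernForms e i j w (E₁ k w) +
      ∑ k, (dCoord (proj m M z) w (X w)).2 k * F.chernForms e i j w (E₂ k w)) z :=
    (ContMDiffAt.sum fun k _ => (c1 k).mul (F.contMDiffAt_chernForms_of_smooth hs h
      (isOpen_coordDomain _) (hE₁ k) hz hzd i j)).add
    (ContMDiffAt.sum fun k _ => (c2 k).mul (F.contMDiffAt_chernForms_of_smooth hs h
      (isOpen_coordDomain _) (hE₂ k) hz hzd i j))
  refine h1.congr_of_eventuallyEq ?_
  filter_upwards [coordDomain_mem_nhds hzd] with w hw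
  let T : Base m × Base m →L[ℝ] SMModel m := ofCoord (proj m M z) w
  have e1 : X w = ∑ k, (dCoord (proj m M z) w (X w)).1 k • E₁ k w +
      ∑ k, (dCoord (proj m M z) w (X w)).2 k • E₂ k w := by
    have e2 : X w = T ((dCoord (proj m M z) w (X w)).1, 0) +
        T (0, (dCoord (proj m M z) w (X w)).2) := by
      rw [← map_add, Prod.mk_add_mk, add_zero, zero_add]
      exact (ofCoord_dCoord hw (X w)).symm
    rw [clm_fst_eq_sum T, clm_snd_eq_sum T] at e2
    exact e2
  conv_lhs => rw [e1]
  simp only [map_add, map_sum, map_smul, smul_eq_mul]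

end FinslerStructure

end Finsler

theorem theorem1 {m : ℕ} {M : Type*} [TopologicalSpace M]
    [ChartedSpace (EuclideanSpace ℝ (Fin (m + 1))) M] [IsManifold (𝓡 (m + 1)) ∞ M]
    (F : Finsler.FinslerStructure m M) :
    (∃ nab : Finsler.SMConn m M, F.IsLeviCivita nab) ∧
    (∃ C, F.IsChern C) ∧ (∃ C, F.IsCartan C) ∧
    ∀ nab : Finsler.SMConn m M, F.IsLeviCivita nab →
      (∀ (s : Set (Finsler.SphereBundle m M)) (e : Fin (m + 1) → Finsler.VField m M),
        IsOpen s → F.IsAdaptedFrame s e →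
        ∃ om : Finsler.FormMatrix m M,
          Finsler.SmoothForms s om ∧
          Finsler.IsConnectionMatrix (F.bott nab) s e om ∧
          F.StructureEquations (F.cartanEndo (F.bott nab)) s e om ∧
          (∀ om' : Finsler.FormMatrix m M,
            F.StructureEquations (F.cartanEndo (F.bott nab)) s e om' →
              ∀ i j, ∀ z ∈ s, om' i j z = om i j z)) ∧
      (∀ C, F.IsChern C → F.Corresponds (F.bott nab) C) ∧
      (∀ C, F.IsCartan C → F.Corresponds (F.symmetrization (F.bott nab)) C) := by
  refine ⟨⟨_, F.isLeviCivita_leviCivita⟩, ⟨_, F.isChern_chern⟩, ⟨_, F.isCartan_cartan⟩,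
    fun nab hn => ⟨fun s e hs h => ⟨F.chernForms e, F.smoothForms_chernForms hs h,
      F.isConnectionMatrix_chernForms hn hs h, F.structureEquations_chernForms hn hs h,
      fun om' h' i j z hz =>
        F.structureEquations_unique h (F.structureEquations_chernForms hn hs h) h' i j hz⟩,
    fun C hC => F.corresponds_bott hn hC,
    fun C ⟨C₀, h₀, h⟩ => F.corresponds_symmetrization h₀ (F.corresponds_bott hn h₀) h⟩⟩
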